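/- Let $d\in\mathbb N_0$, let $\Omega\subset\mathbb R^d$ be open with $0\in\Omega$, and let the scalar field $\mathbb K$ be $\mathbb R$ or $\mathbb C$. Write $xy$, $1/x$ for coordinatewise product and reciprocal, $\mathbb R_*=\mathbb R\setminus\{0\}$, $\theta_j=x_j\partial_j$ and $\theta^\beta=\theta_1^{\beta_1}\cdots\theta_d^{\beta_d}$. A map $L:\mathscr D'(\Omega)\to\mathscr D'(\Omega)$ is called a Hadamard operator if it is linear and continuous and for every $\alpha\in\mathbb N_0^d$ there is $m_\alpha\in\mathbb K$ with $L(x^\alpha)=m_\alpha x^\alpha$. Let $\mathcal O'_H$ be the set of all $T\in\mathscr D'(\mathbb R^d)$ such that for every $k\in\mathbb N_0$ there are finitely many functions $t_\beta$ with $(1+|x|^2)^{k/2}t_\beta\in L_\infty(\mathbb R^d)$ and $T=\sum_\beta\theta^\beta t_\beta$. Let $\mathscr D'_H$ be the set of all $T\in\mathcal O'_H$ such that for some $\varepsilon>0$ one has $|x_j|\ge\varepsilon$ for all $x\in\operatorname{supp}T$ and all $j$ (that is, $\operatorname{supp}T$ has positive distance to all coordinate hyperplanes). For $S\in\mathscr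 D'(\Omega)$ and $T\in\mathscr D'(\mathbb R^d)$ we say that $S\star T$ is defined on $\Omega$, and given by $(S\star T)\varphi=S_y(T_x\varphi(xy))$, if for every $\varphi\in\mathscr D(\Omega)$ the function $y\mapsto T_x\varphi(xy)$, $y\in\mathbb R_*^d$, has a (necessarily unique) extension to $\mathbb R^d$ that belongs to $\mathscr D(\Omega)$; $S$ is applied to this extension. Theorem. A map $L:\mathscr D'(\Omega)\to\mathscr D'(\Omega)$ is a Hadamard operator if and only if there is $T\in\mathscr D'_H$ such that 1. for every compact $K\subset\Omega$ the set $(1/\operatorname{supp}T)K=\{x/\xi:\xi\in\operatorname{supp}T,\ x\in K\}$ is relatively compact in $\Omega$, that is, its closure is compact and contained in $\Omega$, and 2. for all $S\in\mathscr D'(\Omega)$, $S\star T$ is defined on $\Omega$ and $L(S)=S\star T$. Moreover, for every $T\in\mathscr D'_H$ with property 1 and every $S\in\mathscr D'(\Omega)$, $S\star T$ is defined on $\Omega$ and is an element of $\mathscr D'(\Omega)$. -/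

import Mathlib

open MeasureTheory TopologicalSpace
open scoped Distributions CompactConvergenceCLM

noncomputable section

namespace HadamardOp

/-- `𝓓'(Ω)` for an open set `Ω ⊆ ℝ^d` and the scalar field `𝕜` (`ℝ` or `ℂ`): the continuous
`𝕜`-linear forms on the LF-space `𝓓(Ω)` of `𝕜`-valued test functions, with the topology of uniform
convergence on compact sets. As `𝓓(Ω)` is a Montel space, this is the strong dual topology. -/
abbrev Dist (𝕜 : Type*) [RCLike 𝕜] {d : ℕ} (Ω : Opens (Fin d → ℝ)) : Type _ :=
  𝓓(Ω, 𝕜) →L_c[𝕜] 𝕜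

section

variable {𝕜 : Type*} [RCLike 𝕜] {d : ℕ} {Ω : Opens (Fin d → ℝ)}

/-- The function `x ↦ x^α = ∏ j, x_j ^ α_j` on `ℝ^d`. -/
def monomialFun (𝕜 : Type*) [RCLike 𝕜] {d : ℕ} (α : Fin d → ℕ) (x : Fin d → ℝ) : 𝕜 :=
  ((∏ j, x j ^ α j : ℝ) : 𝕜)

theorem continuous_monomialFun (α : Fin d → ℕ) : Continuous (monomialFun 𝕜 α) := by
  unfold monomialFun
  fun_prop

/-- The monomial `x^α` as a distribution on `Ω`, see `monomialDist_apply`. -/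
def monomialDist (α : Fin d → ℕ) : Dist 𝕜 Ω :=
  (TestFunction.integralAgainstBilinCLM (ContinuousLinearMap.mul 𝕜 𝕜) volume
    (monomialFun 𝕜 α) : 𝓓(Ω, 𝕜) →L[𝕜] 𝕜)

theorem monomialDist_apply (α : Fin d → ℕ) (φ : 𝓓(Ω, 𝕜)) :
    (monomialDist α : Dist 𝕜 Ω) φ = ∫ x, φ x * monomialFun 𝕜 α x := by
  have h : LocallyIntegrableOn (monomialFun 𝕜 α) (Ω : Set (Fin d → ℝ)) volume :=
    (continuous_monomialFun α).locallyIntegrable.locallyIntegrableOn _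
  exact TestFunction.integralAgainstBilinCLM_eq_integral h

/-- A map on `𝓓'(Ω)` is a Hadamard operator if it is linear and continuous and admits all monomials
as eigenvectors (they are nonzero as soon as `Ω` is non-empty). -/
structure IsHadamardOperator (L : Dist 𝕜 Ω → Dist 𝕜 Ω) : Prop where
  isLinearMap : IsLinearMap 𝕜 L
  continuous : Continuous L
  eigenvector : ∀ α : Fin d → ℕ, ∃ m : 𝕜, L (monomialDist α) = m • monomialDist α

/-- For `y` in `(ℝ \ {0})^d` and `φ ∈ 𝓓(Ω)`, the test function `x ↦ φ(xy)` on `ℝ^d`, where `xy` is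
the coordinatewise product. -/
def dilate (y : Fin d → ℝ) (hy : ∀ j, y j ≠ 0) (φ : 𝓓(Ω, 𝕜)) :
    𝓓((⊤ : Opens (Fin d → ℝ)), 𝕜) where
  toFun x := φ (x * y)
  contDiff' := φ.contDiff.comp (contDiff_id.mul contDiff_const)
  hasCompactSupport' := by
    have hu : IsUnit y := Pi.isUnit_iff.2 fun j => (hy j).isUnit
    obtain ⟨u, rfl⟩ := hu
    exact φ.hasCompactSupport.comp_homeomorph
      { toEquiv := Units.mulRight u
        continuous_toFun := continuous_id.mul continuous_const
        continuous_invFun := continuous_id.mul continuous_const }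
  tsupport_subset' := fun _ _ => trivial

/-- `ψ` is the function `y ↦ T_x φ(xy)`. For `y` with a zero coordinate `x ↦ φ(xy)` need not have
compact support; as `(ℝ \ {0})^d` is dense, the formula there determines the
continuous function `ψ`. -/
def IsMulTransform (T : Dist 𝕜 (⊤ : Opens (Fin d → ℝ))) (φ ψ : 𝓓(Ω, 𝕜)) : Prop :=
  ∀ (y : Fin d → ℝ) (hy : ∀ j, y j ≠ 0), ψ y = T (dilate y hy φ)

/-- `U = S ⋆ T` on `Ω`, where `(S ⋆ T) φ = S_y (T_x φ(xy))` is the multiplicative convolution: for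
every `φ ∈ 𝓓(Ω)` the formula makes sense, that is, `y ↦ T_x φ(xy)` belongs to `𝓓(Ω)`, and its value
is `U φ`. -/
def IsMulConv (S : Dist 𝕜 Ω) (T : Dist 𝕜 (⊤ : Opens (Fin d → ℝ))) (U : Dist 𝕜 Ω) : Prop :=
  ∀ φ : 𝓓(Ω, 𝕜), ∃ ψ : 𝓓(Ω, 𝕜), IsMulTransform T φ ψ ∧ U φ = S ψ

theorem lineDeriv_eq_coe (v : Fin d → ℝ) (φ : 𝓓(Ω, 𝕜)) :
    (fun x => lineDeriv ℝ φ x v) = ⇑(TestFunction.lineDerivCLM ℝ v φ : 𝓓(Ω, 𝕜)) := by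
  ext x
  exact (TestFunction.lineDerivCLM_apply_of_le (by simp)).symm

/-- The transpose `φ ↦ -∂_j (x_j φ) = -φ - x_j ∂_j φ` of the Euler derivative `θ_j = x_j ∂_j`, on
test functions. -/
def eulerTranspose (j : Fin d) (φ : 𝓓(Ω, 𝕜)) : 𝓓(Ω, 𝕜) where
  toFun x := -φ x - x j • lineDeriv ℝ φ x (Pi.single j 1)
  contDiff' := by
    have h : ContDiff ℝ (⊤ : ℕ∞) (fun x : Fin d → ℝ => lineDeriv ℝ φ x (Pi.single j 1)) := by
      rw [lineDeriv_eq_coe]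
      exact TestFunction.contDiff _
    have hj : ContDiff ℝ (⊤ : ℕ∞) (fun x : Fin d → ℝ => x j) := contDiff_apply ℝ ℝ j
    exact ContDiff.sub (ContDiff.neg φ.contDiff) (ContDiff.smul hj h)
  hasCompactSupport' := by
    have h : HasCompactSupport (fun x : Fin d → ℝ => lineDeriv ℝ φ x (Pi.single j 1)) := by
      rw [lineDeriv_eq_coe]
      exact TestFunction.hasCompactSupport _
    have h1 : HasCompactSupport (fun x : Fin d → ℝ => x j • lineDeriv ℝ φ x (Pi.single j 1)) :=
      HasCompactSupport.smul_left (f := fun x : Fin d → ℝ => x j) h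
    exact HasCompactSupport.sub (-φ).hasCompactSupport h1
  tsupport_subset' := by
    have h : tsupport (fun x : Fin d → ℝ => lineDeriv ℝ φ x (Pi.single j 1)) ⊆ Ω := by
      rw [lineDeriv_eq_coe]
      exact TestFunction.tsupport_subset _
    refine (tsupport_sub (⇑(-φ)) _).trans (Set.union_subset (-φ).tsupport_subset ?_)
    exact (tsupport_smul_subset_right (fun x : Fin d → ℝ => x j) _).trans h

/-- The transpose of `θ^β = θ_1^{β_1} ⋯ θ_d^{β_d}` on test functions (the `θ_j` commute). -/
def eulerTransposePow (β : Fin d → ℕ) (φ : 𝓓(Ω, 𝕜)) : 𝓓(Ω, 𝕜) :=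
  (List.finRange d).foldr (fun j ψ => (eulerTranspose j)^[β j] ψ) φ

/-- The class `O_H`: for every `k` the distribution `T` on `ℝ^d` is a finite sum `∑ θ^β t_β`, in the
sense of distributions, with `(1 + |x|^2)^{k/2} t_β ∈ L_∞(ℝ^d)`; `|x|` is the Euclidean norm. -/
def IsOH (T : Dist 𝕜 (⊤ : Opens (Fin d → ℝ))) : Prop :=
  ∀ k : ℕ, ∃ (B : Finset (Fin d → ℕ)) (t : (Fin d → ℕ) → (Fin d → ℝ) → 𝕜),
    (∀ β ∈ B, MemLp (fun x => ((1 + ∑ j, x j ^ 2 : ℝ) ^ ((k : ℝ) / 2)) • t β x) ⊤ volume) ∧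
    ∀ φ : 𝓓((⊤ : Opens (Fin d → ℝ)), 𝕜),
      T φ = ∑ β ∈ B, ∫ x, t β x * eulerTransposePow β φ x

/-- The set `𝓓'_H` of all `T ∈ O_H` whose support has positive distance to all coordinate
hyperplanes `{x | x_j = 0}`. -/
structure IsDH (T : Dist 𝕜 (⊤ : Opens (Fin d → ℝ))) : Prop where
  isOH : IsOH T
  support : ∃ ε : ℝ, 0 < ε ∧ ∀ x ∈ Distribution.dsupport T, ∀ j, ε ≤ |x j|

/-- `(1 / supp T) K` is relatively compact in `Ω` for every compact `K ⊆ Ω`; quotients of vectors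
are coordinatewise. -/
def SupportCondition (Ω : Opens (Fin d → ℝ)) (T : Dist 𝕜 (⊤ : Opens (Fin d → ℝ))) : Prop :=
  ∀ K : Set (Fin d → ℝ), IsCompact K → K ⊆ Ω →
    IsCompact (closure {z | ∃ ξ ∈ Distribution.dsupport T, ∃ x ∈ K, z = ξ⁻¹ * x}) ∧
    closure {z | ∃ ξ ∈ Distribution.dsupport T, ∃ x ∈ K, z = ξ⁻¹ * x} ⊆ Ω

end

end HadamardOp

end

noncomputable section

namespace HadamardOp

open Filter Topology Set

/-! ### Completeness of `𝓓_K` -/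

section Complete

variable {E F : Type*} [NormedAddCommGroup E] [NormedSpace ℝ E]
  [NormedAddCommGroup F] [NormedSpace ℝ F] {K : Compacts E}

/-! Everything is read off the transpose `M` of `L`, which acts on test functions, and the
distribution `T` with `M φ (y) = T_x φ(xy)`.

From `T` to `L`: Euler derivatives commute with dilations, so `T_x φ(xy)` is a sum of integrals of
`t_β(x)` against an Euler derivative of `φ` taken at `xy`. Decay of `t_β` of high order allows as
many derivatives in `y` as desired, also across the coordinate hyperplanes, and the support
condition keeps the result in `𝓓(Ω)` (`exists_transformCLM`). `L` is the dual of this continuous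
map. Monomials are eigenvectors by Fubini and the substitution `z = xy`; the powers of `1/x_j` that
appear are harmless because `supp T` stays away from the hyperplanes
(`exists_integral_transform_monomial`).

From `L` to `T`: `𝓓(Ω)` is semireflexive, so `L` has a transpose (`exists_transpose`). The
eigenvector property says that `M` multiplies the moment of order `α` by `m_α`. By Weierstrass,
moments determine a compactly supported function, hence `M` commutes with dilations and Euler
derivatives. As `0 ∈ Ω`, every test function on `ℝ^d` can be dilated into `Ω`, and this defines `T`
(`IsTranspose.exists_dist`). A Baire argument gives common supports for `M φ`, and dilating them
yields both support properties of `T`.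

The decay of `T` is the hard point. If `φ` vanishes near `x_j = 0`, then `M φ` vanishes to infinite
order on `y_j = 0` (`IsTranspose.pderivWord_replicate_eq_zero`): up to symmetrization `φ` lies in
the range of an Euler operator whose output has vanishing `l`-th normal derivative there, and `M`
commutes with that operator. Now cut the region containing `supp T` into dyadic pieces and dilate
each one, by a vector `y` with small coordinates, into one fixed region of `Ω`. Flatness of order
`k` in the smallest `y_j` pays for the weight `(1 + ‖x‖)^k`, and the Jacobians `∏ y_j` form a
convergent geometric sum (`IsTranspose.exists_bound_dist`). Hahn-Banach and the duality of `L¹` and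
`L_∞` turn this bound into the representation required by `O_H` (`isOH_of_bound`). -/

/-- Uniform limits of all derivatives of functions in `𝓓_K` are the derivatives of a function
in `𝓓_K`. -/
theorem exists_limit_of_tendsto_structureMap [CompleteSpace F] {ι : Type*} {l : Filter ι} [NeBot l]
    (u : ι → 𝓓_{K}(E, F)) (f : ∀ i, BoundedContinuousFunction E (E [×i]→L[ℝ] F))
    (h : ∀ i, Tendsto (fun n => ContDiffMapSupportedIn.structureMapCLM ℝ ⊤ i (u n)) l (𝓝 (f i))) :
    ∃ g : 𝓓_{K}(E, F), ∀ i, ContDiffMapSupportedIn.structureMapCLM ℝ ⊤ i g = f i := by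
  have hu : ∀ i, TendstoUniformly (fun n => iteratedFDeriv ℝ i (u n)) (f i) l := by
    intro i
    have := (BoundedContinuousFunction.tendsto_iff_tendstoUniformly).1 (h i)
    simpa [ContDiffMapSupportedIn.structureMapCLM_top_apply] using! this
  have hpt : ∀ i x, Tendsto (fun n => iteratedFDeriv ℝ i (u n) x) l (𝓝 (f i x)) := fun i x =>
    (hu i).tendsto_at x
  let g : E → F := fun x => (f 0 x) 0
  -- Derivatives converge uniformly at each order, so each limit is the derivative of the previous
  -- one; together they form a Taylor series of `g`.
  have hd : ∀ (i : ℕ) (x : E), HasFDerivAt (f i) ((f (i + 1) x).curryLeft) x := by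
    intro i x
    let c := (continuousMultilinearCurryLeftEquiv ℝ (fun _ : Fin (i + 1) => E) F)
    refine hasFDerivAt_of_tendstoUniformly (l := l) (f := fun n => iteratedFDeriv ℝ i (u n))
      (f' := fun n => fderiv ℝ (iteratedFDeriv ℝ i (u n)))
      (g' := fun x => (f (i + 1) x).curryLeft) ?_ ?_ (fun y => hpt i y) x
    · have := c.isometry.uniformContinuous.comp_tendstoUniformly (hu (i + 1))
      exact this
    · intro n y
      exact (((u n).contDiff.differentiable_iteratedFDeriv (m := i)
        (by exact_mod_cast ENat.natCast_lt_top i)) y).hasFDerivAt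
  have ht : HasFTaylorSeriesUpTo (⊤ : ℕ∞) g (fun x i => f i x) := by
    refine ⟨fun x => rfl, fun i _ x => hd i x, fun i _ => (f i).continuous⟩
  have hcd : ContDiff ℝ (⊤ : ℕ∞) g := ht.contDiff
  refine ⟨⟨g, hcd, fun x hx => ?_⟩, fun i => ?_⟩
  · have h0 := hpt 0 x
    have h1 : ∀ n, iteratedFDeriv ℝ 0 (u n) x = 0 := fun n =>
      (u n).iteratedFDeriv_zero_on_compl hx
    simp only [h1] at h0
    have := tendsto_nhds_unique h0 tendsto_const_nhds
    simp [g, this]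
  · ext1 x
    rw [ContDiffMapSupportedIn.structureMapCLM_top_apply]
    have := ht.eq_iteratedFDeriv (m := i) (by exact_mod_cast le_top) x
    exact this.symm

/-- The limit just constructed shows that the embedding into the product of all derivative spaces
has closed range. Completeness makes closed convex hulls of compact sets compact, and is half of
what Baire's theorem needs. -/
instance instCompleteSpaceSupportedIn [CompleteSpace F] : CompleteSpace 𝓓_{K}(E, F) := by
  have hemb := ContDiffMapSupportedIn.isUniformEmbedding_pi_structureMapCLM (E := E) (F := F)
    (n := ⊤) (K := K) ℝ
  rw [completeSpace_iff_isComplete_range hemb.toIsUniformInducing]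
  refine IsClosed.isComplete ?_
  rw [← closure_subset_iff_isClosed]
  intro f hf
  rw [mem_closure_iff_comap_neBot] at hf
  have hconv : Tendsto (Subtype.val : range (ContinuousLinearMap.pi
      (ContDiffMapSupportedIn.structureMapCLM (E := E) (F := F) (K := K) ℝ ⊤)) → _)
      (comap Subtype.val (𝓝 f)) (𝓝 f) := tendsto_comap
  rw [tendsto_pi_nhds] at hconv
  obtain ⟨g, hg⟩ := exists_limit_of_tendsto_structureMap
    (fun n : range (ContinuousLinearMap.pi
      (ContDiffMapSupportedIn.structureMapCLM (E := E) (F := F) (K := K) ℝ ⊤)) => n.2.choose) f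
    (fun i => (hconv i).congr fun n => (congrFun n.2.choose_spec i).symm)
  exact ⟨g, funext fun i => hg i⟩

/-- Together with completeness this makes `𝓓_K` a Baire space, hence barrelled. -/
instance instIsCountablyGeneratedUniformity :
    (uniformity 𝓓_{K}(E, F)).IsCountablyGenerated := by
  have hemb := ContDiffMapSupportedIn.isUniformEmbedding_pi_structureMapCLM (E := E) (F := F)
    (n := ⊤) (K := K) ℝ
  rw [← hemb.comap_uniformity]
  infer_instance

end Complete

end HadamardOp
end

noncomputable section

namespace HadamardOp

open Filter Topology Set

/-! ### Compact sets of test functions -/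

section CompactSets

variable {E F : Type*} [NormedAddCommGroup E] [NormedSpace ℝ E]
  [NormedAddCommGroup F] [NormedSpace ℝ F] {Ω : Opens E}

theorem locallyConvexSpace_boundedContinuousFunction {X G : Type*} [TopologicalSpace X]
    [NormedAddCommGroup G] [NormedSpace ℝ G] :
    LocallyConvexSpace ℝ (BoundedContinuousFunction X G) := inferInstance

/-- The restriction of a test function to a compact set containing its support. -/
def restrictSupport (K : Compacts E) (φ : 𝓓(Ω, F)) (h : Function.support φ ⊆ K) :
    𝓓_{K}(E, F) :=
  .of_support_subset φ.contDiff h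

/-- The `i`-th derivative of a test function, as a bounded continuous function. -/
def derivBCF (Ω : Opens E) (F : Type*) [NormedAddCommGroup F] [NormedSpace ℝ F] (i : ℕ) :
    𝓓(Ω, F) →L[ℝ] BoundedContinuousFunction E (E [×i]→L[ℝ] F) :=
  haveI : IsTopologicalAddGroup (BoundedContinuousFunction E (E [×i]→L[ℝ] F)) :=
    @SeminormedAddCommGroup.toIsTopologicalAddGroup (BoundedContinuousFunction E (E [×i]→L[ℝ] F))
      BoundedContinuousFunction.instSeminormedAddCommGroup
  haveI : LocallyConvexSpace ℝ (BoundedContinuousFunction E (E [×i]→L[ℝ] F)) :=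
    locallyConvexSpace_boundedContinuousFunction
  TestFunction.limitCLM ℝ
    (fun φ : 𝓓(Ω, F) => ContDiffMapSupportedIn.structureMapCLM ℝ ⊤ i
      (restrictSupport ⟨tsupport φ, φ.hasCompactSupport⟩ φ subset_closure))
    (fun K _ => ContDiffMapSupportedIn.structureMapCLM (E := E) (F := F) (K := K) ℝ ⊤ i)
    (fun K hK f => by
      ext1 x
      simp only [ContDiffMapSupportedIn.structureMapCLM_top_apply]
      rfl)

theorem derivBCF_apply (i : ℕ) (φ : 𝓓(Ω, F)) (x : E) :
    derivBCF Ω F i φ x = iteratedFDeriv ℝ i φ x := by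
  change ContDiffMapSupportedIn.structureMapCLM ℝ ⊤ i
      (restrictSupport ⟨tsupport φ, φ.hasCompactSupport⟩ φ subset_closure) x = _
  rw [ContDiffMapSupportedIn.structureMapCLM_top_apply]
  rfl

/-- An exhaustion of an open set by compact sets. -/
theorem exists_compact_exhaustion [FiniteDimensional ℝ E] (Ω : Opens E) :
    ∃ K : ℕ → Compacts E, (∀ n, (K n : Set E) ⊆ Ω) ∧ Monotone K ∧
      ∀ C : Set E, IsCompact C → C ⊆ Ω → ∃ n, C ⊆ K n := by
  have : ProperSpace E := FiniteDimensional.proper ℝ E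
  have : LocallyCompactSpace Ω := Ω.isOpen.locallyCompactSpace
  let k := CompactExhaustion.choice Ω
  refine ⟨fun n => ⟨Subtype.val '' (k n), (k.isCompact n).image continuous_subtype_val⟩,
    fun n => ?_, fun m n h => image_mono (k.subset h), fun C hC hCΩ => ?_⟩
  · rintro _ ⟨x, _, rfl⟩
    exact x.2
  · have h1 : IsCompact (Subtype.val ⁻¹' C : Set Ω) := by
      rw [Subtype.isCompact_iff, image_preimage_eq_inter_range, Subtype.range_coe_subtype]
      exact (inter_eq_left.2 hCΩ).symm ▸ hC
    obtain ⟨n, hn⟩ := k.exists_superset_of_isCompact h1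
    exact ⟨n, fun x hx => ⟨⟨x, hCΩ hx⟩, hn hx, rfl⟩⟩

/-- Weighted point evaluations along a sequence which leaves every compact set. -/
def weightedEval (Ω : Opens E) (F : Type*) [NormedAddCommGroup F] [NormedSpace ℝ F]
    (x : ℕ → E) (a : ℕ → ℝ)
    (hx : ∀ C : Set E, IsCompact C → C ⊆ Ω → ∃ N, ∀ n, N ≤ n → x n ∉ C) :
    𝓓(Ω, F) →L[ℝ] BoundedContinuousFunction ℕ F :=
  have key : ∀ (C : Set E) (N : ℕ), (∀ n, N ≤ n → x n ∉ C) → ∀ φ : E → F,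
      (Function.support φ ⊆ C) → ∀ n, N ≤ n → a n • φ (x n) = 0 := by
    intro C N hN φ hφ n hn
    rw [Function.notMem_support.1 fun h => hN n hn (hφ h), smul_zero]
  have bdd : ∀ φ : 𝓓(Ω, F), ∃ c, ∀ n, ‖a n • φ (x n)‖ ≤ c := by
    intro φ
    obtain ⟨N, hN⟩ := hx _ φ.hasCompactSupport φ.tsupport_subset
    refine ⟨∑ n ∈ Finset.range N, ‖a n • φ (x n)‖, fun n => ?_⟩
    rcases lt_or_ge n N with h | h
    · exact Finset.single_le_sum (f := fun n => ‖a n • φ (x n)‖)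
        (fun _ _ => norm_nonneg _) (Finset.mem_range.2 h)
    · rw [key _ N hN φ subset_closure n h, norm_zero]
      positivity
  TestFunction.mkCLM ℝ
    (fun φ => BoundedContinuousFunction.ofNormedAddCommGroupDiscrete
      (fun n => a n • φ (x n)) _ (bdd φ).choose_spec)
    (fun φ ψ => BoundedContinuousFunction.ext fun n => smul_add _ _ _)
    (fun c φ => BoundedContinuousFunction.ext fun n => smul_comm _ _ _)
    (fun K hK => by
      refine (ContDiffMapSupportedIn.mkCLMtoNormedSpace (K := K) (n := ⊤) ℝ
        (fun φ => BoundedContinuousFunction.ofNormedAddCommGroupDiscrete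
          (fun n => a n • φ (x n)) _ (bdd (TestFunction.ofSupportedIn hK φ)).choose_spec)
        (fun φ ψ => BoundedContinuousFunction.ext fun n => smul_add _ _ _)
        (fun c φ => BoundedContinuousFunction.ext fun n => smul_comm _ _ _) ?_).continuous
      -- Only finitely many of the points meet `K`, so on `𝓓_K` a finite sum of weights bounds the
      -- map.
      obtain ⟨N, hN⟩ := hx _ K.isCompact hK
      refine ⟨{0}, ∑ n ∈ Finset.range N, ‖a n‖, by positivity, fun φ => ?_⟩
      rw [Finset.sup_singleton]
      refine (BoundedContinuousFunction.norm_le (by positivity)).2 fun n => ?_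
      change ‖a n • φ (x n)‖ ≤ _
      rcases lt_or_ge n N with h | h
      · rw [norm_smul]
        gcongr
        · exact Finset.single_le_sum (f := fun n => ‖a n‖)
            (fun _ _ => norm_nonneg _) (Finset.mem_range.2 h)
        · exact ContDiffMapSupportedIn.norm_apply_le_seminorm ℝ
      · rw [key _ N hN φ φ.support_subset n h, norm_zero]
        positivity)

theorem weightedEval_apply (x : ℕ → E) (a : ℕ → ℝ)
    (hx : ∀ C : Set E, IsCompact C → C ⊆ Ω → ∃ N, ∀ n, N ≤ n → x n ∉ C) (φ : 𝓓(Ω, F)) (n : ℕ) :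
    weightedEval Ω F x a hx φ n = a n • φ (x n) := rfl

/-- The test functions in a compact set have their supports in a common compact set. -/
theorem exists_common_support [FiniteDimensional ℝ E] {B : Set 𝓓(Ω, F)} (hB : IsCompact B) :
    ∃ K : Compacts E, (K : Set E) ⊆ Ω ∧ ∀ φ ∈ B, Function.support φ ⊆ K := by
  obtain ⟨K, hK, hmono, hex⟩ := exists_compact_exhaustion Ω
  by_contra! h
  have h1 : ∀ n, ∃ φ ∈ B, ∃ x, x ∉ K n ∧ φ x ≠ 0 := by
    intro n
    obtain ⟨φ, hφ, hs⟩ := h (K n) (hK n)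
    obtain ⟨x, hx, hxK⟩ := not_subset.1 hs
    exact ⟨φ, hφ, x, hxK, hx⟩
  choose φ hφ x hx hne using h1
  have hx' : ∀ C : Set E, IsCompact C → C ⊆ Ω → ∃ N, ∀ n, N ≤ n → x n ∉ C := by
    intro C hC hCΩ
    obtain ⟨N, hN⟩ := hex C hC hCΩ
    exact ⟨N, fun n hn hxn => hx n (hmono hn (hN hxn))⟩
  -- With these weights the image of `φ n` has norm at least `n`, whereas the image of the compact
  -- set `B` is bounded.
  let a : ℕ → ℝ := fun n => n / ‖φ n (x n)‖
  have hb := (hB.image (weightedEval Ω F x a hx').continuous).isBounded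
  obtain ⟨R, hR⟩ := hb.exists_norm_le
  obtain ⟨n, hn⟩ := exists_nat_gt R
  have h2 := hR _ (mem_image_of_mem _ (hφ n))
  have h3 := (BoundedContinuousFunction.norm_coe_le_norm (weightedEval Ω F x a hx' (φ n)) n)
  rw [weightedEval_apply, norm_smul, norm_div, norm_norm,
    div_mul_cancel₀ _ (norm_ne_zero_iff.2 (hne n))] at h3
  simp only [Real.norm_natCast] at h3
  linarith

/-- A compact set of test functions is the image of a compact set of some `𝓓_K`. -/
theorem exists_isCompact_supportedIn [FiniteDimensional ℝ E] {B : Set 𝓓(Ω, F)}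
    (hB : IsCompact B) :
    ∃ (K : Compacts E) (hK : (K : Set E) ⊆ Ω) (B' : Set 𝓓_{K}(E, F)), IsCompact B' ∧
      TestFunction.ofSupportedIn hK '' B' = B := by
  obtain ⟨K, hK, hsupp⟩ := exists_common_support hB
  let r : B → 𝓓_{K}(E, F) := fun φ => restrictSupport K φ.1 (hsupp _ φ.2)
  -- The topology of `𝓓_K` is initial for the derivative maps, and these are already continuous on
  -- `𝓓(Ω)`.
  have hr : Continuous r := by
    rw [ContDiffMapSupportedIn.continuous_iff_comp]
    intro i
    convert! (derivBCF Ω F i).continuous.comp continuous_subtype_val using 1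
  have : CompactSpace B := isCompact_iff_compactSpace.1 hB
  refine ⟨K, hK, range r, isCompact_range hr, ?_⟩
  ext φ
  constructor
  · rintro ⟨_, ⟨ψ, rfl⟩, rfl⟩
    exact ψ.2
  · exact fun h => ⟨_, ⟨⟨φ, h⟩, rfl⟩, rfl⟩

end CompactSets

/-! ### Reflexivity -/

section Reflexive

variable {𝕜 : Type*} [RCLike 𝕜] {d : ℕ} {Ω : Opens (Fin d → ℝ)}

/-- A continuous linear form on `𝓓'(Ω)` is controlled by the values on a compact set. -/
theorem exists_isCompact_bound (Λ : Dist 𝕜 Ω →ₗ[𝕜] 𝕜) (hΛ : Continuous Λ) :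
    ∃ (B : Set 𝓓(Ω, 𝕜)) (C : ℝ), IsCompact B ∧ 0 < C ∧
      ∀ (S : Dist 𝕜 Ω) (M : ℝ), 0 < M → (∀ φ ∈ B, ‖S φ‖ ≤ M) → ‖Λ S‖ ≤ C * M := by
  have h0 : Λ ⁻¹' Metric.ball 0 1 ∈ 𝓝 (0 : Dist 𝕜 Ω) := by
    apply hΛ.continuousAt
    rw [map_zero]
    exact Metric.ball_mem_nhds 0 one_pos
  obtain ⟨⟨B, r⟩, ⟨hB, hr⟩, h⟩ :=
    (CompactConvergenceCLM.hasBasis_nhds_zero_of_basis Metric.nhds_basis_ball).mem_iff.1 h0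
  refine ⟨B, 2 / r, hB, by positivity, fun S M hM hS => ?_⟩
  dsimp only at hr h hB
  -- The factor 2 yields the strict inequality required by the open ball.
  have h1 : ((r / (2 * M) : ℝ) : 𝕜) • S ∈ Λ ⁻¹' Metric.ball 0 1 := by
    apply h
    intro φ hφ
    have : ‖((r / (2 * M) : ℝ) : 𝕜) • S φ‖ < r := by
      rw [norm_smul, RCLike.norm_ofReal, abs_of_pos (by positivity)]
      calc r / (2 * M) * ‖S φ‖ ≤ r / (2 * M) * M := by gcongr; exact hS φ hφ
        _ = r / 2 := by field_simp
        _ < r := by linarith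
    simpa using this
  simp only [mem_preimage, map_smul, mem_ball_zero_iff, norm_smul, RCLike.norm_ofReal] at h1
  rw [abs_of_pos (by positivity)] at h1
  have h2 : ‖Λ S‖ < 1 / (r / (2 * M)) := by
    rw [lt_div_iff₀ (by positivity)]
    linarith
  refine h2.le.trans (le_of_eq ?_)
  field_simp

/-- `𝓓(Ω)` is semireflexive: a continuous linear form on `𝓓'(Ω)` is the evaluation at a test
function. -/
theorem exists_eval_eq (Λ : Dist 𝕜 Ω →ₗ[𝕜] 𝕜) (hΛ : Continuous Λ) :
    ∃ ψ : 𝓓(Ω, 𝕜), ∀ S : Dist 𝕜 Ω, Λ S = S ψ := by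
  classical
  obtain ⟨B, C, hB, hC, hbound⟩ := exists_isCompact_bound Λ hΛ
  obtain ⟨K, hK, B', hB', rfl⟩ := exists_isCompact_supportedIn hB
  let ι : 𝓓_{K}(Fin d → ℝ, 𝕜) →L[𝕜] 𝓓(Ω, 𝕜) := TestFunction.ofSupportedInCLM 𝕜 hK
  let ev : Dist 𝕜 Ω → 𝓓_{K}(Fin d → ℝ, 𝕜) →L[𝕜] 𝕜 := fun S => ContinuousLinearMap.comp S ι
  have : ProperSpace 𝕜 := inferInstance
  -- Scalars from the ball of `𝕜` are included because the hull below is only absolutely convex over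
  -- `ℝ`; the point `0` keeps it nonempty and makes the separating constant positive.
  let B₁ : Set 𝓓_{K}(Fin d → ℝ, 𝕜) :=
    insert 0 ((fun p : 𝕜 × 𝓓_{K}(Fin d → ℝ, 𝕜) => p.1 • p.2) '' (Metric.closedBall 0 C ×ˢ B'))
  have hB₁ : IsCompact B₁ := by
    refine IsCompact.insert (IsCompact.image ?_ continuous_smul) 0
    exact (isCompact_closedBall 0 C).prod hB'
  let Q := closedAbsConvexHull ℝ B₁
  have hQ : IsCompact Q := isCompact_closedAbsConvexHull_of_totallyBounded hB₁.totallyBounded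
  have hsub : B₁ ⊆ Q := subset_closedAbsConvexHull
  have hQc : Convex ℝ Q := absConvex_convexClosedHull.2
  -- A common solution `q` exists by compactness of `Q` as soon as any finite family of equations is
  -- solvable; that is a separation argument in finite dimension.
  have hne : (Q ∩ ⋂ S : Dist 𝕜 Ω, {q | ev S q = Λ S}).Nonempty := by
    refine hQ.inter_iInter_nonempty _
      (fun S => isClosed_eq (ev S).continuous continuous_const) fun u => ?_
    by_contra hemp
    let G : 𝓓_{K}(Fin d → ℝ, 𝕜) →L[𝕜] (u → 𝕜) := ContinuousLinearMap.pi fun S => ev S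
    have hv : (fun S : u => Λ S) ∉ G '' Q := by
      rintro ⟨q, hq, hqv⟩
      refine hemp ⟨q, hq, ?_⟩
      simp only [mem_iInter]
      intro S hS
      exact congrFun hqv ⟨S, hS⟩
    obtain ⟨f, s, hf1, hf2⟩ := RCLike.geometric_hahn_banach_closed_point (𝕜 := 𝕜)
      (hQc.is_linear_image (f := G) ((G.restrictScalars ℝ).toLinearMap.isLinear))
      (hQ.image G.continuous).isClosed hv
    have hfe : ∀ v : u → 𝕜, f v = ∑ S, v S * f (Pi.single S 1) := by
      intro v
      conv_lhs => rw [← Finset.univ_sum_single v, map_sum]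
      refine Finset.sum_congr rfl fun S _ => ?_
      rw [← smul_eq_mul, ← map_smul]
      congr 1
      rw [← Pi.single_smul, smul_eq_mul, mul_one]
    -- The separating functional is itself a distribution: it is at most `s / C` on `B`, so the
    -- bound for `Λ` gives `‖Λ S₀‖ ≤ s`, against the separation.
    let S₀ : Dist 𝕜 Ω := ∑ S : u, f (Pi.single S 1) • (S : Dist 𝕜 Ω)
    have hS₀ : ∀ q, S₀ (ι q) = f (G q) := by
      intro q
      rw [hfe]
      simp only [S₀, sum_apply]
      refine Finset.sum_congr rfl fun S _ => ?_
      rw [mul_comm]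
      rfl
    have hΛS₀ : Λ S₀ = f fun S : u => Λ S := by
      rw [hfe]
      simp only [S₀, map_sum, map_smul, smul_eq_mul, mul_comm]
    have hs : 0 < s := by
      have := hf1 _ (mem_image_of_mem G (hsub (mem_insert _ _)))
      simpa using this
    have h1 : ∀ φ ∈ TestFunction.ofSupportedIn hK '' B', ‖S₀ φ‖ ≤ s / C := by
      rintro _ ⟨b, hb, rfl⟩
      change ‖S₀ (ι b)‖ ≤ _
      rw [le_div_iff₀ hC]
      -- Rotating by `z` turns the bound on real parts into a bound on absolute values.
      obtain ⟨z, hz, hzs⟩ := RCLike.exists_norm_eq_mul_self (K := 𝕜) (S₀ (ι b))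
      have hmem : ((C : 𝕜) * z) • b ∈ B₁ := by
        refine mem_insert_of_mem _ ⟨((C : 𝕜) * z, b), ⟨?_, hb⟩, rfl⟩
        simp [hz, abs_of_pos hC]
      have := hf1 _ (mem_image_of_mem G (hsub hmem))
      rw [← hS₀, map_smul, map_smul, smul_eq_mul, mul_assoc, ← hzs, ← RCLike.ofReal_mul,
        RCLike.ofReal_re] at this
      linarith
    have h2 := hbound S₀ (s / C) (by positivity) h1
    rw [mul_div_cancel₀ _ hC.ne', hΛS₀] at h2
    exact absurd hf2 (not_lt.2 ((RCLike.re_le_norm _).trans h2))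
  obtain ⟨q, -, hq⟩ := hne
  rw [mem_iInter] at hq
  exact ⟨ι q, fun S => (hq S).symm⟩

/-- A continuous linear map on `𝓓'(Ω)` has a transpose on `𝓓(Ω)`. -/
theorem exists_transpose {L : Dist 𝕜 Ω → Dist 𝕜 Ω} (hlin : IsLinearMap 𝕜 L) (hL : Continuous L) :
    ∃ M : 𝓓(Ω, 𝕜) → 𝓓(Ω, 𝕜), ∀ S φ, L S φ = S (M φ) := by
  have h : ∀ φ : 𝓓(Ω, 𝕜), ∃ ψ : 𝓓(Ω, 𝕜), ∀ S, L S φ = S ψ := by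
    intro φ
    let Λ : Dist 𝕜 Ω →ₗ[𝕜] 𝕜 :=
      { toFun := fun S => L S φ
        map_add' := fun S S' => by rw [hlin.map_add]; rfl
        map_smul' := fun c S => by rw [hlin.map_smul]; rfl }
    exact exists_eval_eq Λ ((continuous_eval_const φ).comp hL)
  choose M hM using h
  exact ⟨M, fun S φ => hM φ S⟩

end Reflexive

end HadamardOp
end

noncomputable section

namespace HadamardOp

open Filter Topology Set

/-! ### Moments -/

section Moments

variable {d : ℕ}

/-- Integration against `g` is a continuous functional on the continuous functions on `supp g`. It
kills polynomials, which are dense by Stone-Weierstrass, hence it kills `g` itself, and `∫ g² = 0`.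
-/
theorem eq_zero_of_real_moments {g : (Fin d → ℝ) → ℝ} (hg : Continuous g)
    (hc : HasCompactSupport g) (h : ∀ α : Fin d → ℕ, ∫ x, g x * ∏ j, x j ^ α j = 0) :
    g = 0 := by
  let K := tsupport g
  have : CompactSpace K := isCompact_iff_compactSpace.1 hc
  have hKm : MeasurableSet K := (isClosed_tsupport g).measurableSet
  have hfin : IsFiniteMeasure (volume.comap (Subtype.val : K → Fin d → ℝ)) := by
    refine ⟨?_⟩
    rw [(MeasurableEmbedding.subtype_coe hKm).comap_apply, image_univ, Subtype.range_coe]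
    exact IsCompact.measure_lt_top hc
  let μ : Measure K := volume.comap (Subtype.val : K → Fin d → ℝ)
  have hcont : ∀ f : C(K, ℝ), Integrable f μ := fun f =>
    f.continuous.integrable_of_hasCompactSupport (HasCompactSupport.of_compactSpace _)
  let gK : C(K, ℝ) := ⟨fun x => g x, hg.comp continuous_subtype_val⟩
  let I : C(K, ℝ) →L[ℝ] ℝ := LinearMap.mkContinuous
    { toFun := fun f => ∫ x, (gK * f) x ∂μ
      map_add' := fun f f' => by
        rw [mul_add]
        exact integral_add (hcont _) (hcont _)
      map_smul' := fun c f => by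
        rw [mul_smul_comm]
        exact integral_smul c _ } (∫ x, ‖gK x‖ ∂μ) (fun f => by
        refine (norm_integral_le_integral_norm _).trans ?_
        rw [← integral_mul_const]
        refine integral_mono (hcont _).norm ((hcont gK).norm.mul_const _) fun x => ?_
        simp only [ContinuousMap.mul_apply, norm_mul]
        gcongr
        exact f.norm_coe_le_norm x)
  have hI : ∀ f : C(K, ℝ), I f = ∫ x, (gK * f) x ∂μ := fun f => rfl
  let X : Fin d → C(K, ℝ) := fun j => ⟨fun x => x.1 j, (continuous_apply j).comp continuous_subtype_val⟩
  let A := Algebra.adjoin ℝ (range X)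
  have hA : A.topologicalClosure = ⊤ := by
    refine ContinuousMap.subalgebra_topologicalClosure_eq_top_of_separatesPoints _ ?_
    intro x y hxy
    obtain ⟨j, hj⟩ := Function.ne_iff.1 (fun h => hxy (Subtype.ext h))
    exact ⟨_, ⟨X j, Algebra.subset_adjoin (mem_range_self j), rfl⟩, hj⟩
  have hext : ∀ f : (Fin d → ℝ) → ℝ, ∫ x : K, g x * f x ∂μ = ∫ x, g x * f x := by
    intro f
    rw [integral_subtype_comap hKm (fun x => g x * f x)]
    refine setIntegral_eq_integral_of_forall_compl_eq_zero fun x hx => ?_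
    rw [image_eq_zero_of_notMem_tsupport hx, zero_mul]
  have hIA : ∀ f ∈ A, I f = 0 := by
    intro f hf
    rw [show A = _ from Algebra.adjoin_range_eq_range_aeval ℝ X] at hf
    obtain ⟨p, rfl⟩ := hf
    change I (MvPolynomial.aeval X p) = 0
    rw [MvPolynomial.aeval_def, MvPolynomial.eval₂_eq', map_sum]
    refine Finset.sum_eq_zero fun α _ => ?_
    rw [← Algebra.smul_def, map_smul, hI]
    have := hext fun x => ∏ j, x j ^ α j
    rw [h] at this
    have h2 : ∀ x : K, (gK * ∏ j, X j ^ α j) x = g x * ∏ j, x.1 j ^ α j := by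
      intro x
      simp [gK, X, ContinuousMap.prod_apply]
    simp only [h2, this, smul_zero]
  have hI0 : I gK = 0 := by
    have h1 : gK ∈ A.topologicalClosure := by rw [hA]; trivial
    have h2 : closure (A : Set C(K, ℝ)) ⊆ I ⁻¹' {0} :=
      closure_minimal (fun f hf => hIA f hf) (isClosed_singleton.preimage I.continuous)
    exact h2 h1
  have h3 : ∫ x, g x * g x = 0 := by
    rw [← hext, ← hI0, hI]
    rfl
  by_contra hne
  obtain ⟨x, hx⟩ := Function.ne_iff.1 hne
  have := (hg.mul hg).integral_pos_of_hasCompactSupport_nonneg_nonzero (μ := volume)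
    (hc.mul_left (f := g)) (fun x => mul_self_nonneg (g x)) (x := x) (by simpa using hx)
  exact this.ne' h3

/-- A compactly supported continuous function is determined by its moments. -/
theorem eq_of_moments {𝕜 : Type*} [RCLike 𝕜] {f g : (Fin d → ℝ) → 𝕜} (hf : Continuous f)
    (hfc : HasCompactSupport f) (hg : Continuous g) (hgc : HasCompactSupport g)
    (h : ∀ α : Fin d → ℕ, ∫ x, f x * monomialFun 𝕜 α x = ∫ x, g x * monomialFun 𝕜 α x) :
    f = g := by
  have hcont : Continuous (f - g) := hf.sub hg
  have hcomp : HasCompactSupport (f - g) := hfc.sub hgc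
  have hint : ∀ α : Fin d → ℕ, Integrable fun x => (f - g) x * monomialFun 𝕜 α x := fun α =>
    (hcont.mul (continuous_monomialFun α)).integrable_of_hasCompactSupport hcomp.mul_right
  have h0 : ∀ α : Fin d → ℕ, ∫ x, (f - g) x * monomialFun 𝕜 α x = 0 := by
    intro α
    simp only [Pi.sub_apply, sub_mul]
    rw [integral_sub, h, sub_self]
    · exact (hf.mul (continuous_monomialFun α)).integrable_of_hasCompactSupport hfc.mul_right
    · exact (hg.mul (continuous_monomialFun α)).integrable_of_hasCompactSupport hgc.mul_right
  -- Monomials are real-valued, so the moments of the real and imaginary parts vanish separately.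
  have hre : (fun x => RCLike.re ((f - g) x)) = 0 := by
    refine eq_zero_of_real_moments (RCLike.continuous_re.comp hcont)
      (hcomp.comp_left (g := fun z => RCLike.re z) (map_zero _)) fun α => ?_
    have := integral_re (hint α)
    rw [h0] at this
    simpa only [monomialFun, RCLike.mul_re, RCLike.ofReal_re, RCLike.ofReal_im, mul_zero, sub_zero,
      zero_add, add_zero, map_zero] using this
  have him : (fun x => RCLike.im ((f - g) x)) = 0 := by
    refine eq_zero_of_real_moments (RCLike.continuous_im.comp hcont)
      (hcomp.comp_left (g := fun z => RCLike.im z) (map_zero _)) fun α => ?_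
    have := integral_im (hint α)
    rw [h0] at this
    simpa only [monomialFun, RCLike.mul_im, RCLike.ofReal_re, RCLike.ofReal_im, mul_zero, sub_zero,
      zero_add, add_zero, map_zero] using this
  funext x
  have h1 := congrFun hre x
  have h2 := congrFun him x
  exact sub_eq_zero.1 (RCLike.ext (by simpa using h1) (by simpa using h2))

end Moments

end HadamardOp
end

noncomputable section

namespace HadamardOp

open Filter Topology Set

/-! ### Differential operators on test functions -/

section Operators

variable {𝕜 : Type*} [RCLike 𝕜] {d : ℕ} {Ω Ω' : Opens (Fin d → ℝ)}

theorem smooth (φ : 𝓓(Ω, 𝕜)) : ContDiff ℝ (⊤ : ℕ∞) φ := φ.contDiff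

theorem differentiable (φ : 𝓓(Ω, 𝕜)) : Differentiable ℝ φ :=
  (smooth φ).differentiable (by simp)

/-- The partial derivative `∂_j` on test functions. -/
def pderiv (j : Fin d) : 𝓓(Ω, 𝕜) →L[𝕜] 𝓓(Ω, 𝕜) :=
  TestFunction.lineDerivCLM 𝕜 (Pi.single j 1)

theorem pderiv_apply (j : Fin d) (φ : 𝓓(Ω, 𝕜)) (x : Fin d → ℝ) :
    pderiv j φ x = fderiv ℝ φ x (Pi.single j 1) := by
  rw [pderiv, TestFunction.lineDerivCLM_apply_of_le (by simp),
    (differentiable φ x).lineDeriv_eq_fderiv]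

theorem coe_pderiv (j : Fin d) (φ : 𝓓(Ω, 𝕜)) :
    ⇑(pderiv j φ) = fun x => fderiv ℝ φ x (Pi.single j 1) :=
  funext (pderiv_apply j φ)

theorem eulerTranspose_apply (j : Fin d) (φ : 𝓓(Ω, 𝕜)) (x : Fin d → ℝ) :
    eulerTranspose j φ x = -φ x - x j • pderiv j φ x := by
  rw [pderiv, TestFunction.lineDerivCLM_apply_of_le (by simp)]
  rfl

/-- The product of a smooth function and a test function. -/
def smulLeft (χ : (Fin d → ℝ) → ℝ) (hχ : ContDiff ℝ (⊤ : ℕ∞) χ) (φ : 𝓓(Ω, 𝕜)) : 𝓓(Ω, 𝕜) where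
  toFun x := χ x • φ x
  contDiff' := hχ.smul φ.contDiff
  hasCompactSupport' := HasCompactSupport.smul_left (f := χ) φ.hasCompactSupport
  tsupport_subset' := (tsupport_smul_subset_right χ φ).trans φ.tsupport_subset

@[simp]
theorem smulLeft_apply (χ : (Fin d → ℝ) → ℝ) (hχ : ContDiff ℝ (⊤ : ℕ∞) χ) (φ : 𝓓(Ω, 𝕜))
    (x : Fin d → ℝ) : smulLeft χ hχ φ x = χ x • φ x := rfl

theorem pderiv_smulLeft_apply (j : Fin d) (χ : (Fin d → ℝ) → ℝ) (hχ : ContDiff ℝ (⊤ : ℕ∞) χ)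
    (φ : 𝓓(Ω, 𝕜)) (x : Fin d → ℝ) :
    pderiv j (smulLeft χ hχ φ) x =
      χ x • pderiv j φ x + fderiv ℝ χ x (Pi.single j 1) • φ x := by
  rw [pderiv_apply, pderiv_apply]
  change fderiv ℝ (fun x => χ x • φ x) x _ = _
  rw [fderiv_fun_smul ((hχ.differentiable (by simp)) x) (differentiable φ x)]
  simp

theorem contDiff_coord (j : Fin d) : ContDiff ℝ (⊤ : ℕ∞) (fun x : Fin d → ℝ => x j) :=
  contDiff_apply ℝ ℝ j

theorem eulerTranspose_eq (j : Fin d) (φ : 𝓓(Ω, 𝕜)) :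
    eulerTranspose j φ = -φ - smulLeft (fun x => x j) (contDiff_coord j) (pderiv j φ) := by
  ext x
  rw [eulerTranspose_apply]
  rfl

theorem pderiv_comm (i j : Fin d) (φ : 𝓓(Ω, 𝕜)) :
    pderiv i (pderiv j φ) = pderiv j (pderiv i φ) := by
  have h : ∀ (i j : Fin d) (x : Fin d → ℝ), pderiv i (pderiv j φ) x =
      fderiv ℝ (fderiv ℝ φ) x (Pi.single i 1) (Pi.single j 1) := by
    intro i j x
    rw [pderiv_apply, coe_pderiv, fderiv_clm_apply]
    · simp
    · exact ((smooth φ).fderiv_right (m := (⊤ : ℕ∞)) (by simp)).differentiable (by simp) x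
    · exact differentiableAt_const _
  ext x
  rw [h, h]
  have := (smooth φ).contDiffAt (x := x)
  refine (this.isSymmSndFDerivAt ?_) _ _
  rw [minSmoothness_of_isRCLikeNormedField]
  exact WithTop.coe_le_coe.2 (le_top : (2 : ℕ∞) ≤ ⊤)

/-- The commutator of `∂_i` with the transposed Euler derivative is `-∂_i` when `i = j` and zero
otherwise. Commutativity of the Euler derivatives and the flatness argument both rest on it. -/
theorem pderiv_eulerTranspose (i j : Fin d) (φ : 𝓓(Ω, 𝕜)) (x : Fin d → ℝ) :
    pderiv i (eulerTranspose j φ) x = eulerTranspose j (pderiv i φ) x -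
      if i = j then pderiv i φ x else 0 := by
  have h : fderiv ℝ (fun x : Fin d → ℝ => x j) x (Pi.single i 1) = if i = j then 1 else 0 := by
    have : (fun x : Fin d → ℝ => x j) = ContinuousLinearMap.proj (R := ℝ) j := rfl
    rw [this, ContinuousLinearMap.fderiv]
    simp [Pi.single_apply, eq_comm]
  rw [eulerTranspose_eq, map_sub, map_neg, sub_apply, neg_apply, pderiv_smulLeft_apply, h,
    eulerTranspose_apply, pderiv_comm i j]
  split_ifs with hij
  · subst hij
    simp only [one_smul]
    ring
  · simp

theorem eulerTranspose_comm (i j : Fin d) (φ : 𝓓(Ω, 𝕜)) :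
    eulerTranspose i (eulerTranspose j φ) = eulerTranspose j (eulerTranspose i φ) := by
  ext x
  rw [eulerTranspose_apply, eulerTranspose_apply, eulerTranspose_apply, eulerTranspose_apply,
    pderiv_eulerTranspose, pderiv_eulerTranspose, eulerTranspose_apply, eulerTranspose_apply,
    pderiv_comm i j]
  by_cases h : i = j
  · subst h; rfl
  · rw [if_neg h, if_neg (Ne.symm h)]
    simp only [RCLike.real_smul_eq_coe_mul]
    ring

/-- Products of the transposed Euler derivatives, indexed by words. -/
def eulerWord (w : List (Fin d)) (φ : 𝓓(Ω, 𝕜)) : 𝓓(Ω, 𝕜) := w.foldr eulerTranspose φ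

/-- Products of partial derivatives, indexed by words. -/
def pderivWord (w : List (Fin d)) (φ : 𝓓(Ω, 𝕜)) : 𝓓(Ω, 𝕜) := w.foldr (fun j => pderiv j) φ

@[simp] theorem eulerWord_nil (φ : 𝓓(Ω, 𝕜)) : eulerWord [] φ = φ := rfl

@[simp] theorem eulerWord_cons (j : Fin d) (w : List (Fin d)) (φ : 𝓓(Ω, 𝕜)) :
    eulerWord (j :: w) φ = eulerTranspose j (eulerWord w φ) := rfl

@[simp] theorem pderivWord_nil (φ : 𝓓(Ω, 𝕜)) : pderivWord [] φ = φ := rfl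

@[simp] theorem pderivWord_cons (j : Fin d) (w : List (Fin d)) (φ : 𝓓(Ω, 𝕜)) :
    pderivWord (j :: w) φ = pderiv j (pderivWord w φ) := rfl

theorem pderivWord_append (v w : List (Fin d)) (φ : 𝓓(Ω, 𝕜)) :
    pderivWord (v ++ w) φ = pderivWord v (pderivWord w φ) := List.foldr_append

theorem eulerWord_perm {v w : List (Fin d)} (h : v.Perm w) (φ : 𝓓(Ω, 𝕜)) :
    eulerWord v φ = eulerWord w φ :=
  haveI : LeftCommutative (eulerTranspose : Fin d → 𝓓(Ω, 𝕜) → 𝓓(Ω, 𝕜)) :=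
    ⟨fun i j φ => eulerTranspose_comm i j φ⟩
  h.foldr_eq φ

theorem pderivWord_perm {v w : List (Fin d)} (h : v.Perm w) (φ : 𝓓(Ω, 𝕜)) :
    pderivWord v φ = pderivWord w φ :=
  haveI : LeftCommutative (fun (j : Fin d) (φ : 𝓓(Ω, 𝕜)) => pderiv j φ) :=
    ⟨fun i j φ => pderiv_comm i j φ⟩
  h.foldr_eq φ

/-- The word which contains `j` exactly `β j` times. -/
def expandWord (β : Fin d → ℕ) : List (Fin d) :=
  (List.finRange d).flatMap fun j => List.replicate (β j) j

theorem count_expandWord (β : Fin d → ℕ) (i : Fin d) : (expandWord β).count i = β i := by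
  rw [expandWord, List.count_flatMap]
  have : (List.count i ∘ fun j => List.replicate (β j) j) = fun j => if j = i then β j else 0 := by
    funext j
    simp [List.count_replicate]
  rw [this, ← List.ofFn_eq_map, List.sum_ofFn]
  simp

theorem eulerTransposePow_eq_eulerWord (β : Fin d → ℕ) (φ : 𝓓(Ω, 𝕜)) :
    eulerTransposePow β φ = eulerWord (expandWord β) φ := by
  rw [eulerTransposePow, expandWord, eulerWord]
  induction List.finRange d with
  | nil => rfl
  | cons j l ih =>
    rw [List.flatMap_cons, List.foldr_append, List.foldr_cons, ih]
    generalize List.foldr _ _ _ = ψ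
    induction β j with
    | zero => rfl
    | succ n ihn => rw [Function.iterate_succ_apply', ihn]; rfl

/-- Since the factors commute, only multiplicities matter; this lets estimates be made with
arbitrary words. -/
theorem eulerWord_eq_eulerTransposePow (w : List (Fin d)) (φ : 𝓓(Ω, 𝕜)) :
    eulerWord w φ = eulerTransposePow (fun j => w.count j) φ := by
  rw [eulerTransposePow_eq_eulerWord]
  refine eulerWord_perm (List.perm_iff_count.2 fun i => ?_) φ
  rw [count_expandWord]

theorem pderiv_scale {φ : 𝓓(Ω, 𝕜)} {ψ : 𝓓(Ω', 𝕜)} {y : Fin d → ℝ}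
    (h : ∀ x, ψ x = φ (x * y)) (j : Fin d) (x : Fin d → ℝ) :
    pderiv j ψ x = y j • pderiv j φ (x * y) := by
  rw [pderiv_apply, pderiv_apply, show (ψ : (Fin d → ℝ) → 𝕜) = fun x => φ (x * y) from funext h]
  have hd : HasFDerivAt (fun x : Fin d → ℝ => x * y)
      ((ContinuousLinearMap.mul ℝ (Fin d → ℝ)).flip y) x :=
    ((ContinuousLinearMap.mul ℝ (Fin d → ℝ)).flip y).hasFDerivAt
  have := ((differentiable φ (x * y)).hasFDerivAt.comp x hd).fderiv
  change fderiv ℝ (φ ∘ fun x => x * y) x _ = _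
  rw [this, ContinuousLinearMap.comp_apply, ← map_smul]
  congr 1
  ext i
  by_cases hi : i = j
  · subst hi; simp
  · simp [hi]

/-- The Euler derivatives commute with dilations. -/
theorem eulerTranspose_scale {φ : 𝓓(Ω, 𝕜)} {ψ : 𝓓(Ω', 𝕜)} {y : Fin d → ℝ}
    (h : ∀ x, ψ x = φ (x * y)) (j : Fin d) (x : Fin d → ℝ) :
    eulerTranspose j ψ x = eulerTranspose j φ (x * y) := by
  rw [eulerTranspose_apply, eulerTranspose_apply, pderiv_scale h, h, smul_smul]
  rfl

theorem eulerWord_scale {φ : 𝓓(Ω, 𝕜)} {ψ : 𝓓(Ω', 𝕜)} {y : Fin d → ℝ}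
    (h : ∀ x, ψ x = φ (x * y)) (w : List (Fin d)) (x : Fin d → ℝ) :
    eulerWord w ψ x = eulerWord w φ (x * y) := by
  induction w generalizing x with
  | nil => exact h x
  | cons j w ih => exact eulerTranspose_scale ih j x

theorem tsupport_pderiv_subset (j : Fin d) (φ : 𝓓(Ω, 𝕜)) :
    tsupport (pderiv j φ) ⊆ tsupport φ := by
  rw [coe_pderiv]
  exact tsupport_fderiv_apply_subset ℝ (f := φ) (Pi.single j 1)

theorem contDiff_monomialFun (α : Fin d → ℕ) : ContDiff ℝ (⊤ : ℕ∞) (monomialFun 𝕜 α) := by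
  unfold monomialFun
  have h : ContDiff ℝ (⊤ : ℕ∞) (fun x : Fin d → ℝ => ∏ j, x j ^ α j) :=
    contDiff_prod fun j _ => (contDiff_coord j).pow _
  exact (ContinuousLinearMap.contDiff (RCLike.ofRealCLM (K := 𝕜))).comp h

/-- Along the `j`-th axis only one factor varies, and the function is `(x_j + t)^(α_j + 1)` times a
constant. -/
theorem fderiv_coord_mul_monomialFun (j : Fin d) (α : Fin d → ℕ) (x : Fin d → ℝ) :
    fderiv ℝ (fun x : Fin d → ℝ => (x j : 𝕜) * monomialFun 𝕜 α x) x (Pi.single j 1) =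
      (α j + 1) * monomialFun 𝕜 α x := by
  have hd : DifferentiableAt ℝ (fun x : Fin d → ℝ => (x j : 𝕜) * monomialFun 𝕜 α x) x := by
    refine DifferentiableAt.mul ?_ ((contDiff_monomialFun α).differentiable (by simp) x)
    exact (RCLike.ofRealCLM (K := 𝕜)).differentiableAt.comp x
      ((contDiff_coord j).differentiable (by simp) x)
  rw [← hd.lineDeriv_eq_fderiv]
  set c : ℝ := ∏ i ∈ Finset.univ.erase j, x i ^ α i
  set e : Fin d → ℝ := Pi.single j 1 with he
  have h1 : ∀ t : ℝ, (((x + t • e) j : ℝ) : 𝕜) *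
      monomialFun 𝕜 α (x + t • e) = (((x j + t) ^ (α j + 1) * c : ℝ) : 𝕜) := by
    intro t
    rw [monomialFun, ← RCLike.ofReal_mul, ← Finset.mul_prod_erase _ _ (Finset.mem_univ j)]
    congr 1
    have : ∏ i ∈ Finset.univ.erase j, (x + t • e) i ^ α i = c := by
      refine Finset.prod_congr rfl fun i hi => ?_
      simp [he, Finset.ne_of_mem_erase hi]
    rw [this]
    simp [he]
    ring
  have h2 : HasDerivAt (fun t : ℝ => (((x j + t) ^ (α j + 1) * c : ℝ) : 𝕜))
      (((α j + 1) * x j ^ α j * c : ℝ) : 𝕜) 0 := by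
    have h3 : HasDerivAt (fun t : ℝ => (x j + t) ^ (α j + 1) * c)
        ((α j + 1) * x j ^ α j * c) 0 := by
      have := (((hasDerivAt_id (0 : ℝ)).const_add (x j)).pow (α j + 1)).mul_const c
      convert! this using 1
      simp
    exact (RCLike.ofRealCLM (K := 𝕜)).hasFDerivAt.comp_hasDerivAt (0 : ℝ) h3
  rw [lineDeriv]
  simp only [h1]
  rw [h2.deriv, monomialFun, ← Finset.mul_prod_erase _ _ (Finset.mem_univ j)]
  change _ = (α j + 1) * ((x j ^ α j * c : ℝ) : 𝕜)
  push_cast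
  ring

/-- Integration by parts for the Euler derivative against monomials. -/
theorem integral_eulerTranspose_monomial (j : Fin d) (φ : 𝓓(Ω, 𝕜)) (α : Fin d → ℕ) :
    ∫ x, eulerTranspose j φ x * monomialFun 𝕜 α x = α j * ∫ x, φ x * monomialFun 𝕜 α x := by
  have hint : ∀ (ψ : 𝓓(Ω, 𝕜)) {g : (Fin d → ℝ) → 𝕜}, Continuous g →
      Integrable (fun x => g x * ψ x) := fun ψ g hg =>
    (hg.mul ψ.contDiff.continuous).integrable_of_hasCompactSupport ψ.hasCompactSupport.mul_left
  have hm := continuous_monomialFun (𝕜 := 𝕜) α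
  have hj : Continuous fun x : Fin d → ℝ => (x j : 𝕜) :=
    RCLike.continuous_ofReal.comp (continuous_apply j)
  have hd : Differentiable ℝ (fun x : Fin d → ℝ => (x j : 𝕜) * monomialFun 𝕜 α x) :=
    Differentiable.mul ((RCLike.ofRealCLM (K := 𝕜)).differentiable.comp
      ((contDiff_coord j).differentiable (by simp)))
      ((contDiff_monomialFun α).differentiable (by simp))
  -- The derivative is moved onto `x_j x^α`, giving `(α_j + 1) x^α`; the term `-φ` of the transposed
  -- operator lowers the factor to `α_j`.
  have key := integral_mul_fderiv_eq_neg_fderiv_mul_of_integrable (μ := volume) (𝕜 := 𝕜)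
    (f := fun x : Fin d → ℝ => (x j : 𝕜) * monomialFun 𝕜 α x) (g := φ) (v := Pi.single j 1)
    ?_ ?_ (hint φ (hj.mul hm)) (fun x _ => hd x)
    (fun x _ => differentiable φ x)
  · simp only [fderiv_coord_mul_monomialFun, ← pderiv_apply] at key
    have h1 : ∀ x, eulerTranspose j φ x * monomialFun 𝕜 α x =
        -(monomialFun 𝕜 α x * φ x) - (x j : 𝕜) * monomialFun 𝕜 α x * pderiv j φ x := by
      intro x
      rw [eulerTranspose_apply, RCLike.real_smul_eq_coe_mul]
      ring
    simp only [h1]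
    have h2 : Integrable (fun x => -(monomialFun 𝕜 α x * φ x)) := (hint φ hm).neg
    have h3 : Integrable (fun x => (x j : 𝕜) * monomialFun 𝕜 α x * pderiv j φ x) :=
      hint _ (hj.mul hm)
    rw [integral_sub h2 h3, key, integral_neg]
    simp only [mul_assoc, integral_const_mul, mul_comm (φ _)]
    ring
  · simp only [fderiv_coord_mul_monomialFun]
    exact hint φ (continuous_const.mul hm)
  · simp only [← pderiv_apply]
    exact hint _ (hj.mul hm)

end Operators

end HadamardOp
end

noncomputable section

namespace HadamardOp

open Filter Topology Set

/-! ### Continuity of the elementary operators -/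

section Continuity

variable {𝕜 : Type*} [RCLike 𝕜] {d : ℕ} {Ω Ω' : Opens (Fin d → ℝ)}

/-- Multiplication by a smooth function as a continuous linear map. -/
def smulLeftCLM (χ : (Fin d → ℝ) → ℝ) (hχ : ContDiff ℝ (⊤ : ℕ∞) χ) :
    𝓓(Ω, 𝕜) →L[𝕜] 𝓓(Ω, 𝕜) :=
  TestFunction.limitCLM 𝕜 (smulLeft χ hχ)
    (fun K hK => (TestFunction.ofSupportedInCLM 𝕜 hK).comp
      (ContDiffMapSupportedIn.bilinLeftCLM (ContinuousLinearMap.mul 𝕜 𝕜)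
        (g := fun x => (χ x : 𝕜)) ((RCLike.ofRealCLM (K := 𝕜)).contDiff.comp hχ)))
    (fun K hK f => by
      ext x
      change χ x • f x = f x * (χ x : 𝕜)
      rw [RCLike.real_smul_eq_coe_mul, mul_comm])

/-- `eulerTranspose` as a continuous linear map. -/
def eulerCLM (j : Fin d) : 𝓓(Ω, 𝕜) →L[𝕜] 𝓓(Ω, 𝕜) :=
  -ContinuousLinearMap.id 𝕜 _ - (smulLeftCLM (fun x => x j) (contDiff_coord j)).comp (pderiv j)

@[simp]
theorem eulerCLM_apply (j : Fin d) (φ : 𝓓(Ω, 𝕜)) : eulerCLM j φ = eulerTranspose j φ :=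
  (eulerTranspose_eq j φ).symm

/-- `eulerWord` as a continuous linear map. -/
def eulerWordCLM (w : List (Fin d)) : 𝓓(Ω, 𝕜) →L[𝕜] 𝓓(Ω, 𝕜) :=
  w.foldr (fun j A => (eulerCLM j).comp A) (ContinuousLinearMap.id 𝕜 _)

@[simp]
theorem eulerWordCLM_apply (w : List (Fin d)) (φ : 𝓓(Ω, 𝕜)) :
    eulerWordCLM w φ = eulerWord w φ := by
  induction w with
  | nil => rfl
  | cons j w ih => 
    rw [eulerWord_cons, ← ih, ← eulerCLM_apply]
    rfl

/-- `pderivWord` as a continuous linear map. -/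
def pderivWordCLM (w : List (Fin d)) : 𝓓(Ω, 𝕜) →L[𝕜] 𝓓(Ω, 𝕜) :=
  w.foldr (fun j A => (pderiv j).comp A) (ContinuousLinearMap.id 𝕜 _)

@[simp]
theorem pderivWordCLM_apply (w : List (Fin d)) (φ : 𝓓(Ω, 𝕜)) :
    pderivWordCLM w φ = pderivWord w φ := by
  induction w with
  | nil => rfl
  | cons j w ih => 
    rw [pderivWord_cons, ← ih]
    rfl

/-- The function `x ↦ φ(xu)` as a test function on another open set. -/
def scaleTo (Ω' : Opens (Fin d → ℝ)) (u : Fin d → ℝ) (hu : ∀ j, u j ≠ 0) (φ : 𝓓(Ω, 𝕜))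
    (h : ∀ x, x * u ∈ tsupport φ → x ∈ Ω') : 𝓓(Ω', 𝕜) where
  toFun x := φ (x * u)
  contDiff' := φ.contDiff.comp (contDiff_id.mul contDiff_const)
  hasCompactSupport' := (dilate u hu φ).hasCompactSupport
  tsupport_subset' := fun x hx => h x (tsupport_comp_subset_preimage φ
    (continuous_id.mul continuous_const : Continuous fun x : Fin d → ℝ => x * u) hx)

@[simp]
theorem scaleTo_apply (u : Fin d → ℝ) (hu : ∀ j, u j ≠ 0) (φ : 𝓓(Ω, 𝕜))
    (h : ∀ x, x * u ∈ tsupport φ → x ∈ Ω') (x : Fin d → ℝ) :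
    scaleTo Ω' u hu φ h x = φ (x * u) := rfl

@[simp]
theorem dilate_apply (u : Fin d → ℝ) (hu : ∀ j, u j ≠ 0) (φ : 𝓓(Ω, 𝕜)) (x : Fin d → ℝ) :
    dilate u hu φ x = φ (x * u) := rfl

theorem norm_iteratedFDeriv_comp_mul_le {f : (Fin d → ℝ) → 𝕜} (hf : ContDiff ℝ (⊤ : ℕ∞) f)
    (u x : Fin d → ℝ) (i : ℕ) :
    ‖iteratedFDeriv ℝ i (fun x => f (x * u)) x‖ ≤ ‖u‖ ^ i * ‖iteratedFDeriv ℝ i f (x * u)‖ := by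
  set g := (ContinuousLinearMap.mul ℝ (Fin d → ℝ)).flip u
  have h := g.iteratedFDeriv_comp_right hf x (i := i) (by exact_mod_cast le_top)
  change ‖iteratedFDeriv ℝ i (f ∘ g) x‖ ≤ _
  rw [h, mul_comm]
  refine (ContinuousMultilinearMap.norm_compContinuousLinearMap_le _ _).trans ?_
  have hg : ‖g‖ ≤ ‖u‖ :=
    g.opNorm_le_bound (norm_nonneg _) fun y => (norm_mul_le _ _).trans_eq (mul_comm _ _)
  rw [Finset.prod_const, Finset.card_univ, Fintype.card_fin]
  exact mul_le_mul_of_nonneg_left (pow_le_pow_left₀ (norm_nonneg _) hg _) (norm_nonneg _)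

theorem norm_iteratedFDeriv_comp_mul_le' {f : (Fin d → ℝ) → 𝕜} (hf : ContDiff ℝ (⊤ : ℕ∞) f)
    (u x : Fin d → ℝ) (i : ℕ) :
    ‖iteratedFDeriv ℝ i (fun x => f (u * x)) x‖ ≤ ‖u‖ ^ i * ‖iteratedFDeriv ℝ i f (u * x)‖ := by
  simpa only [mul_comm u] using norm_iteratedFDeriv_comp_mul_le hf u x i

/-- Dilation as a continuous linear map between spaces of functions with fixed support. -/
def scaleSupp (u : Fin d → ℝ) (K K' : Compacts (Fin d → ℝ)) (h : ∀ x, x * u ∈ K → x ∈ K') :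
    𝓓_{K}(Fin d → ℝ, 𝕜) →L[𝕜] 𝓓_{K'}(Fin d → ℝ, 𝕜) :=
  ContDiffMapSupportedIn.mkCLM 𝕜 (fun φ x => φ (x * u)) (fun _ _ _ => rfl) (fun _ _ _ => rfl)
    (fun φ => φ.contDiff.comp (contDiff_id.mul contDiff_const))
    (fun φ x hx => φ.zero_on_compl fun hx' => hx (h x hx'))
    (fun i _ => ⟨{i}, ‖u‖ ^ i, by positivity, fun φ x _ => by
      refine (norm_iteratedFDeriv_comp_mul_le φ.contDiff u x i).trans ?_
      gcongr
      rw [Finset.sup_singleton]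
      exact ContDiffMapSupportedIn.norm_iteratedFDeriv_apply_le_seminorm_top 𝕜⟩)

theorem bddAbove_iteratedFDeriv (φ : 𝓓(Ω, 𝕜)) (i : ℕ) :
    ∃ C, 0 ≤ C ∧ ∀ x, ‖iteratedFDeriv ℝ i φ x‖ ≤ C := by
  refine ⟨‖derivBCF Ω 𝕜 i φ‖, (norm_nonneg _).trans
    (BoundedContinuousFunction.norm_coe_le_norm (derivBCF Ω 𝕜 i φ) 0), fun x => ?_⟩
  rw [← derivBCF_apply]
  exact BoundedContinuousFunction.norm_coe_le_norm _ x

/-- A distribution vanishes on the test functions supported in the complement of its support. -/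
theorem apply_eq_zero_of_disjoint_dsupport (T : Dist 𝕜 Ω) (φ : 𝓓(Ω, 𝕜))
    (h : ∀ x ∈ tsupport φ, x ∉ Distribution.dsupport T) : T φ = 0 := by
  have h1 : ∀ x : tsupport φ, ∃ s : Set (Fin d → ℝ),
      Distribution.IsVanishingOn T s ∧ IsOpen s ∧ x.1 ∈ s :=
    fun x => (Distribution.notMem_dsupport_iff x.1).1 (h x.1 x.2)
  choose s hs ho hx using h1
  -- Vanishing is only local: a partition of unity subordinate to finitely many sets on which `T`
  -- vanishes splits `φ` into pieces annihilated by `T`.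
  obtain ⟨t, ht⟩ := IsCompact.elim_finite_subcover (φ.hasCompactSupport : IsCompact (tsupport φ))
    s ho fun x hx' => mem_iUnion.2 ⟨⟨x, hx'⟩, hx _⟩
  obtain ⟨ρ, hρ⟩ := SmoothPartitionOfUnity.exists_isSubordinate (modelWithCornersSelf ℝ (Fin d → ℝ))
    (isClosed_tsupport φ) (fun i : t => s i.1) (fun i => ho i.1) (fun x hx' => by
      obtain ⟨i, hi, hxi⟩ := mem_iUnion₂.1 (ht hx')
      exact mem_iUnion.2 ⟨⟨i, hi⟩, hxi⟩)
  have hsm : ∀ i, ContDiff ℝ (⊤ : ℕ∞) (ρ i) := fun i => (ρ i).contMDiff.contDiff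
  have hsum : φ = ∑ i, smulLeft (ρ i) (hsm i) φ := by
    ext x
    rw [sum_apply]
    simp only [smulLeft_apply]
    rw [← Finset.sum_smul]
    by_cases hx' : x ∈ tsupport φ
    · have := ρ.sum_eq_one hx'
      rw [finsum_eq_sum_of_fintype] at this
      rw [this, one_smul]
    · rw [image_eq_zero_of_notMem_tsupport hx', smul_zero]
  rw [hsum, map_sum]
  refine Finset.sum_eq_zero fun i _ => hs i.1 _ ?_
  exact (tsupport_smul_subset_left (ρ i) φ).trans (hρ i)

end Continuity

end HadamardOp
end

noncomputable section

namespace HadamardOp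

open Filter Topology Set

/-! ### Multiplicative convolution of a function with a smooth function -/

section MulConvolution

variable {𝕜 : Type*} [RCLike 𝕜] {d : ℕ}

theorem iteratedFDeriv_comp_mul {g : (Fin d → ℝ) → 𝕜} (hg : ContDiff ℝ (⊤ : ℕ∞) g)
    (x y : Fin d → ℝ) (i : ℕ) :
    iteratedFDeriv ℝ i (fun y => g (x * y)) y =
      ContinuousMultilinearMap.compContinuousLinearMapContinuousMultilinear ℝ
        (fun _ : Fin i => Fin d → ℝ) (fun _ : Fin i => Fin d → ℝ) 𝕜
        (fun _ => ContinuousLinearMap.mul ℝ (Fin d → ℝ) x) (iteratedFDeriv ℝ i g (x * y)) :=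
  (ContinuousLinearMap.mul ℝ (Fin d → ℝ) x).iteratedFDeriv_comp_right hg y
    (by exact_mod_cast le_top)

theorem continuous_iteratedFDeriv_comp_mul {g : (Fin d → ℝ) → 𝕜}
    (hg : ContDiff ℝ (⊤ : ℕ∞) g) (i : ℕ) :
    Continuous fun p : (Fin d → ℝ) × (Fin d → ℝ) =>
      iteratedFDeriv ℝ i (fun y => g (p.1 * y)) p.2 := by
  simp only [iteratedFDeriv_comp_mul hg]
  refine Continuous.clm_apply ?_ ?_
  · refine (ContinuousMultilinearMap.cont _).comp (continuous_pi fun _ => ?_)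
    exact (ContinuousLinearMap.mul ℝ (Fin d → ℝ)).continuous.comp continuous_fst
  · exact (hg.continuous_iteratedFDeriv (by exact_mod_cast le_top)).comp
      (continuous_fst.mul continuous_snd)

variable {g : (Fin d → ℝ) → 𝕜} {u : (Fin d → ℝ) → 𝕜} {m : ℕ} {C : ℕ → ℝ}

/-- The `i`-th derivative in `y` of `g(xy)` costs a factor `‖x‖^i`. Finite moments of `u` up to
order `m` therefore dominate `m` differentiations under the integral sign. -/
theorem hasFTaylorSeriesUpTo_integral_mul (hg : ContDiff ℝ (⊤ : ℕ∞) g)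
    (hC : ∀ i x, ‖iteratedFDeriv ℝ i g x‖ ≤ C i) (hu : AEStronglyMeasurable u volume)
    (hint : ∀ i ≤ m, Integrable fun x => ‖u x‖ * ‖x‖ ^ i) :
    HasFTaylorSeriesUpTo m (fun y => ∫ x, u x • g (x * y)) fun y i =>
      ∫ x, u x • iteratedFDeriv ℝ i (fun y => g (x * y)) y := by
  have hmeas : ∀ (i : ℕ) (y : Fin d → ℝ), AEStronglyMeasurable
      (fun x => u x • iteratedFDeriv ℝ i (fun y => g (x * y)) y) volume := fun i y =>
    hu.smul ((continuous_iteratedFDeriv_comp_mul hg i).comp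
      (continuous_id.prodMk continuous_const)).aestronglyMeasurable
  have hbd : ∀ (i : ℕ) (x y : Fin d → ℝ),
      ‖u x • iteratedFDeriv ℝ i (fun y => g (x * y)) y‖ ≤ ‖u x‖ * ‖x‖ ^ i * C i := by
    intro i x y
    rw [norm_smul, mul_assoc]
    gcongr
    refine (norm_iteratedFDeriv_comp_mul_le' hg x y i).trans ?_
    gcongr
    exact hC i _
  have hI : ∀ i ≤ m, Integrable fun x => ‖u x‖ * ‖x‖ ^ i * C i := fun i hi =>
    (hint i hi).mul_const _
  have hsm : ∀ x : Fin d → ℝ, ContDiff ℝ (⊤ : ℕ∞) fun y => g (x * y) := fun x =>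
    hg.comp (contDiff_const.mul contDiff_id)
  refine ⟨fun y => ?_, fun i hi y => ?_, fun i hi => ?_⟩
  · have h1 : Integrable (fun x => u x • iteratedFDeriv ℝ 0 (fun y => g (x * y)) y) :=
      (hI 0 (Nat.zero_le _)).mono' (hmeas 0 y) (Eventually.of_forall fun x => hbd 0 x y)
    have := (ContinuousMultilinearMap.apply ℝ (fun _ : Fin 0 => Fin d → ℝ) 𝕜
      0).integral_comp_comm h1
    rw [ContinuousMultilinearMap.curry0_apply]
    change ContinuousMultilinearMap.apply ℝ (fun _ : Fin 0 => Fin d → ℝ) 𝕜 0 _ = _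
    rw [← this]
    rfl
  · have hi' : i + 1 ≤ m := by exact_mod_cast hi
    let J := continuousMultilinearCurryLeftEquiv ℝ (fun _ : Fin (i + 1) => Fin d → ℝ) 𝕜
    have key := hasFDerivAt_integral_of_dominated_of_fderiv_le (μ := volume) (𝕜 := ℝ)
      (F := fun y x => u x • iteratedFDeriv ℝ i (fun y => g (x * y)) y)
      (F' := fun y x => J (u x • iteratedFDeriv ℝ (i + 1) (fun y => g (x * y)) y))
      (x₀ := y) (bound := fun x => ‖u x‖ * ‖x‖ ^ (i + 1) * C (i + 1)) univ_mem
      (Eventually.of_forall fun y => hmeas i y)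
      ((hI i (by lia)).mono' (hmeas i y) (Eventually.of_forall fun x => hbd i x y))
      (J.continuous.comp_aestronglyMeasurable (hmeas (i + 1) y))
      (Eventually.of_forall fun x y _ => ?_) (hI _ hi') (Eventually.of_forall fun x y _ => ?_)
    · convert! key using 1
      have h1 : Integrable (fun x => u x • iteratedFDeriv ℝ (i + 1) (fun y => g (x * y)) y) :=
        (hI _ hi').mono' (hmeas _ y) (Eventually.of_forall fun x => hbd _ x y)
      exact (ContinuousLinearMap.integral_comp_comm (𝕜 := ℝ)
        (E := (Fin d → ℝ) [×(i + 1)]→L[ℝ] 𝕜) (Fₗ := (Fin d → ℝ) →L[ℝ] (Fin d → ℝ) [×i]→L[ℝ] 𝕜)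
        J.toContinuousLinearEquiv.toContinuousLinearMap h1).symm
    · rw [LinearIsometryEquiv.norm_map]
      exact hbd _ _ _
    · have h1 : DifferentiableAt ℝ (iteratedFDeriv ℝ i fun y => g (x * y)) y :=
        (hsm x).differentiable_iteratedFDeriv (by exact_mod_cast WithTop.coe_lt_top _) y
      have h2 := h1.hasFDerivAt.const_smul (u x)
      exact h2
  · have hi' : i ≤ m := by exact_mod_cast hi
    refine continuous_of_dominated (fun y => hmeas i y)
      (fun y => Eventually.of_forall fun x => hbd i x y) (hI i hi')
      (Eventually.of_forall fun x => ?_)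
    exact ((continuous_iteratedFDeriv_comp_mul hg i).comp
      (continuous_const.prodMk continuous_id)).const_smul (u x)

theorem contDiff_integral_mul (hg : ContDiff ℝ (⊤ : ℕ∞) g)
    (hC : ∀ i x, ‖iteratedFDeriv ℝ i g x‖ ≤ C i) (hu : AEStronglyMeasurable u volume)
    (hint : ∀ i ≤ m, Integrable fun x => ‖u x‖ * ‖x‖ ^ i) :
    ContDiff ℝ m fun y => ∫ x, u x • g (x * y) :=
  contDiffOn_univ.1 (HasFTaylorSeriesUpToOn.contDiffOn (n := m)
    (hasFTaylorSeriesUpToOn_univ_iff.2 (hasFTaylorSeriesUpTo_integral_mul hg hC hu hint)))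

theorem norm_iteratedFDeriv_integral_mul_le (hg : ContDiff ℝ (⊤ : ℕ∞) g)
    (hC : ∀ i x, ‖iteratedFDeriv ℝ i g x‖ ≤ C i) (hu : AEStronglyMeasurable u volume)
    (hint : ∀ i ≤ m, Integrable fun x => ‖u x‖ * ‖x‖ ^ i) (y : Fin d → ℝ) :
    ‖iteratedFDeriv ℝ m (fun y => ∫ x, u x • g (x * y)) y‖ ≤
      (∫ x, ‖u x‖ * ‖x‖ ^ m) * C m := by
  rw [← (hasFTaylorSeriesUpTo_integral_mul hg hC hu hint).eq_iteratedFDeriv le_rfl,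
    ← integral_mul_const]
  refine norm_integral_le_of_norm_le ((hint m le_rfl).mul_const _)
    (Eventually.of_forall fun x => ?_)
  rw [norm_smul, mul_assoc]
  gcongr
  refine (norm_iteratedFDeriv_comp_mul_le' hg x y m).trans ?_
  gcongr
  exact hC m _

end MulConvolution

end HadamardOp
end

noncomputable section

namespace HadamardOp

open Filter Topology Set

/-! ### Coordinatewise multiplication: density and change of variables -/

section CoordinatewiseMul

variable {d : ℕ}

theorem dense_forall_ne_zero : Dense {y : Fin d → ℝ | ∀ j, y j ≠ 0} := by
  have h : {y : Fin d → ℝ | ∀ j, y j ≠ 0} = Set.pi univ fun _ => ({0}ᶜ : Set ℝ) := by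
    ext y
    simp
  rw [h]
  exact dense_pi _ fun _ _ => dense_compl_singleton 0

theorem eq_of_eqOn_forall_ne_zero {F : Type*} [TopologicalSpace F] [T2Space F]
    {f g : (Fin d → ℝ) → F} (hf : Continuous f) (hg : Continuous g)
    (h : ∀ y, (∀ j, y j ≠ 0) → f y = g y) : f = g :=
  hf.ext_on dense_forall_ne_zero hg fun y hy => h y hy

/-- Multiplication by a vector without zero coordinates as a homeomorphism. -/
def mulHomeo (x : Fin d → ℝ) (hx : ∀ j, x j ≠ 0) : (Fin d → ℝ) ≃ₜ (Fin d → ℝ) where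
  toFun y := x * y
  invFun y := x⁻¹ * y
  left_inv y := by ext j; simp [hx j]
  right_inv y := by ext j; simp [hx j]
  continuous_toFun := continuous_const.mul continuous_id
  continuous_invFun := continuous_const.mul continuous_id

theorem map_mul_volume (x : Fin d → ℝ) (hx : ∀ j, x j ≠ 0) :
    Measure.map (fun y => x * y) (volume : Measure (Fin d → ℝ)) =
      ENNReal.ofReal |∏ j, x j|⁻¹ • volume := by
  have hdet : (Matrix.diagonal x).det ≠ 0 := by
    rw [Matrix.det_diagonal]
    exact Finset.prod_ne_zero_iff.2 fun j _ => hx j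
  have h := Real.map_matrix_volume_pi_eq_smul_volume_pi hdet
  rw [Matrix.det_diagonal, abs_inv] at h
  rw [← h]
  congr 1
  ext y j
  simp [Matrix.mulVec_diagonal]

variable {F : Type*} [NormedAddCommGroup F]

theorem integrable_comp_mul {f : (Fin d → ℝ) → F} (hf : Integrable f) (x : Fin d → ℝ)
    (hx : ∀ j, x j ≠ 0) : Integrable fun y => f (x * y) := by
  have h : Integrable f (Measure.map (fun y => x * y) volume) := by
    rw [map_mul_volume x hx]
    exact hf.smul_measure ENNReal.ofReal_ne_top
  exact (integrable_map_equiv (mulHomeo x hx).toMeasurableEquiv f).1 h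

theorem integral_comp_mul [NormedSpace ℝ F] (f : (Fin d → ℝ) → F) (x : Fin d → ℝ)
    (hx : ∀ j, x j ≠ 0) : ∫ y, f (x * y) = |∏ j, x j|⁻¹ • ∫ y, f y := by
  have h := integral_map_equiv (μ := volume) (mulHomeo x hx).toMeasurableEquiv f
  have h2 : Measure.map (mulHomeo x hx).toMeasurableEquiv (volume : Measure (Fin d → ℝ)) =
      ENNReal.ofReal |∏ j, x j|⁻¹ • volume := map_mul_volume x hx
  rw [h2, integral_smul_measure, ENNReal.toReal_ofReal (by positivity)] at h
  exact h.symm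

end CoordinatewiseMul

/-! ### Leibniz rules for products of functions of one variable -/

section Leibniz

variable {𝕜 : Type*} [RCLike 𝕜] {d : ℕ} {Ω : Opens (Fin d → ℝ)}

/-- The function `x ↦ ∏ j, η_j (x_j)`. -/
def tensor (η : Fin d → ℝ → ℝ) (x : Fin d → ℝ) : ℝ := ∏ j, η j (x j)

theorem contDiff_tensor {η : Fin d → ℝ → ℝ} (h : ∀ j, ContDiff ℝ (⊤ : ℕ∞) (η j)) :
    ContDiff ℝ (⊤ : ℕ∞) (tensor η) :=
  contDiff_prod fun j _ => (h j).comp (contDiff_coord j)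

theorem tensor_update (η : Fin d → ℝ → ℝ) (j : Fin d) (f : ℝ → ℝ) (x : Fin d → ℝ) :
    tensor (Function.update η j f) x = f (x j) * ∏ i ∈ Finset.univ.erase j, η i (x i) := by
  rw [tensor, ← Finset.mul_prod_erase _ _ (Finset.mem_univ j), Function.update_self]
  congr 1
  exact Finset.prod_congr rfl fun i hi => by rw [Function.update_of_ne (Finset.ne_of_mem_erase hi)]

theorem tensor_eq_mul_erase (η : Fin d → ℝ → ℝ) (j : Fin d) (x : Fin d → ℝ) :
    tensor η x = η j (x j) * ∏ i ∈ Finset.univ.erase j, η i (x i) := by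
  rw [tensor, ← Finset.mul_prod_erase _ _ (Finset.mem_univ j)]

theorem fderiv_tensor {η : Fin d → ℝ → ℝ} (h : ∀ j, ContDiff ℝ (⊤ : ℕ∞) (η j)) (j : Fin d)
    (x : Fin d → ℝ) :
    fderiv ℝ (tensor η) x (Pi.single j 1) = tensor (Function.update η j (deriv (η j))) x := by
  have hd : DifferentiableAt ℝ (tensor η) x := (contDiff_tensor h).differentiable (by simp) x
  rw [← hd.lineDeriv_eq_fderiv, tensor_update]
  set c : ℝ := ∏ i ∈ Finset.univ.erase j, η i (x i)
  set e : Fin d → ℝ := Pi.single j 1 with he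
  have h1 : ∀ t : ℝ, tensor η (x + t • e) = η j (x j + t) * c := by
    intro t
    rw [tensor_eq_mul_erase η j]
    congr 1
    · simp [he]
    · refine Finset.prod_congr rfl fun i hi => ?_
      simp [he, Finset.ne_of_mem_erase hi]
  rw [lineDeriv]
  simp only [h1]
  have h2 : HasDerivAt (η j) (deriv (η j) (x j)) (x j + 0) := by
    rw [add_zero]
    exact ((h j).differentiable (by simp) _).hasDerivAt
  have h3 := (h2.comp (0 : ℝ) ((hasDerivAt_id (0 : ℝ)).const_add (x j))).mul_const c
  convert! h3.deriv using 1
  simp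

/-- The operator `A` on test functions is a combination of the `eulerWord`s with coefficients
in `𝒞`. -/
def HasEulerExpansion (𝒞 : Set ((Fin d → ℝ) → ℝ)) (A : 𝓓(Ω, 𝕜) → 𝓓(Ω, 𝕜)) : Prop :=
  ∃ l : List (((Fin d → ℝ) → ℝ) × List (Fin d)), (∀ p ∈ l, p.1 ∈ 𝒞) ∧
    ∀ h x, A h x = (l.map fun p => p.1 x • eulerWord p.2 h x).sum

theorem HasEulerExpansion.add {𝒞 : Set ((Fin d → ℝ) → ℝ)} {A B : 𝓓(Ω, 𝕜) → 𝓓(Ω, 𝕜)}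
    (hA : HasEulerExpansion 𝒞 A) (hB : HasEulerExpansion 𝒞 B) :
    HasEulerExpansion 𝒞 fun h => A h + B h := by
  obtain ⟨l, hl, hl'⟩ := hA
  obtain ⟨m, hm, hm'⟩ := hB
  refine ⟨l ++ m, fun p hp => (List.mem_append.1 hp).elim (hl p) (hm p), fun h x => ?_⟩
  rw [add_apply, hl', hm', List.map_append, List.sum_append]

theorem HasEulerExpansion.zero {𝒞 : Set ((Fin d → ℝ) → ℝ)} :
    HasEulerExpansion 𝒞 fun _ : 𝓓(Ω, 𝕜) => 0 :=
  ⟨[], by simp, fun h x => rfl⟩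

theorem HasEulerExpansion.comp_eulerWord {𝒞 : Set ((Fin d → ℝ) → ℝ)} {A : 𝓓(Ω, 𝕜) → 𝓓(Ω, 𝕜)}
    (hA : HasEulerExpansion 𝒞 A) (w : List (Fin d)) :
    HasEulerExpansion 𝒞 fun h => A (eulerWord w h) := by
  obtain ⟨l, hl, hl'⟩ := hA
  refine ⟨l.map fun p => (p.1, p.2 ++ w), ?_, fun h x => ?_⟩
  · intro p hp
    obtain ⟨q, hq, rfl⟩ := List.mem_map.1 hp
    exact hl q hq
  · rw [hl', List.map_map]
    congr 1
    refine List.map_congr_left fun p _ => ?_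
    simp [eulerWord, List.foldr_append]

/-- If the products of `O_j` with multiplications by elements of `𝒞` have expansions, then so have
the products of the words in the `O_j` with these multiplications. -/
theorem hasEulerExpansion_foldr {𝒞 : Set ((Fin d → ℝ) → ℝ)}
    (h𝒞 : ∀ χ ∈ 𝒞, ContDiff ℝ (⊤ : ℕ∞) χ) (O : Fin d → 𝓓(Ω, 𝕜) →L[𝕜] 𝓓(Ω, 𝕜))
    (hO : ∀ (j : Fin d) (χ) (hχ : χ ∈ 𝒞), HasEulerExpansion 𝒞
      fun h : 𝓓(Ω, 𝕜) => O j (smulLeft χ (h𝒞 χ hχ) h))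
    (w : List (Fin d)) {χ : (Fin d → ℝ) → ℝ} (hχ : χ ∈ 𝒞) :
    HasEulerExpansion 𝒞 fun h : 𝓓(Ω, 𝕜) =>
      w.foldr (fun j => O j) (smulLeft χ (h𝒞 χ hχ) h) := by
  induction w with
  | nil => exact ⟨[(χ, [])], by simpa using hχ, fun h x => by simp⟩
  | cons j w ih =>
    obtain ⟨l, hl, hl'⟩ := ih
    -- The inductive expansion is pointwise, while `O j` acts on test functions; the sum is rebuilt
    -- term by term as a test function.
    have key : ∀ l : List (((Fin d → ℝ) → ℝ) × List (Fin d)), (∀ p ∈ l, p.1 ∈ 𝒞) →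
        ∃ A : 𝓓(Ω, 𝕜) → 𝓓(Ω, 𝕜),
          (∀ h x, A h x = (l.map fun p => p.1 x • eulerWord p.2 h x).sum) ∧
          HasEulerExpansion 𝒞 fun h => O j (A h) := by
      intro l
      induction l with
      | nil =>
        refine fun _ => ⟨fun _ => 0, fun h x => rfl, ?_⟩
        simp only [map_zero]
        exact HasEulerExpansion.zero
      | cons p l ih =>
        intro hp
        obtain ⟨A, hA, hA'⟩ := ih fun q hq => hp q (List.mem_cons_of_mem _ hq)
        have hp1 := hp p List.mem_cons_self
        refine ⟨fun h => smulLeft p.1 (h𝒞 _ hp1) (eulerWord p.2 h) + A h, fun h x => ?_, ?_⟩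
        · rw [add_apply, hA]
          rfl
        · simp only [map_add]
          exact ((hO j _ hp1).comp_eulerWord p.2).add hA'
    obtain ⟨A, hA, hA'⟩ := key l hl
    have : (fun h : 𝓓(Ω, 𝕜) => (j :: w).foldr (fun j => ⇑(O j)) (smulLeft χ (h𝒞 χ hχ) h)) =
        fun h => O j (A h) := by
      funext h
      rw [List.foldr_cons]
      congr 1
      ext x
      rw [hl', hA]
    rw [this]
    exact hA'

/-- The products `∏ j, η_j (x_j)` with factors in `𝒢`. -/
def tensorClass (d : ℕ) (𝒢 : Set (ℝ → ℝ)) : Set ((Fin d → ℝ) → ℝ) :=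
  {χ | ∃ η : Fin d → ℝ → ℝ, (∀ j, η j ∈ 𝒢) ∧ χ = tensor η}

theorem tensorClass_contDiff {𝒢 : Set (ℝ → ℝ)} (h : ∀ η ∈ 𝒢, ContDiff ℝ (⊤ : ℕ∞) η) :
    ∀ χ ∈ tensorClass d 𝒢, ContDiff ℝ (⊤ : ℕ∞) χ := by
  rintro _ ⟨η, hη, rfl⟩
  exact contDiff_tensor fun j => h _ (hη j)

theorem update_mem {𝒢 : Set (ℝ → ℝ)} {η : Fin d → ℝ → ℝ} (hη : ∀ j, η j ∈ 𝒢) (j : Fin d)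
    {f : ℝ → ℝ} (hf : f ∈ 𝒢) (i : Fin d) : Function.update η j f i ∈ 𝒢 := by
  by_cases h : i = j
  · subst h; simpa using hf
  · rw [Function.update_of_ne h]; exact hη i

/-- The Leibniz rule replaces one factor `η_j` by `-s η_j'`, so closure under this operation
suffices. -/
theorem hasEulerExpansion_eulerWord_smulLeft {𝒢 : Set (ℝ → ℝ)}
    (h𝒢 : ∀ η ∈ 𝒢, ContDiff ℝ (⊤ : ℕ∞) η)
    (h1 : ∀ η ∈ 𝒢, (fun s => -(s * deriv η s)) ∈ 𝒢) (w : List (Fin d))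
    {χ : (Fin d → ℝ) → ℝ} (hχ : χ ∈ tensorClass d 𝒢) :
    HasEulerExpansion (tensorClass d 𝒢) fun h : 𝓓(Ω, 𝕜) =>
      eulerWord w (smulLeft χ (tensorClass_contDiff h𝒢 χ hχ) h) := by
  have h2 := hasEulerExpansion_foldr (Ω := Ω) (𝕜 := 𝕜) (tensorClass_contDiff h𝒢)
    eulerCLM ?_ w hχ
  · have h3 : ∀ ψ : 𝓓(Ω, 𝕜), w.foldr (fun j => ⇑(eulerCLM j)) ψ = eulerWord w ψ := by
      intro ψ
      simp only [eulerWord]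
      congr 1
      funext j φ
      exact eulerCLM_apply j φ
    simpa only [h3] using h2
  · intro j χ hχ
    obtain ⟨η, hη, rfl⟩ := id hχ
    refine ⟨[(tensor η, [j]), (tensor (Function.update η j fun s => -(s * deriv (η j) s)), [])],
      ?_, fun h x => ?_⟩
    · simp only [List.mem_cons, List.not_mem_nil, or_false, forall_eq_or_imp, forall_eq]
      exact ⟨⟨η, hη, rfl⟩, _, update_mem hη j (h1 _ (hη j)), rfl⟩
    · beta_reduce
      rw [eulerCLM_apply, eulerTranspose_apply, pderiv_smulLeft_apply,
        fderiv_tensor fun j => h𝒢 _ (hη j)]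
      simp only [List.map_cons, List.map_nil, List.sum_cons, List.sum_nil, eulerWord_cons,
        eulerWord_nil, eulerTranspose_apply, smulLeft_apply, tensor_update,
        RCLike.real_smul_eq_coe_mul]
      push_cast
      ring

/-- Away from `x_j = 0` a partial derivative is `1/x_j` times an Euler derivative. Passing to Euler
derivatives makes later estimates independent of dilations. -/
theorem hasEulerExpansion_pderivWord_smulLeft {𝒢 : Set (ℝ → ℝ)}
    (h𝒢 : ∀ η ∈ 𝒢, ContDiff ℝ (⊤ : ℕ∞) η) (h0 : ∀ η ∈ 𝒢, η 0 = 0)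
    (h1 : ∀ η ∈ 𝒢, (fun s => deriv η s - s⁻¹ * η s) ∈ 𝒢)
    (h2 : ∀ η ∈ 𝒢, (fun s => -(s⁻¹ * η s)) ∈ 𝒢) (w : List (Fin d))
    {χ : (Fin d → ℝ) → ℝ} (hχ : χ ∈ tensorClass d 𝒢) :
    HasEulerExpansion (tensorClass d 𝒢) fun h : 𝓓(Ω, 𝕜) =>
      pderivWord w (smulLeft χ (tensorClass_contDiff h𝒢 χ hχ) h) := by
  refine hasEulerExpansion_foldr (Ω := Ω) (𝕜 := 𝕜) (tensorClass_contDiff h𝒢) pderiv ?_ w hχ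
  intro j χ hχ
  obtain ⟨η, hη, rfl⟩ := id hχ
  refine ⟨[(tensor (Function.update η j fun s => -(s⁻¹ * η j s)), [j]),
    (tensor (Function.update η j fun s => deriv (η j) s - s⁻¹ * η j s), [])], ?_, fun h x => ?_⟩
  · simp only [List.mem_cons, List.not_mem_nil, or_false, forall_eq_or_imp, forall_eq]
    exact ⟨⟨_, update_mem hη j (h2 _ (hη j)), rfl⟩, _, update_mem hη j (h1 _ (hη j)), rfl⟩
  · beta_reduce
    rw [pderiv_smulLeft_apply, fderiv_tensor fun j => h𝒢 _ (hη j)]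
    simp only [List.map_cons, List.map_nil, List.sum_cons, List.sum_nil, eulerWord_cons,
      eulerWord_nil, eulerTranspose_apply, tensor_update, tensor_eq_mul_erase η j,
      RCLike.real_smul_eq_coe_mul]
    -- On the hyperplane the coefficient vanishes by `h0`, and the convention `0⁻¹ = 0` agrees with
    -- this.
    by_cases hx : x j = 0
    · simp [hx, h0 _ (hη j)]
    · have : ((x j : ℝ) : 𝕜) ≠ 0 := by exact_mod_cast hx
      push_cast
      field_simp
      ring

end Leibniz

end HadamardOp
end

noncomputable section

namespace HadamardOp

open Filter Topology Set

/-! ### The transform `φ ↦ (y ↦ T_x φ(xy))` of a distribution in `O_H` -/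

section Transform

variable {𝕜 : Type*} [RCLike 𝕜] {d : ℕ} {Ω : Opens (Fin d → ℝ)}

theorem one_add_norm_le_mul_sqrt (x : Fin d → ℝ) :
    1 + ‖x‖ ≤ 2 * Real.sqrt (1 + ∑ j, x j ^ 2) := by
  have h0 : 0 ≤ ∑ j, x j ^ 2 := Finset.sum_nonneg fun j _ => sq_nonneg _
  have h1 : 1 ≤ Real.sqrt (1 + ∑ j, x j ^ 2) := by
    rw [Real.one_le_sqrt]
    linarith
  have h2 : ‖x‖ ≤ Real.sqrt (1 + ∑ j, x j ^ 2) := by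
    refine (pi_norm_le_iff_of_nonneg (Real.sqrt_nonneg _)).2 fun j => Real.le_sqrt_of_sq_le ?_
    have := Finset.single_le_sum (fun i _ => sq_nonneg (x i)) (Finset.mem_univ j)
    rw [Real.norm_eq_abs, sq_abs]
    linarith
  linarith

/-- Decay of order `k + d + 1` absorbs a factor `‖x‖^k` and still leaves the integrable majorant `(1
+ ‖x‖)^(-(d + 1))`. -/
theorem IsOH.exists_integrable {T : Dist 𝕜 (⊤ : Opens (Fin d → ℝ))} (hT : IsOH T) (k : ℕ) :
    ∃ (B : Finset (Fin d → ℕ)) (t : (Fin d → ℕ) → (Fin d → ℝ) → 𝕜),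
      (∀ β ∈ B, AEStronglyMeasurable (t β) volume ∧
        ∀ i ≤ k, Integrable fun x => ‖t β x‖ * ‖x‖ ^ i) ∧
      ∀ φ : 𝓓((⊤ : Opens (Fin d → ℝ)), 𝕜),
        T φ = ∑ β ∈ B, ∫ x, t β x * eulerTransposePow β φ x := by
  obtain ⟨B, t, ht, hTt⟩ := hT (k + d + 1)
  refine ⟨B, t, fun β hβ => ?_, hTt⟩
  obtain ⟨hm, hn⟩ := ht β hβ
  set ρ : (Fin d → ℝ) → ℝ := fun x => Real.sqrt (1 + ∑ j, x j ^ 2)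
  have hρ0 : ∀ x, 0 < ρ x := fun x => by
    have : 0 ≤ ∑ j, x j ^ 2 := Finset.sum_nonneg fun j _ => sq_nonneg _
    exact Real.sqrt_pos.2 (by linarith)
  have hρc : Continuous ρ := by fun_prop
  have hw : ∀ x : Fin d → ℝ, (1 + ∑ j, x j ^ 2 : ℝ) ^ (((k + d + 1 : ℕ) : ℝ) / 2) =
      ρ x ^ (k + d + 1) := by
    intro x
    have : 0 ≤ ∑ j, x j ^ 2 := Finset.sum_nonneg fun j _ => sq_nonneg _
    change _ = Real.sqrt (1 + ∑ j, x j ^ 2) ^ (k + d + 1)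
    rw [← Real.rpow_natCast, Real.sqrt_eq_rpow, ← Real.rpow_mul (by linarith)]
    congr 1
    ring
  simp only [hw] at hm hn
  have hmeas : AEStronglyMeasurable (t β) volume := by
    have h1 : AEStronglyMeasurable (fun x => (ρ x ^ (k + d + 1))⁻¹ • (ρ x ^ (k + d + 1) • t β x))
        volume :=
      ((hρc.pow _).inv₀ fun x => (pow_pos (hρ0 x) _).ne').aestronglyMeasurable.smul hm
    refine h1.congr (Eventually.of_forall fun x => ?_)
    beta_reduce
    rw [smul_smul, inv_mul_cancel₀ (pow_pos (hρ0 x) _).ne', one_smul]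
  refine ⟨hmeas, fun i hi => ?_⟩
  obtain ⟨C, hC⟩ : ∃ C : ℝ, ∀ᵐ x, ‖ρ x ^ (k + d + 1) • t β x‖ ≤ C := by
    rw [eLpNorm_exponent_top] at hn
    refine ⟨(eLpNormEssSup (fun x => ρ x ^ (k + d + 1) • t β x) volume).toReal,
      (ae_le_eLpNormEssSup (μ := volume)
      (f := fun x => ρ x ^ (k + d + 1) • t β x)).mono fun x hx => ?_⟩
    exact (ENNReal.toReal_le_toReal enorm_ne_top hn.ne).2 hx
  have hint : Integrable fun x : Fin d → ℝ =>
      C * 2 ^ (k + d + 1) * (1 + ‖x‖) ^ (-((d + 1 : ℕ) : ℝ)) :=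
    (integrable_one_add_norm (by simp)).const_mul _
  refine hint.mono' (hmeas.norm.mul (continuous_norm.pow i).aestronglyMeasurable) ?_
  filter_upwards [hC] with x hx
  have h1 : (0 : ℝ) < 1 + ‖x‖ := by positivity
  rw [Real.rpow_neg h1.le, Real.rpow_natCast, norm_mul, norm_norm, norm_pow, norm_norm,
    ← div_eq_mul_inv, le_div_iff₀ (by positivity)]
  rw [norm_smul, Real.norm_of_nonneg (pow_pos (hρ0 x) _).le] at hx
  have h2 : ‖x‖ ^ i ≤ (1 + ‖x‖) ^ k :=
    (pow_le_pow_left₀ (norm_nonneg _) (by linarith) _).trans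
      (pow_le_pow_right₀ (by linarith [norm_nonneg x]) hi)
  calc ‖t β x‖ * ‖x‖ ^ i * (1 + ‖x‖) ^ (d + 1)
      ≤ ‖t β x‖ * (1 + ‖x‖) ^ k * (1 + ‖x‖) ^ (d + 1) := by gcongr
    _ = ‖t β x‖ * (1 + ‖x‖) ^ (k + d + 1) := by ring
    _ ≤ ‖t β x‖ * (2 * ρ x) ^ (k + d + 1) := by
        gcongr
        exact one_add_norm_le_mul_sqrt x
    _ = ρ x ^ (k + d + 1) * ‖t β x‖ * 2 ^ (k + d + 1) := by ring
    _ ≤ _ := by gcongr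

theorem eulerTransposePow_dilate (β : Fin d → ℕ) (φ : 𝓓(Ω, 𝕜)) (y : Fin d → ℝ)
    (hy : ∀ j, y j ≠ 0) (x : Fin d → ℝ) :
    eulerTransposePow β (dilate y hy φ) x = eulerTransposePow β φ (x * y) := by
  rw [eulerTransposePow_eq_eulerWord, eulerTransposePow_eq_eulerWord]
  exact eulerWord_scale (fun x => rfl) _ x

/-- Because Euler derivatives commute with dilations, the transform is an integral of `t_β(x)`
against a fixed test function at `xy`, which also makes sense when `y` has zero coordinates. The
representation, and so `F`, depends on `k`. The last clause provides continuity. -/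
theorem IsOH.exists_contDiff {T : Dist 𝕜 (⊤ : Opens (Fin d → ℝ))} (hT : IsOH T) (k : ℕ) :
    ∃ (B : Finset (Fin d → ℕ)) (C : (Fin d → ℕ) → ℝ), (∀ β, 0 ≤ C β) ∧ ∀ φ : 𝓓(Ω, 𝕜),
      ∃ F : (Fin d → ℝ) → 𝕜, ContDiff ℝ k F ∧
        (∀ y (hy : ∀ j, y j ≠ 0), F y = T (dilate y hy φ)) ∧
        ∀ a : (Fin d → ℕ) → ℝ, (∀ β ∈ B, ∀ x, ‖iteratedFDeriv ℝ k (eulerTransposePow β φ) x‖ ≤ a β) →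
          ∀ y, ‖iteratedFDeriv ℝ k F y‖ ≤ ∑ β ∈ B, C β * a β := by
  obtain ⟨B, t, ht, hTt⟩ := hT.exists_integrable k
  have hb : ∀ (β : Fin d → ℕ) (φ : 𝓓(Ω, 𝕜)), ∃ b : ℕ → ℝ, ∀ i x,
      ‖iteratedFDeriv ℝ i (eulerTransposePow β φ) x‖ ≤ b i := fun β φ => by
    choose b hb using fun i => bddAbove_iteratedFDeriv (eulerTransposePow β φ) i
    exact ⟨b, fun i x => (hb i).2 x⟩
  refine ⟨B, fun β => ∫ x, ‖t β x‖ * ‖x‖ ^ k, fun β => integral_nonneg fun x => by positivity,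
    fun φ => ⟨fun y => ∑ β ∈ B, ∫ x, t β x • eulerTransposePow β φ (x * y), ?_, ?_, ?_⟩⟩
  · refine ContDiff.sum fun β hβ => ?_
    obtain ⟨b, hb⟩ := hb β φ
    exact contDiff_integral_mul (smooth _) hb (ht β hβ).1 (ht β hβ).2
  · intro y hy
    rw [hTt]
    simp only [eulerTransposePow_dilate, smul_eq_mul]
  · intro a ha y
    have hcd : ∀ β ∈ B, ContDiff ℝ k fun y => ∫ x, t β x • eulerTransposePow β φ (x * y) := by
      intro β hβ
      obtain ⟨b, hb⟩ := hb β φ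
      exact contDiff_integral_mul (smooth _) hb (ht β hβ).1 (ht β hβ).2
    rw [iteratedFDeriv_fun_sum_apply fun β hβ => (hcd β hβ).contDiffAt]
    refine (norm_sum_le _ _).trans (Finset.sum_le_sum fun β hβ => ?_)
    obtain ⟨b, hb⟩ := hb β φ
    -- Only the order `k` needs the prescribed bound; at other orders any bound will do.
    have h1 : ∀ i x, ‖iteratedFDeriv ℝ i (eulerTransposePow β φ) x‖ ≤
        Function.update b k (a β) i := by
      intro i x
      by_cases hi : i = k
      · subst hi; simpa using ha β hβ x
      · simpa [hi] using hb i x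
    simpa using norm_iteratedFDeriv_integral_mul_le (smooth _) h1 (ht β hβ).1 (ht β hβ).2 y

/-- The transform of `φ` is supported in `(1 / supp T) supp φ`. -/
theorem support_subset_of_transform {T : Dist 𝕜 (⊤ : Opens (Fin d → ℝ))}
    (hT : ∀ x ∈ Distribution.dsupport T, ∀ j, x j ≠ 0) {φ : 𝓓(Ω, 𝕜)} {F : (Fin d → ℝ) → 𝕜}
    (hF : Continuous F) (hFT : ∀ y (hy : ∀ j, y j ≠ 0), F y = T (dilate y hy φ)) :
    Function.support F ⊆
      closure {z | ∃ ξ ∈ Distribution.dsupport T, ∃ x ∈ tsupport φ, z = ξ⁻¹ * x} := by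
  -- The transform is known only where no coordinate of `y` vanishes, but such points are dense in
  -- the open set where `F` is nonzero.
  have ho : IsOpen (Function.support F) := hF.isOpen_support
  refine (dense_forall_ne_zero.open_subset_closure_inter ho).trans (closure_mono ?_)
  rintro y ⟨hy0, hy⟩
  by_contra h
  refine hy0 ?_
  rw [hFT y hy]
  refine apply_eq_zero_of_disjoint_dsupport T _ fun x hx hx' => h ⟨x, hx', x * y, ?_, ?_⟩
  · exact tsupport_comp_subset_preimage φ
      (continuous_id.mul continuous_const : Continuous fun x : Fin d → ℝ => x * y) hx
  · ext j
    simp [hT x hx' j]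

theorem IsMulTransform.unique {T : Dist 𝕜 (⊤ : Opens (Fin d → ℝ))} {φ ψ ψ' : 𝓓(Ω, 𝕜)}
    (h : IsMulTransform T φ ψ) (h' : IsMulTransform T φ ψ') : ψ = ψ' := by
  have := eq_of_eqOn_forall_ne_zero ψ.continuous ψ'.continuous fun y hy => by
    rw [h y hy, h' y hy]
  exact DFunLike.coe_injective this

/-- The `C^k` extensions for different `k` agree on a dense set, hence everywhere, so a single
extension is smooth. -/
theorem exists_isMulTransform {T : Dist 𝕜 (⊤ : Opens (Fin d → ℝ))} (hT : IsDH T)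
    (hs : SupportCondition Ω T) (φ : 𝓓(Ω, 𝕜)) : ∃ ψ : 𝓓(Ω, 𝕜), IsMulTransform T φ ψ := by
  have h := fun k => hT.isOH.exists_contDiff (Ω := Ω) k
  choose B C hC F hF hFT _ using h
  have hcont : ∀ k, Continuous (F k φ) := fun k => (hF k φ).continuous
  have heq : ∀ k, F k φ = F 0 φ := fun k =>
    eq_of_eqOn_forall_ne_zero (hcont k) (hcont 0) fun y hy => by
      rw [hFT k φ y hy, hFT 0 φ y hy]
  obtain ⟨ε, hε, hsupp⟩ := hT.support
  have hT0 : ∀ x ∈ Distribution.dsupport T, ∀ j, x j ≠ 0 := fun x hx j h0 => by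
    have := hsupp x hx j
    rw [h0, abs_zero] at this
    linarith
  obtain ⟨hc, hsub⟩ := hs (tsupport φ) φ.hasCompactSupport φ.tsupport_subset
  have hs' := closure_minimal (support_subset_of_transform hT0 (hcont 0) (hFT 0 φ)) isClosed_closure
  refine ⟨⟨F 0 φ, ?_, hc.of_isClosed_subset (isClosed_tsupport _) hs', hs'.trans hsub⟩, hFT 0 φ⟩
  exact contDiff_infty.2 fun k => heq k ▸ hF k φ

/-- Continuity of `A` on the limit space `𝓓(Ω)` is unpacked into a concrete seminorm estimate on one
`𝓓_K`. -/
theorem exists_bound_iteratedFDeriv (A : 𝓓(Ω, 𝕜) →L[𝕜] 𝓓(Ω, 𝕜)) {K : Compacts (Fin d → ℝ)}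
    (hK : (K : Set (Fin d → ℝ)) ⊆ Ω) (i : ℕ) :
    ∃ (s : Finset ℕ) (C : ℝ), 0 ≤ C ∧ ∀ (f : 𝓓_{K}(Fin d → ℝ, 𝕜)) (x : Fin d → ℝ),
      ‖iteratedFDeriv ℝ i (A (TestFunction.ofSupportedIn hK f)) x‖ ≤
        C * (s.sup fun j => ContDiffMapSupportedIn.seminorm ℝ (Fin d → ℝ) 𝕜 ⊤ K j) f := by
  let Φ := ((derivBCF Ω 𝕜 i).comp (A.restrictScalars ℝ)).comp
    (TestFunction.ofSupportedInCLM ℝ hK : 𝓓_{K}(Fin d → ℝ, 𝕜) →L[ℝ] 𝓓(Ω, 𝕜))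
  let q : Seminorm ℝ 𝓓_{K}(Fin d → ℝ, 𝕜) :=
    (normSeminorm ℝ (BoundedContinuousFunction (Fin d → ℝ) ((Fin d → ℝ) [×i]→L[ℝ] 𝕜))).comp
      (Φ : _ →ₗ[ℝ] _)
  have hn : Continuous fun v : BoundedContinuousFunction (Fin d → ℝ)
      ((Fin d → ℝ) [×i]→L[ℝ] 𝕜) => ‖v‖ :=
    @continuous_norm _ (SeminormedAddCommGroup.toSeminormedAddGroup
      (E := BoundedContinuousFunction (Fin d → ℝ) ((Fin d → ℝ) [×i]→L[ℝ] 𝕜)))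
  have hq : Continuous q := hn.comp Φ.continuous
  obtain ⟨s, C, -, h⟩ := Seminorm.bound_of_continuous
    (ContDiffMapSupportedIn.withSeminorms ℝ (Fin d → ℝ) 𝕜 ⊤ K) q hq
  refine ⟨s, C, C.2, fun f x => ?_⟩
  rw [← derivBCF_apply]
  exact (BoundedContinuousFunction.norm_coe_le_norm (Φ f) x).trans (h f)

/-- The transform `φ ↦ (y ↦ T_x φ(xy))` as a continuous linear map on `𝓓(Ω)`. -/
theorem exists_transformCLM {T : Dist 𝕜 (⊤ : Opens (Fin d → ℝ))} (hT : IsDH T)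
    (hs : SupportCondition Ω T) :
    ∃ M : 𝓓(Ω, 𝕜) →L[𝕜] 𝓓(Ω, 𝕜), ∀ φ, IsMulTransform T φ (M φ) := by
  choose M hM using exists_isMulTransform hT hs
  have hadd : ∀ φ φ', M (φ + φ') = M φ + M φ' := fun φ φ' =>
    (hM _).unique fun y hy => by
      rw [add_apply, hM φ y hy, hM φ' y hy, ← map_add]
      rfl
  have hsmul : ∀ (c : 𝕜) (φ), M (c • φ) = c • M φ := fun c φ =>
    (hM _).unique fun y hy => by
      rw [smul_apply, hM φ y hy, ← map_smul]
      rfl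
  have hsmulR : ∀ (c : ℝ) (φ), M (c • φ) = c • M φ := fun c φ => by
    have h : ∀ χ : 𝓓(Ω, 𝕜), c • χ = (c : 𝕜) • χ := fun χ => by
      ext x
      exact RCLike.real_smul_eq_coe_mul c (χ x)
    rw [h, h, hsmul]
  obtain ⟨ε, hε, hsupp⟩ := hT.support
  have hT0 : ∀ x ∈ Distribution.dsupport T, ∀ j, x j ≠ 0 := fun x hx j h0 => by
    have := hsupp x hx j
    rw [h0, abs_zero] at this
    linarith
  refine ⟨TestFunction.mkCLM 𝕜 M hadd hsmul fun K hK => ?_, hM⟩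
  -- The support condition supplies one compact set for all transforms of functions supported in
  -- `K`, so continuity can be checked between two spaces of fixed support.
  obtain ⟨hc, hsub⟩ := hs K K.isCompact hK
  set K' : Compacts (Fin d → ℝ) := ⟨_, hc⟩
  let A : 𝓓_{K}(Fin d → ℝ, 𝕜) →L[ℝ] 𝓓_{K'}(Fin d → ℝ, 𝕜) :=
    ContDiffMapSupportedIn.mkCLM ℝ (fun f => M (TestFunction.ofSupportedIn hK f))
      (fun f g x => by
        have := hadd (TestFunction.ofSupportedIn hK f) (TestFunction.ofSupportedIn hK g)
        exact DFunLike.congr_fun this x)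
      (fun c f x => by
        have := hsmulR c (TestFunction.ofSupportedIn hK f)
        exact DFunLike.congr_fun this x)
      (fun f => smooth _)
      (fun f x hx => by
        by_contra h
        refine hx (closure_mono ?_ (support_subset_of_transform hT0 (M _).continuous (hM _) h))
        rintro z ⟨ξ, hξ, y, hy, rfl⟩
        exact ⟨ξ, hξ, y, f.tsupport_subset hy, rfl⟩)
      (fun i _ => by
        obtain ⟨B, C, hC, hF⟩ := hT.isOH.exists_contDiff (Ω := Ω) i
        choose s c hc hb using fun β : Fin d → ℕ => 
          exists_bound_iteratedFDeriv (𝕜 := 𝕜) (eulerWordCLM (expandWord β)) hK i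
        refine ⟨B.biUnion s, ∑ β ∈ B, C β * c β,
          Finset.sum_nonneg fun β _ => mul_nonneg (hC β) (hc β), fun f x _ => ?_⟩
        obtain ⟨F, hF1, hF2, hF3⟩ := hF (TestFunction.ofSupportedIn hK f)
        have hFM : F = M (TestFunction.ofSupportedIn hK f) :=
          eq_of_eqOn_forall_ne_zero hF1.continuous (M _).continuous fun y hy => by
            rw [hF2 y hy, hM _ y hy]
        rw [← hFM, Finset.sum_mul]
        refine (hF3 (fun β => c β * (((B.biUnion s).sup fun j =>
          ContDiffMapSupportedIn.seminorm ℝ (Fin d → ℝ) 𝕜 ⊤ K j) f)) ?_ x).trans_eq ?_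
        · intro β hβ x
          have h1 := hb β f x
          rw [eulerWordCLM_apply, ← eulerTransposePow_eq_eulerWord] at h1
          refine h1.trans (mul_le_mul_of_nonneg_left ?_ (hc β))
          exact Seminorm.le_def.1 (Finset.sup_mono (Finset.subset_biUnion_of_mem s hβ)) f
        · exact Finset.sum_congr rfl fun β _ => by ring)
  exact (TestFunction.continuous_ofSupportedIn hsub).comp A.continuous

end Transform

end HadamardOp
end

noncomputable section

namespace HadamardOp

open Filter Topology Set

/-! ### The transform maps monomials to multiples of themselves -/

section Eigenvector

variable {𝕜 : Type*} [RCLike 𝕜] {d : ℕ} {Ω : Opens (Fin d → ℝ)}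

/-- Bounded smooth functions of one variable which vanish for `|s| < c` and are constant near
`±∞`. -/
def awayClass (c : ℝ) : Set (ℝ → ℝ) :=
  {η | ContDiff ℝ (⊤ : ℕ∞) η ∧ (∀ s, |s| < c → η s = 0) ∧ (∃ b, ∀ s, |η s| ≤ b) ∧
    HasCompactSupport (deriv η)}

theorem deriv_eq_zero_of_forall_abs_lt {η : ℝ → ℝ} {c : ℝ} (h : ∀ s, |s| < c → η s = 0) {s : ℝ}
    (hs : |s| < c) : deriv η s = 0 := by
  have : η =ᶠ[𝓝 s] fun _ => 0 := by
    filter_upwards [(isOpen_lt continuous_abs continuous_const).mem_nhds hs] with t ht using h t ht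
  rw [this.deriv_eq, deriv_const]

theorem contDiff_deriv {η : ℝ → ℝ} (h : ContDiff ℝ (⊤ : ℕ∞) η) :
    ContDiff ℝ (⊤ : ℕ∞) (deriv η) := by
  have : ContDiff ℝ ((⊤ : ℕ∞) + 1) η := by simpa using h
  exact (contDiff_succ_iff_deriv.1 this).2.2

/-- The compact support of `η'` keeps `s η'` bounded despite the factor `s`, so the class is stable
under the Leibniz rule for Euler derivatives. -/
theorem awayClass_neg_mul_deriv {c : ℝ} {η : ℝ → ℝ} (h : η ∈ awayClass c) :
    (fun s => -(s * deriv η s)) ∈ awayClass c := by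
  obtain ⟨h1, h2, -, h4⟩ := h
  have hc : ContDiff ℝ (⊤ : ℕ∞) fun s => -(s * deriv η s) :=
    (contDiff_id.mul (contDiff_deriv h1)).neg
  have hs : HasCompactSupport fun s => -(s * deriv η s) := by
    have : HasCompactSupport fun s => s * deriv η s := h4.mul_left
    exact this.neg
  refine ⟨hc, fun s hs => ?_, ?_, hs.deriv⟩
  · beta_reduce
    rw [deriv_eq_zero_of_forall_abs_lt h2 hs, mul_zero, neg_zero]
  · obtain ⟨b, hb⟩ := hc.continuous.bounded_above_of_compact_support hs
    exact ⟨b, hb⟩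

theorem exists_mem_awayClass {c : ℝ} (hc : 0 < c) :
    ∃ η ∈ awayClass c, ∀ s, 2 * c < |s| → η s = 1 := by
  let η : ℝ → ℝ := fun s => Real.smoothTransition ((s ^ 2 - c ^ 2) / (3 * c ^ 2))
  have h1 : ∀ s, |s| < c → η s = 0 := fun s hs => by
    refine Real.smoothTransition.zero_of_nonpos (div_nonpos_of_nonpos_of_nonneg ?_ (by positivity))
    have := sq_lt_sq' (by linarith [abs_nonneg s]) hs
    rw [sq_abs] at this
    linarith
  have h2 : ∀ s, 2 * c < |s| → η s = 1 := fun s hs => by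
    refine Real.smoothTransition.one_of_one_le ((one_le_div (by positivity)).2 ?_)
    have := sq_lt_sq' (by linarith) hs
    rw [sq_abs] at this
    linarith
  have h3 : ContDiff ℝ (⊤ : ℕ∞) η := by
    refine Real.smoothTransition.contDiff.comp ?_
    exact ((contDiff_id.pow 2).sub contDiff_const).div_const _
  refine ⟨η, ⟨h3, h1, ⟨1, fun s => ?_⟩, ?_⟩, h2⟩
  · rw [abs_of_nonneg (Real.smoothTransition.nonneg _)]
    exact Real.smoothTransition.le_one _
  · refine HasCompactSupport.of_support_subset_isCompact (isCompact_Icc (a := -(2 * c)) (b := 2 * c))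
      fun s hs => ?_
    rw [mem_Icc, ← abs_le]
    by_contra! h
    refine hs ?_
    have : η =ᶠ[𝓝 s] fun _ => 1 := by
      filter_upwards [(isOpen_lt continuous_const continuous_abs).mem_nhds h] with t ht using h2 t ht
    rw [this.deriv_eq, deriv_const]

theorem awayClass_contDiff {c : ℝ} : ∀ η ∈ awayClass c, ContDiff ℝ (⊤ : ℕ∞) η := fun _ h => h.1

theorem tensor_eq_zero_of_abs_lt {η : Fin d → ℝ → ℝ} {c : ℝ} (h : ∀ j s, |s| < c → η j s = 0)
    {x : Fin d → ℝ} {j : Fin d} (hx : |x j| < c) : tensor η x = 0 :=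
  Finset.prod_eq_zero (Finset.mem_univ j) (h j _ hx)

theorem exists_bound_tensor {η : Fin d → ℝ → ℝ} (h : ∀ j, ∃ b, ∀ s, |η j s| ≤ b) :
    ∃ b, ∀ x, |tensor η x| ≤ b := by
  choose b hb using h
  refine ⟨∏ j, b j, fun x => ?_⟩
  rw [tensor, Finset.abs_prod]
  exact Finset.prod_le_prod (fun j _ => abs_nonneg _) fun j _ => hb j _

theorem ae_forall_ne_zero : ∀ᵐ y : Fin d → ℝ, ∀ j, y j ≠ 0 := by
  rw [ae_all_iff]
  intro j
  have := Measure.pi_hyperplane (fun _ : Fin d => (volume : Measure ℝ)) j 0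
  rw [ae_iff, volume_pi]
  simpa using this

theorem monomialFun_mul (α : Fin d → ℕ) (x y : Fin d → ℝ) :
    monomialFun 𝕜 α (x * y) = monomialFun 𝕜 α x * monomialFun 𝕜 α y := by
  simp [monomialFun, mul_pow, Finset.prod_mul_distrib]

theorem monomialFun_ne_zero (α : Fin d → ℕ) {x : Fin d → ℝ} (hx : ∀ j, x j ≠ 0) :
    monomialFun 𝕜 α x ≠ 0 := by
  rw [monomialFun]
  exact_mod_cast Finset.prod_ne_zero_iff.2 fun j _ => pow_ne_zero _ (hx j)

theorem integrable_mul_monomialFun (g : 𝓓(Ω, 𝕜)) (α : Fin d → ℕ) :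
    Integrable fun z => g z * monomialFun 𝕜 α z :=
  (g.contDiff.continuous.mul (continuous_monomialFun α)).integrable_of_hasCompactSupport
    g.hasCompactSupport.mul_right

theorem integral_eulerWord_monomial (w : List (Fin d)) (φ : 𝓓(Ω, 𝕜)) (α : Fin d → ℕ) :
    ∫ x, eulerWord w φ x * monomialFun 𝕜 α x =
      (w.map fun j => (α j : 𝕜)).prod * ∫ x, φ x * monomialFun 𝕜 α x := by
  induction w with
  | nil => simp
  | cons j w ih =>
    rw [eulerWord_cons, integral_eulerTranspose_monomial, ih, List.map_cons, List.prod_cons,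
      mul_assoc]

/-- The transform of a function with support away from the coordinate hyperplanes maps monomials
to multiples of themselves. -/
theorem integral_transform_monomial {c : ℝ} (hc : 0 < c) {t : (Fin d → ℝ) → 𝕜} (ht : Integrable t)
    {χ : (Fin d → ℝ) → ℝ} (hχ : χ ∈ tensorClass d (awayClass c)) (α : Fin d → ℕ) :
    ∃ m : 𝕜, ∀ g : 𝓓(Ω, 𝕜),
      Integrable (fun y => (∫ x, t x * χ x • g (x * y)) * monomialFun 𝕜 α y) ∧
      ∫ y, (∫ x, t x * χ x • g (x * y)) * monomialFun 𝕜 α y =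
        m * ∫ y, g y * monomialFun 𝕜 α y := by
  obtain ⟨η, hη, rfl⟩ := hχ
  have hcont : Continuous (tensor η) := (contDiff_tensor fun j => (hη j).1).continuous
  obtain ⟨b, hb⟩ := exists_bound_tensor fun j => (hη j).2.2.1
  have hb0 : 0 ≤ b := (abs_nonneg _).trans (hb 0)
  have hz : ∀ x, tensor η x ≠ 0 → ∀ j, c ≤ |x j| := fun x hx j => by
    by_contra! h
    exact hx (tensor_eq_zero_of_abs_lt (fun j => (hη j).2.1) h)
  have hz0 : ∀ x, tensor η x ≠ 0 → ∀ j, x j ≠ 0 := fun x hx j h => by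
    have := hz x hx j
    rw [h, abs_zero] at this
    linarith
  -- The eigenvalue is `∫ N`: the substitution `z = xy` produces `x^(-α)` from the monomial and
  -- `1/|∏ x_j|` from the Jacobian.
  set N : (Fin d → ℝ) → 𝕜 := fun x =>
    t x * tensor η x * (monomialFun 𝕜 α x)⁻¹ * ((|∏ j, x j|⁻¹ : ℝ) : 𝕜)
  refine ⟨∫ x, N x, fun g => ?_⟩
  set H : (Fin d → ℝ) → 𝕜 := fun z => g z * monomialFun 𝕜 α z
  have hH : Integrable H := integrable_mul_monomialFun g α
  set f : (Fin d → ℝ) × (Fin d → ℝ) → 𝕜 := fun p =>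
    t p.1 * tensor η p.1 • g (p.1 * p.2) * monomialFun 𝕜 α p.2
  have hf : ∀ x y, f (x, y) = t x * tensor η x * (monomialFun 𝕜 α x)⁻¹ * H (x * y) := by
    intro x y
    by_cases hx : tensor η x = 0
    · simp [f, hx]
    · have := monomialFun_ne_zero (𝕜 := 𝕜) α (hz0 x hx)
      simp only [f, H, monomialFun_mul, RCLike.real_smul_eq_coe_mul]
      field_simp
  have hmeas : AEStronglyMeasurable f (volume.prod volume) := by
    have h1 : Continuous fun p : (Fin d → ℝ) × (Fin d → ℝ) =>
        tensor η p.1 • g (p.1 * p.2) :=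
      (hcont.comp continuous_fst).smul (g.contDiff.continuous.comp (by fun_prop))
    have h2 : Continuous fun p : (Fin d → ℝ) × (Fin d → ℝ) => monomialFun 𝕜 α p.2 :=
      (continuous_monomialFun α).comp continuous_snd
    exact (ht.aestronglyMeasurable.comp_fst.mul h1.aestronglyMeasurable).mul
      h2.aestronglyMeasurable
  have hinner : ∀ x, Integrable fun y => f (x, y) := by
    intro x
    simp only [hf]
    by_cases hx : tensor η x = 0
    · simp [hx]
    · exact (integrable_comp_mul hH x (hz0 x hx)).const_mul _
  have hnorm : ∀ x, ∫ y, ‖f (x, y)‖ = ‖N x‖ * ∫ z, ‖H z‖ := by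
    intro x
    by_cases hx : tensor η x = 0
    · simp [hf, hx, N]
    · simp only [hf, norm_mul _ (H _)]
      rw [integral_const_mul, integral_comp_mul (fun z => ‖H z‖) x (hz0 x hx), smul_eq_mul,
        ← mul_assoc]
      congr 1
      simp only [N]
      rw [norm_mul _ ((|∏ j, x j|⁻¹ : ℝ) : 𝕜), RCLike.norm_ofReal, abs_inv, abs_abs]
  -- Here the cutoff matters: on its support `|x_j| ≥ c`, so the negative powers are bounded and `N`
  -- inherits integrability from `t`.
  have hNb : ∀ x, ‖N x‖ ≤ ‖t x‖ * (b * (∏ j, c ^ α j)⁻¹ * (∏ _j : Fin d, c)⁻¹) := by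
    intro x
    by_cases hx : tensor η x = 0
    · simp only [N, hx]
      simp only [RCLike.ofReal_zero, mul_zero, zero_mul, norm_zero]
      have : 0 ≤ ∏ j, c ^ α j := Finset.prod_nonneg fun j _ => by positivity
      positivity
    · have h1 := hz x hx
      simp only [N, norm_mul, norm_inv, monomialFun, RCLike.norm_ofReal, abs_abs, abs_inv]
      rw [mul_assoc, mul_assoc, ← mul_assoc |tensor η x|]
      have h2 : ∏ j, c ^ α j ≤ |∏ j, x j ^ α j| := by
        rw [Finset.abs_prod]
        refine Finset.prod_le_prod (fun j _ => by positivity) fun j _ => ?_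
        rw [abs_pow]
        exact pow_le_pow_left₀ hc.le (h1 j) _
      have h3 : ∏ _j : Fin d, c ≤ |∏ j, x j| := by
        rw [Finset.abs_prod]
        exact Finset.prod_le_prod (fun j _ => hc.le) fun j _ => h1 j
      have h4 : 0 < ∏ j, c ^ α j := Finset.prod_pos fun j _ => by positivity
      have h5 : 0 < ∏ _j : Fin d, c := Finset.prod_pos fun j _ => hc
      gcongr
      exact hb x
  have hNint : Integrable fun x => ‖N x‖ * ∫ z, ‖H z‖ := by
    have h1 : AEStronglyMeasurable (fun x => ∫ y, ‖f (x, y)‖) volume :=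
      hmeas.norm.integral_prod_right'
    simp only [hnorm] at h1
    refine ((ht.norm.mul_const (b * (∏ j, c ^ α j)⁻¹ * (∏ _j : Fin d, c)⁻¹)).mul_const
      (∫ z, ‖H z‖)).mono' h1 (Eventually.of_forall fun x => ?_)
    have h0 : 0 ≤ ∫ z, ‖H z‖ := integral_nonneg fun _ => norm_nonneg _
    rw [norm_mul, norm_norm, Real.norm_of_nonneg h0]
    exact mul_le_mul_of_nonneg_right (hNb x) h0
  have hfint : Integrable f (volume.prod volume) := by
    refine (integrable_prod_iff hmeas).2 ⟨Eventually.of_forall hinner, ?_⟩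
    simpa only [hnorm] using hNint
  have h1 : ∀ y, (∫ x, t x * tensor η x • g (x * y)) * monomialFun 𝕜 α y = ∫ x, f (x, y) :=
    fun y => (integral_mul_const _ _).symm
  simp only [h1]
  refine ⟨hfint.integral_prod_right, ?_⟩
  rw [← integral_integral_swap (f := fun x y => f (x, y)) hfint, ← integral_mul_const]
  congr 1
  ext x
  by_cases hx : tensor η x = 0
  · simp [hf, hx, N]
  · simp only [hf]
    rw [integral_const_mul, integral_comp_mul H x (hz0 x hx), RCLike.real_smul_eq_coe_mul,
      ← mul_assoc]

theorem HasEulerExpansion.exists_sum {𝒞 : Set ((Fin d → ℝ) → ℝ)} {A : 𝓓(Ω, 𝕜) → 𝓓(Ω, 𝕜)}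
    (hA : HasEulerExpansion 𝒞 A) :
    ∃ (n : ℕ) (χ : Fin n → (Fin d → ℝ) → ℝ) (w : Fin n → List (Fin d)), (∀ i, χ i ∈ 𝒞) ∧
      ∀ h x, A h x = ∑ i, χ i x • eulerWord (w i) h x := by
  obtain ⟨l, hl, hl'⟩ := hA
  refine ⟨l.length, fun i => l[i].1, fun i => l[i].2, fun i => hl _ (List.getElem_mem _),
    fun h x => ?_⟩
  rw [hl', ← Fin.sum_univ_fun_getElem]
  rfl

/-- The functions `t_β` need not vanish near the hyperplanes, although `T` does. A cutoff equal to 1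
near `supp T` is inserted into the test function, and the Leibniz rule moves it next to `t_β`.
Integration by parts then gives each word `w β i` its scalar. -/
theorem exists_integral_transform_monomial {T : Dist 𝕜 (⊤ : Opens (Fin d → ℝ))} (hT : IsDH T)
    (α : Fin d → ℕ) :
    ∃ m : 𝕜, ∀ φ ψ : 𝓓(Ω, 𝕜), IsMulTransform T φ ψ →
      ∫ y, ψ y * monomialFun 𝕜 α y = m * ∫ y, φ y * monomialFun 𝕜 α y := by
  obtain ⟨ε, hε, hsupp⟩ := hT.support
  obtain ⟨η, hη, hη1⟩ := exists_mem_awayClass (c := ε / 4) (by positivity)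
  have hχ : tensor (fun _ : Fin d => η) ∈ tensorClass d (awayClass (ε / 4)) := ⟨_, fun _ => hη, rfl⟩
  set χ := tensor (fun _ : Fin d => η)
  have hχs : ContDiff ℝ (⊤ : ℕ∞) χ := tensorClass_contDiff awayClass_contDiff χ hχ
  obtain ⟨B, t, ht, hTt⟩ := hT.isOH.exists_integrable 0
  have hexp := fun β : Fin d → ℕ => (hasEulerExpansion_eulerWord_smulLeft (𝕜 := 𝕜)
    (Ω := (⊤ : Opens (Fin d → ℝ))) (awayClass_contDiff (c := ε / 4))
    (fun η hη => awayClass_neg_mul_deriv hη) (expandWord β) hχ).exists_sum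
  choose n χ' w hχ' hw using hexp
  have hint : ∀ β ∈ B, Integrable (t β) := fun β hβ => by
    have := (ht β hβ).2 0 le_rfl
    simp only [pow_zero, mul_one] at this
    exact (integrable_norm_iff (ht β hβ).1).1 this
  have hterm : ∀ (β : Fin d → ℕ) (i : Fin (n β)), ∃ m : 𝕜, β ∈ B → ∀ g : 𝓓(Ω, 𝕜),
      Integrable (fun y => (∫ x, t β x * χ' β i x • g (x * y)) * monomialFun 𝕜 α y) ∧
      ∫ y, (∫ x, t β x * χ' β i x • g (x * y)) * monomialFun 𝕜 α y =
        m * ∫ y, g y * monomialFun 𝕜 α y := by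
    intro β i
    by_cases hβ : β ∈ B
    · obtain ⟨m, hm⟩ := integral_transform_monomial (Ω := Ω) (by positivity) (hint β hβ)
        (hχ' β i) α
      exact ⟨m, fun _ => hm⟩
    · exact ⟨0, fun h => absurd h hβ⟩
  choose m hm using hterm
  have hform : ∀ (φ ψ : 𝓓(Ω, 𝕜)), IsMulTransform T φ ψ → ∀ y, (∀ j, y j ≠ 0) →
      ψ y = ∑ β ∈ B, ∑ i, ∫ x, t β x * χ' β i x • eulerWord (w β i) φ (x * y) := by
    intro φ ψ hψ y hy
    rw [hψ y hy]
    -- The cutoff equals 1 as soon as all `|z_j| > ε/2`, an open neighbourhood of `supp T`.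
    have h1 : T (dilate y hy φ - smulLeft χ hχs (dilate y hy φ)) = 0 := by
      refine apply_eq_zero_of_disjoint_dsupport T _ fun x hx hx' => ?_
      have h2 : ∀ j, 2 * (ε / 4) < |x j| := fun j => by linarith [hsupp x hx' j]
      have ho : IsOpen {x : Fin d → ℝ | ∀ j, 2 * (ε / 4) < |x j|} := by
        simp only [ofPred_forall]
        exact isOpen_iInter_of_finite fun j =>
          isOpen_lt continuous_const (continuous_abs.comp (continuous_apply j))
      obtain ⟨z, hz, hz'⟩ := mem_closure_iff.1 hx _ ho h2
      refine hz' ?_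
      have : χ z = 1 := Finset.prod_eq_one fun j _ => hη1 _ (hz j)
      rw [sub_apply, smulLeft_apply, this, one_smul, sub_self]
    rw [map_sub, sub_eq_zero] at h1
    rw [h1, hTt]
    refine Finset.sum_congr rfl fun β hβ => ?_
    rw [eulerTransposePow_eq_eulerWord]
    simp only [hw, Finset.mul_sum]
    have h2 : ∀ i x, eulerWord (w β i) (dilate y hy φ) x = eulerWord (w β i) φ (x * y) :=
      fun i x => eulerWord_scale (fun x => rfl) _ x
    simp only [h2]
    refine integral_finsetSum _ fun i _ => ?_
    obtain ⟨η', hη', hη''⟩ := hχ' β i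
    obtain ⟨b, hb⟩ := exists_bound_tensor fun j => (hη' j).2.2.1
    obtain ⟨C, hC, hC'⟩ := bddAbove_iteratedFDeriv (eulerWord (w β i) φ) 0
    have hb' : ∀ x, ‖χ' β i x • eulerWord (w β i) φ (x * y)‖ ≤ b * C := fun x => by
      rw [norm_smul, hη'', Real.norm_eq_abs]
      have h3 := hC' (x * y)
      rw [norm_iteratedFDeriv_zero] at h3
      exact mul_le_mul (hb x) h3 (norm_nonneg _) ((abs_nonneg _).trans (hb x))
    refine (hint β hβ).mul_bdd (c := b * C) ?_ (Eventually.of_forall hb')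
    exact ((tensorClass_contDiff awayClass_contDiff _ (hχ' β i)).continuous.smul
      ((eulerWord (w β i) φ).contDiff.continuous.comp
        (continuous_id.mul continuous_const))).aestronglyMeasurable
  refine ⟨∑ β ∈ B, ∑ i, m β i * ((w β i).map fun j => (α j : 𝕜)).prod, fun φ ψ hψ => ?_⟩
  have h1 : ∫ y, ψ y * monomialFun 𝕜 α y = ∫ y, ∑ β ∈ B, ∑ i,
      (∫ x, t β x * χ' β i x • eulerWord (w β i) φ (x * y)) * monomialFun 𝕜 α y := by
    refine integral_congr_ae (ae_forall_ne_zero.mono fun y hy => ?_)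
    beta_reduce
    rw [hform φ ψ hψ y hy, Finset.sum_mul]
    simp only [Finset.sum_mul]
  rw [h1, integral_finsetSum _ fun β hβ => integrable_finsetSum _ fun i _ => (hm β i hβ _).1,
    Finset.sum_mul]
  refine Finset.sum_congr rfl fun β hβ => ?_
  rw [integral_finsetSum _ fun i _ => (hm β i hβ _).1, Finset.sum_mul]
  refine Finset.sum_congr rfl fun i _ => ?_
  rw [(hm β i hβ _).2, integral_eulerWord_monomial, mul_assoc]

theorem exists_isMulConv {T : Dist 𝕜 (⊤ : Opens (Fin d → ℝ))} (hT : IsDH T)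
    (hs : SupportCondition Ω T) (S : Dist 𝕜 Ω) : ∃ U : Dist 𝕜 Ω, IsMulConv S T U := by
  obtain ⟨M, hM⟩ := exists_transformCLM hT hs
  exact ⟨(ContinuousLinearMap.comp S M : 𝓓(Ω, 𝕜) →L[𝕜] 𝕜), fun φ => ⟨M φ, hM φ, rfl⟩⟩

/-- Uniqueness of the transform forces `L` to be precomposition with the continuous map `M`;
continuity of `L` is then automatic. -/
theorem isHadamardOperator_of_isMulConv {T : Dist 𝕜 (⊤ : Opens (Fin d → ℝ))} (hT : IsDH T)
    (hs : SupportCondition Ω T) {L : Dist 𝕜 Ω → Dist 𝕜 Ω} (hL : ∀ S, IsMulConv S T (L S)) :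
    IsHadamardOperator L := by
  obtain ⟨M, hM⟩ := exists_transformCLM hT hs
  have hLM : ∀ S φ, L S φ = S (M φ) := fun S φ => by
    obtain ⟨ψ, hψ, h⟩ := hL S φ
    rw [h, hψ.unique (hM φ)]
  have hL' : L = ContinuousLinearMap.precompCompactConvergenceCLM 𝕜 M := by
    funext S
    ext φ
    exact hLM S φ
  refine ⟨⟨fun S S' => ?_, fun c S => ?_⟩, ?_, fun α => ?_⟩
  · rw [hL', map_add]
  · rw [hL', map_smul]
  · rw [hL']
    exact ContinuousLinearMap.continuous _
  · obtain ⟨m, hm⟩ := exists_integral_transform_monomial (Ω := Ω) hT α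
    refine ⟨m, ?_⟩
    ext φ
    rw [hLM, monomialDist_apply, hm φ _ (hM φ)]
    change _ = m • (monomialDist α : Dist 𝕜 Ω) φ
    rw [monomialDist_apply, smul_eq_mul]

end Eigenvector

end HadamardOp
end

noncomputable section

namespace HadamardOp

open Filter Topology Set

/-! ### The transpose of a Hadamard operator -/

section Transpose

variable {𝕜 : Type*} [RCLike 𝕜] {d : ℕ} {Ω : Opens (Fin d → ℝ)}

/-- The evaluation at a point as a distribution. -/
def deltaDist (y : Fin d → ℝ) : Dist 𝕜 Ω :=
  ((⟨⟨⟨fun φ => φ y, fun _ _ => rfl⟩, fun _ _ => rfl⟩,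
    continuous_eval_const y⟩ : 𝓓(Ω, 𝕜) →L[𝕜] 𝕜))

/-- `M` is the transpose of the Hadamard operator `L`. -/
structure IsTranspose (L : Dist 𝕜 Ω → Dist 𝕜 Ω) (M : 𝓓(Ω, 𝕜) → 𝓓(Ω, 𝕜)) : Prop where
  hadamard : IsHadamardOperator L
  apply : ∀ S φ, L S φ = S (M φ)

variable {L : Dist 𝕜 Ω → Dist 𝕜 Ω} {M : 𝓓(Ω, 𝕜) → 𝓓(Ω, 𝕜)}

/-- The functional is `L` applied to the distribution `δ_y ∘ A`. This is the only form in which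
continuity of `M` is needed, and it avoids proving that `M` is continuous. -/
theorem IsTranspose.exists_clm (h : IsTranspose L M) (A : 𝓓(Ω, 𝕜) →L[𝕜] 𝓓(Ω, 𝕜))
    (y : Fin d → ℝ) : ∃ Λ : 𝓓(Ω, 𝕜) →L[𝕜] 𝕜, ∀ φ, Λ φ = A (M φ) y :=
  ⟨(L ((ContinuousLinearMap.comp (deltaDist y : Dist 𝕜 Ω) A : 𝓓(Ω, 𝕜) →L[𝕜] 𝕜) : Dist 𝕜 Ω) :),
    fun φ => h.apply _ φ⟩

theorem IsTranspose.map_add (h : IsTranspose L M) (φ ψ : 𝓓(Ω, 𝕜)) : M (φ + ψ) = M φ + M ψ := by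
  ext y
  obtain ⟨Λ, hΛ⟩ := h.exists_clm (ContinuousLinearMap.id 𝕜 _) y
  simp only [ContinuousLinearMap.id_apply] at hΛ
  rw [add_apply, ← hΛ, ← hΛ, ← hΛ, _root_.map_add]

theorem IsTranspose.map_smul (h : IsTranspose L M) (c : 𝕜) (φ : 𝓓(Ω, 𝕜)) :
    M (c • φ) = c • M φ := by
  ext y
  obtain ⟨Λ, hΛ⟩ := h.exists_clm (ContinuousLinearMap.id 𝕜 _) y
  simp only [ContinuousLinearMap.id_apply] at hΛ
  rw [smul_apply, ← hΛ, ← hΛ, _root_.map_smul]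

theorem IsTranspose.exists_moment (h : IsTranspose L M) (α : Fin d → ℕ) :
    ∃ m : 𝕜, ∀ φ, ∫ x, M φ x * monomialFun 𝕜 α x = m * ∫ x, φ x * monomialFun 𝕜 α x := by
  obtain ⟨m, hm⟩ := h.hadamard.eigenvector α
  refine ⟨m, fun φ => ?_⟩
  rw [← monomialDist_apply, ← monomialDist_apply, ← h.apply, hm]
  rfl

theorem integral_comp_mul_monomialFun (g : (Fin d → ℝ) → 𝕜) (α : Fin d → ℕ) (y : Fin d → ℝ)
    (hy : ∀ j, y j ≠ 0) :
    ∫ x, g (x * y) * monomialFun 𝕜 α x =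
      ((|∏ j, y j|⁻¹ : ℝ) : 𝕜) * (monomialFun 𝕜 α y)⁻¹ * ∫ x, g x * monomialFun 𝕜 α x := by
  have h := integral_comp_mul (fun x => g x * monomialFun 𝕜 α x) y hy
  have h1 := monomialFun_ne_zero (𝕜 := 𝕜) α hy
  have h2 : ∀ x, g (x * y) * monomialFun 𝕜 α x =
      (monomialFun 𝕜 α y)⁻¹ * (g (y * x) * monomialFun 𝕜 α (y * x)) := fun x => by
    rw [monomialFun_mul, mul_comm y x]
    field_simp
  simp only [h2]
  rw [integral_const_mul, h, RCLike.real_smul_eq_coe_mul]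
  ring

/-- A dilation multiplies each moment by a scalar, and so does `M`. The two scalings commute, so
both sides have the same moments. -/
theorem IsTranspose.apply_scale (h : IsTranspose L M) {φ ψ : 𝓓(Ω, 𝕜)} {y : Fin d → ℝ}
    (hy : ∀ j, y j ≠ 0) (hψ : ∀ x, ψ x = φ (x * y)) (x : Fin d → ℝ) : M ψ x = M φ (x * y) := by
  have key : ⇑(M ψ) = ⇑(dilate y hy (M φ)) := by
    refine eq_of_moments (𝕜 := 𝕜) (M ψ).continuous (M ψ).hasCompactSupport
      (dilate y hy (M φ)).continuous (dilate y hy (M φ)).hasCompactSupport fun α => ?_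
    obtain ⟨m, hm⟩ := h.exists_moment α
    simp only [dilate_apply]
    rw [hm, integral_comp_mul_monomialFun _ _ _ hy, hm]
    simp only [hψ]
    rw [integral_comp_mul_monomialFun _ _ _ hy]
    ring
  exact congrFun key x

/-- Both sides have moments `m α_j ∫ φ x^α`, and moments determine the function. -/
theorem IsTranspose.eulerTranspose (h : IsTranspose L M) (j : Fin d) (φ : 𝓓(Ω, 𝕜)) :
    M (eulerTranspose j φ) = HadamardOp.eulerTranspose j (M φ) := by
  refine DFunLike.coe_injective (eq_of_moments (𝕜 := 𝕜) (M _).continuous (M _).hasCompactSupport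
    (TestFunction.continuous _) (TestFunction.hasCompactSupport _) fun α => ?_)
  obtain ⟨m, hm⟩ := h.exists_moment α
  rw [hm, integral_eulerTranspose_monomial, integral_eulerTranspose_monomial, hm]
  ring

theorem exists_pos_scale (h0 : (0 : Fin d → ℝ) ∈ Ω) {K : Set (Fin d → ℝ)} (hK : IsCompact K) :
    ∃ δ : ℝ, 0 < δ ∧ (fun x => x * fun _ => δ) '' K ⊆ Ω := by
  obtain ⟨r, hr, hrΩ⟩ := Metric.isOpen_iff.1 Ω.isOpen 0 h0
  obtain ⟨R, hR⟩ := hK.isBounded.exists_norm_le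
  refine ⟨r / (|R| + 1), by positivity, ?_⟩
  rintro _ ⟨x, hx, rfl⟩
  refine hrΩ ?_
  rw [mem_ball_zero_iff]
  refine (pi_norm_lt_iff hr).2 fun j => ?_
  have h1 : ‖x j‖ ≤ |R| := (norm_le_pi_norm x j).trans ((hR x hx).trans (le_abs_self R))
  beta_reduce
  rw [Pi.mul_apply, norm_mul, Real.norm_of_nonneg (by positivity : 0 ≤ r / (|R| + 1)),
    mul_div_assoc', div_lt_iff₀ (by positivity)]
  nlinarith

/-- Put `T φ = M ψ (y)` whenever `φ(x) = ψ(xy)`. Every `φ` has this form, since a small uniform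
dilation moves its support into a neighbourhood of `0 ∈ Ω`; commutation of `M` with dilations makes
the value independent of the choice. -/
theorem IsTranspose.exists_dist (h : IsTranspose L M) (h0 : (0 : Fin d → ℝ) ∈ Ω) :
    ∃ T : Dist 𝕜 (⊤ : Opens (Fin d → ℝ)), ∀ φ, IsMulTransform T φ (M φ) := by
  classical
  have hex : ∀ φ : 𝓓((⊤ : Opens (Fin d → ℝ)), 𝕜), ∃ (a : 𝕜), ∀ (ψ : 𝓓(Ω, 𝕜)) (y : Fin d → ℝ),
      (∀ j, y j ≠ 0) → (∀ x, φ x = ψ (x * y)) → a = M ψ y := by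
    intro φ
    by_cases hφ : ∃ (ψ : 𝓓(Ω, 𝕜)) (y : Fin d → ℝ), (∀ j, y j ≠ 0) ∧ ∀ x, φ x = ψ (x * y)
    · obtain ⟨ψ, y, hy, hψ⟩ := hφ
      refine ⟨M ψ y, fun ψ' y' hy' hψ' => ?_⟩
      have h1 : ∀ x, ψ x = ψ' (x * (y' / y)) := fun x => by
        have h2 : x / y * y = x := by
          ext j
          simp [hy j]
        have := hψ (x / y)
        rw [h2, hψ'] at this
        rw [← this]
        congr 1
        ext j
        simp only [Pi.mul_apply, Pi.div_apply]
        ring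
      rw [h.apply_scale (fun j => div_ne_zero (hy' j) (hy j)) h1]
      congr 1
      ext j
      simp only [Pi.mul_apply]
      field_simp [hy j]
    -- This case never occurs; the value 0 only makes the definition total.
    · push Not at hφ
      refine ⟨0, fun ψ y hy hψ => ?_⟩
      obtain ⟨x, hx⟩ := hφ ψ y hy
      exact absurd (hψ x) hx
  choose T hT using hex
  have hpos : ∀ K : Compacts (Fin d → ℝ), ∃ δ : ℝ, 0 < δ ∧
      (fun x => x * fun _ => δ) '' (K : Set (Fin d → ℝ)) ⊆ Ω := fun K =>
    exists_pos_scale h0 K.isCompact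
  choose δ hδ hδK using hpos
  set v : Compacts (Fin d → ℝ) → Fin d → ℝ := fun K _ => δ K
  have hv : ∀ K j, v K j ≠ 0 := fun K j => (hδ K).ne'
  choose Λ hΛ using fun y => h.exists_clm (ContinuousLinearMap.id 𝕜 _) y
  let K' : Compacts (Fin d → ℝ) → Compacts (Fin d → ℝ) := fun K =>
    ⟨_, K.isCompact.image (f := fun x => x * v K) (continuous_id.mul continuous_const)⟩
  have hK' : ∀ K x, x * (v K)⁻¹ ∈ K → x ∈ K' K := fun K x hx =>
    ⟨_, hx, by ext j; simp [hv K j]⟩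
  refine ⟨(TestFunction.limitCLM 𝕜 T (fun K _ => (Λ (v K)).comp
    ((TestFunction.ofSupportedInCLM 𝕜 (hδK K)).comp (scaleSupp (v K)⁻¹ K (K' K) (hK' K))))
    fun K _ f => ?_ : 𝓓(_, 𝕜) →L[𝕜] 𝕜), fun φ y hy => ?_⟩
  · rw [hT _ (TestFunction.ofSupportedIn (hδK K) (scaleSupp (v K)⁻¹ K (K' K) (hK' K) f)) (v K)
      (hv K) fun x => ?_]
    · exact (hΛ _ _).symm
    · change f x = f (x * v K * (v K)⁻¹)
      congr 1
      ext j
      simp [hv K j]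
  · exact (hT _ φ y hy fun x => rfl).symm

/-- The transpose of a Hadamard operator respects families with a common compact support. -/
theorem IsTranspose.exists_support (h : IsTranspose L M) {K : Set (Fin d → ℝ)} (hK : IsCompact K)
    (hKΩ : K ⊆ Ω) :
    ∃ K' : Set (Fin d → ℝ), IsCompact K' ∧ K' ⊆ Ω ∧
      ∀ φ : 𝓓(Ω, 𝕜), tsupport φ ⊆ K → Function.support (M φ) ⊆ K' := by
  obtain ⟨C, hC, hmono, hex⟩ := exists_compact_exhaustion Ω
  let K₀ : Compacts (Fin d → ℝ) := ⟨K, hK⟩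
  choose Λ hΛ using fun y => h.exists_clm (ContinuousLinearMap.id 𝕜 _) y
  let ι : 𝓓_{K₀}(Fin d → ℝ, 𝕜) →L[𝕜] 𝓓(Ω, 𝕜) := TestFunction.ofSupportedInCLM 𝕜 hKΩ
  -- `F n` collects the functions whose image under `M` vanishes off `C n`. By Baire one of these
  -- closed subspaces has interior points, and a subspace with interior points is everything.
  let F : ℕ → Submodule 𝕜 𝓓_{K₀}(Fin d → ℝ, 𝕜) := fun n =>
    ⨅ y ∈ {y : Fin d → ℝ | y ∉ C n}, LinearMap.ker ((Λ y).comp ι : 𝓓_{K₀}(Fin d → ℝ, 𝕜) →ₗ[𝕜] 𝕜)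
  have hmem : ∀ n f, f ∈ F n ↔ ∀ y, y ∉ C n → M (ι f) y = 0 := by
    intro n f
    simp only [F, Submodule.mem_iInf, LinearMap.mem_ker, mem_ofPred_eq]
    refine forall₂_congr fun y _ => ?_
    rw [← ContinuousLinearMap.id_apply (R₁ := 𝕜) (M (ι f)), ← hΛ]
    rfl
  have hclosed : ∀ n, IsClosed (F n : Set 𝓓_{K₀}(Fin d → ℝ, 𝕜)) := by
    intro n
    have : (F n : Set 𝓓_{K₀}(Fin d → ℝ, 𝕜)) = ⋂ y ∈ {y : Fin d → ℝ | y ∉ C n},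
        ((Λ y).comp ι) ⁻¹' {0} := by
      ext f
      simp [F]
    rw [this]
    exact isClosed_biInter fun y _ => isClosed_singleton.preimage ((Λ y).comp ι).continuous
  have hunion : ⋃ n, (F n : Set 𝓓_{K₀}(Fin d → ℝ, 𝕜)) = univ := by
    refine eq_univ_of_forall fun f => ?_
    obtain ⟨n, hn⟩ := hex _ (M (ι f)).hasCompactSupport (M (ι f)).tsupport_subset
    refine mem_iUnion.2 ⟨n, (hmem n f).2 fun y hy => ?_⟩
    exact image_eq_zero_of_notMem_tsupport fun h' => hy (hn h')
  obtain ⟨n, hn⟩ := nonempty_interior_of_iUnion_of_closed hclosed hunion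
  have htop := Submodule.eq_top_of_nonempty_interior' (F n) hn
  refine ⟨C n, (C n).isCompact, hC n, fun φ hφ y hy => ?_⟩
  by_contra hyn
  have h1 : restrictSupport K₀ φ (subset_closure.trans hφ) ∈ F n := htop ▸ Submodule.mem_top
  exact hy ((hmem n _).1 h1 y hyn)

theorem dilate_scaleTo_inv {Ω' : Opens (Fin d → ℝ)} (φ : 𝓓((⊤ : Opens (Fin d → ℝ)), 𝕜))
    (y : Fin d → ℝ) (hy : ∀ j, y j ≠ 0) (hy' : ∀ j, y⁻¹ j ≠ 0)
    (hs : ∀ x, x * y⁻¹ ∈ tsupport φ → x ∈ Ω') :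
    dilate y hy (scaleTo Ω' y⁻¹ hy' φ hs) = φ := by
  ext x
  rw [dilate_apply, scaleTo_apply]
  congr 1
  ext j
  simp [hy j]

theorem tsupport_scaleTo_subset {Ω' : Opens (Fin d → ℝ)} (φ : 𝓓(Ω, 𝕜))
    (y : Fin d → ℝ) (hy : ∀ j, y j ≠ 0) (hs : ∀ x, x * y ∈ tsupport φ → x ∈ Ω') {x : Fin d → ℝ}
    (hx : x ∈ tsupport (scaleTo Ω' y hy φ hs)) : x * y ∈ tsupport φ :=
  tsupport_comp_subset_preimage φ
    (continuous_id.mul continuous_const : Continuous fun x : Fin d → ℝ => x * y) hx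

/-- A criterion for a point to lie outside the support of `T`. -/
theorem notMem_dsupport_of_transform {T : Dist 𝕜 (⊤ : Opens (Fin d → ℝ))}
    (hT : ∀ φ, IsMulTransform T φ (M φ)) {K K' : Set (Fin d → ℝ)} (hKΩ : K ⊆ Ω)
    (hKK' : ∀ φ : 𝓓(Ω, 𝕜), tsupport φ ⊆ K → Function.support (M φ) ⊆ K')
    {y : Fin d → ℝ} (hy : ∀ j, y j ≠ 0) (hyK' : y ∉ K') {U : Set (Fin d → ℝ)} (hU : IsOpen U)
    (hUK : ∀ x ∈ U, x * y ∈ K) {ξ : Fin d → ℝ} (hξ : ξ ∈ U) : ξ ∉ Distribution.dsupport T := by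
  rw [Distribution.notMem_dsupport_iff]
  refine ⟨U, fun φ hφ => ?_, hU, hξ⟩
  have hy' : ∀ j, y⁻¹ j ≠ 0 := fun j => inv_ne_zero (hy j)
  have hyy : ∀ x : Fin d → ℝ, x * y⁻¹ * y = x := fun x => by
    ext j
    simp [hy j]
  have hs : ∀ x, x * y⁻¹ ∈ tsupport φ → x ∈ K := fun x hx => by
    have := hUK _ (hφ hx)
    rwa [hyy] at this
  -- If `φ` lives in `U`, then `φ = ψ(· y)` with `ψ` supported in `K`, so `T φ = M ψ (y)`, which
  -- vanishes because `y` lies outside `K'`.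
  rw [← dilate_scaleTo_inv φ y hy hy' fun x hx => hKΩ (hs x hx), ← hT _ y hy]
  by_contra h1
  exact hyK' (hKK' _ (fun x hx => hs x (tsupport_scaleTo_subset _ _ _ _ hx)) h1)

/-- A point `ξ` with one tiny coordinate tolerates a large dilation in that coordinate without
leaving a ball in `Ω`, while all transforms from that ball vanish at large `y`. -/
theorem IsTranspose.exists_support_bound (h : IsTranspose L M) (h0 : (0 : Fin d → ℝ) ∈ Ω)
    {T : Dist 𝕜 (⊤ : Opens (Fin d → ℝ))} (hT : ∀ φ, IsMulTransform T φ (M φ)) :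
    ∃ ε : ℝ, 0 < ε ∧ ∀ x ∈ Distribution.dsupport T, ∀ j, ε ≤ |x j| := by
  obtain ⟨r', hr', hrΩ'⟩ := Metric.isOpen_iff.1 Ω.isOpen 0 h0
  set r := r' / 2
  have hr : 0 < r := by positivity
  have hrΩ : Metric.closedBall 0 r ⊆ (Ω : Set (Fin d → ℝ)) :=
    (Metric.closedBall_subset_ball (by simp only [r]; linarith)).trans hrΩ'
  obtain ⟨K', hK', -, hKK'⟩ := h.exists_support (isCompact_closedBall 0 r) hrΩ
  obtain ⟨R, hR⟩ := hK'.isBounded.exists_norm_le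
  set ε := r / (|R| + 1)
  have hε : 0 < ε := by positivity
  refine ⟨ε, hε, fun ξ hξ j => ?_⟩
  by_contra! hlt
  -- The coordinate `r / ε = |R| + 1` puts `y` outside `K'`; the other coordinates shrink a
  -- neighbourhood of `ξ` into the ball of radius `r`.
  set y : Fin d → ℝ := fun i => if i = j then r / ε else r / (|ξ i| + 1)
  have hyp : ∀ i, 0 < y i := fun i => by
    simp only [y]
    split_ifs <;> positivity
  refine notMem_dsupport_of_transform hT hrΩ hKK' (y := y) (fun i => (hyp i).ne') (fun hy => ?_)
    (U := {x | ∀ i, |x i| < if i = j then ε else |ξ i| + 1}) ?_ ?_ (fun i => ?_) hξ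
  · have h1 : |y j| ≤ R := (norm_le_pi_norm y j).trans (hR y hy)
    have h2 : y j = |R| + 1 := by
      simp only [y, if_true, ε]
      field_simp
    rw [h2] at h1
    have := le_abs_self R
    have := le_abs_self (|R| + 1)
    linarith
  · simp only [ofPred_forall]
    exact isOpen_iInter_of_finite fun i =>
      isOpen_lt (continuous_abs.comp (continuous_apply i)) continuous_const
  · intro x hx
    rw [mem_closedBall_zero_iff, pi_norm_le_iff_of_nonneg hr.le]
    intro i
    have h1 := hx i
    rw [Pi.mul_apply, norm_mul, Real.norm_eq_abs, Real.norm_of_nonneg (hyp i).le]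
    simp only [y]
    split_ifs at h1 ⊢ with hi
    · rw [mul_div_assoc', div_le_iff₀ hε, mul_comm]
      gcongr
    · rw [mul_div_assoc', div_le_iff₀ (by positivity), mul_comm]
      gcongr
  · split_ifs with hi
    · subst hi; exact hlt
    · linarith

/-- For `z` in the interior of a slightly larger compact set, `y = ξ⁻¹ z` dilates a neighbourhood of
`ξ` into that set. If `y` lay outside the common support of the transforms, `ξ` would not belong to
`supp T`. -/
theorem IsTranspose.supportCondition (h : IsTranspose L M) (h0 : (0 : Fin d → ℝ) ∈ Ω)
    {T : Dist 𝕜 (⊤ : Opens (Fin d → ℝ))} (hT : ∀ φ, IsMulTransform T φ (M φ)) :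
    SupportCondition Ω T := by
  obtain ⟨ε, hε, hsupp⟩ := h.exists_support_bound h0 hT
  intro K hK hKΩ
  obtain ⟨K₁, hK₁, hKK₁, hK₁Ω⟩ := exists_compact_between hK Ω.isOpen hKΩ
  obtain ⟨K', hK', hK'Ω, hM⟩ := h.exists_support hK₁ hK₁Ω
  have hsub : closure {z | ∃ ξ ∈ Distribution.dsupport T, ∃ x ∈ K, z = ξ⁻¹ * x} ⊆ K' := by
    refine closure_minimal ?_ hK'.isClosed
    rintro _ ⟨ξ, hξ, x, hx, rfl⟩
    have hξ0 : ∀ j, ξ j ≠ 0 := fun j hj => by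
      have := hsupp ξ hξ j
      rw [hj, abs_zero] at this
      linarith
    have hc : Continuous fun x : Fin d → ℝ => ξ⁻¹ * x := continuous_const.mul continuous_id
    -- Dilations need nonzero coordinates, so points of `K` on the hyperplanes are reached by
    -- density.
    have hx' : x ∈ closure (interior K₁ ∩ {y | ∀ j, y j ≠ 0}) :=
      dense_forall_ne_zero.open_subset_closure_inter isOpen_interior (hKK₁ hx)
    refine closure_minimal (s := interior K₁ ∩ {y | ∀ j, y j ≠ 0}) ?_
      (hK'.isClosed.preimage hc) hx'
    rintro z ⟨hz, hz0⟩
    by_contra hzK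
    refine notMem_dsupport_of_transform hT hK₁Ω hM (y := ξ⁻¹ * z)
      (fun j => mul_ne_zero (inv_ne_zero (hξ0 j)) (hz0 j)) hzK
      (U := (fun x => x * (ξ⁻¹ * z)) ⁻¹' interior K₁)
      (isOpen_interior.preimage (continuous_id.mul continuous_const))
      (fun x hx => interior_subset hx) ?_ hξ
    have : ξ * (ξ⁻¹ * z) = z := by
      ext j
      simp [hξ0 j]
    rw [mem_preimage, this]
    exact hz
  exact ⟨hK'.of_isClosed_subset isClosed_closure hsub, hsub.trans hK'Ω⟩

end Transpose

end HadamardOp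
end

noncomputable section

namespace HadamardOp

open Filter Topology Set

/-! ### A Sobolev inequality and bounds for the transpose -/

section Sobolev

variable {𝕜 : Type*} [RCLike 𝕜] {d : ℕ} {Ω : Opens (Fin d → ℝ)}

theorem tsupport_pderivWord_subset (w : List (Fin d)) (φ : 𝓓(Ω, 𝕜)) :
    tsupport (pderivWord w φ) ⊆ tsupport φ := by
  induction w with
  | nil => exact le_rfl
  | cons j w ih => exact (tsupport_pderiv_subset j _).trans ih

theorem fderiv_eq_sum_pderiv (φ : 𝓓(Ω, 𝕜)) :
    fderiv ℝ φ = fun x => ∑ j, ContinuousLinearMap.smulRightL ℝ (Fin d → ℝ) 𝕜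
      (ContinuousLinearMap.proj j) (pderiv j φ x) := by
  ext x v
  have h := LinearMap.pi_apply_eq_sum_univ (fderiv ℝ φ x).toLinearMap v
  rw [ContinuousLinearMap.coe_coe] at h
  rw [h, sum_apply]
  refine Finset.sum_congr rfl fun j _ => ?_
  rw [pderiv_apply]
  change _ = v j • fderiv ℝ φ x (Pi.single j 1)
  congr 2
  ext i
  simp [Pi.single_apply, eq_comm]

/-- The iterated derivative is bounded by the partial derivatives of the same order. -/
theorem exists_norm_iteratedFDeriv_le (𝕜 : Type*) [RCLike 𝕜] (d i : ℕ) :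
    ∃ C : ℝ, 0 ≤ C ∧ ∀ {Ω : Opens (Fin d → ℝ)} (φ : 𝓓(Ω, 𝕜)) (B : ℝ),
      (∀ w : List (Fin d), w.length = i → ∀ x, ‖pderivWord w φ x‖ ≤ B) →
        ∀ x, ‖iteratedFDeriv ℝ i φ x‖ ≤ C * B := by
  induction i with
  | zero =>
    refine ⟨1, zero_le_one, fun φ B hB x => ?_⟩
    rw [norm_iteratedFDeriv_zero, one_mul]
    exact hB [] rfl x
  | succ i ih =>
    obtain ⟨C, hC, h⟩ := ih
    let t : Fin d → 𝕜 →L[ℝ] (Fin d → ℝ) →L[ℝ] 𝕜 := fun j =>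
      ContinuousLinearMap.smulRightL ℝ (Fin d → ℝ) 𝕜 (ContinuousLinearMap.proj j)
    refine ⟨∑ j, ‖t j‖ * C, Finset.sum_nonneg fun j _ => by positivity, fun φ B hB x => ?_⟩
    rw [← norm_iteratedFDeriv_fderiv, fderiv_eq_sum_pderiv]
    have hcd : ∀ j, ContDiff ℝ (⊤ : ℕ∞) fun x => t j (pderiv j φ x) := fun j =>
      (t j).contDiff.comp (smooth _)
    have hi : ((i : ℕ) : WithTop ℕ∞) ≤ ((⊤ : ℕ∞) : WithTop ℕ∞) := by exact_mod_cast le_top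
    change ‖iteratedFDeriv ℝ i (fun x => ∑ j, t j (pderiv j φ x)) x‖ ≤ _
    rw [iteratedFDeriv_fun_sum_apply fun j _ => ((hcd j).of_le hi).contDiffAt, Finset.sum_mul]
    refine (norm_sum_le _ _).trans (Finset.sum_le_sum fun j _ => ?_)
    refine ((t j).norm_iteratedFDeriv_comp_left (smooth (pderiv j φ)).contDiffAt hi).trans ?_
    rw [mul_assoc]
    refine mul_le_mul_of_nonneg_left (h (pderiv j φ) B (fun w hw x => ?_) x) (norm_nonneg _)
    have := hB (w ++ [j]) (by simp [hw]) x
    rwa [pderivWord_append] at this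

theorem hasDerivAt_comp_update (φ : 𝓓(Ω, 𝕜)) (x : Fin d → ℝ) (j : Fin d) (s : ℝ) :
    HasDerivAt (fun s => φ (Function.update x j s)) (pderiv j φ (Function.update x j s)) s := by
  have h := (differentiable φ (Function.update x j s)).hasFDerivAt.comp_hasDerivAt s
    (hasDerivAt_update x j s)
  rw [← pderiv_apply] at h
  exact h

theorem norm_le_of_pderiv_le {R : ℝ} {φ : 𝓓(Ω, 𝕜)}
    (hφ : tsupport φ ⊆ Metric.closedBall 0 R) (j : Fin d) {B : ℝ}
    (hB : ∀ x, ‖pderiv j φ x‖ ≤ B) (x : Fin d → ℝ) : ‖φ x‖ ≤ (2 * |R| + 1) * B := by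
  have hB0 : 0 ≤ B := (norm_nonneg _).trans (hB x)
  by_cases hx : x ∈ tsupport φ
  · have hx1 : |x j| ≤ |R| := by
      have h1 := hφ hx
      rw [mem_closedBall_zero_iff] at h1
      exact (norm_le_pi_norm x j).trans (h1.trans (le_abs_self R))
    have h0 : φ (Function.update x j (|R| + 1)) = 0 := by
      refine image_eq_zero_of_notMem_tsupport fun h => ?_
      have h1 := hφ h
      rw [mem_closedBall_zero_iff] at h1
      have h2 := (norm_le_pi_norm _ j).trans (h1.trans (le_abs_self R))
      rw [Function.update_self, Real.norm_eq_abs] at h2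
      have := le_abs_self (|R| + 1)
      linarith
    have h1 := (convex_univ (𝕜 := ℝ) (E := ℝ)).norm_image_sub_le_of_norm_hasDerivWithin_le
      (f := fun s => φ (Function.update x j s)) (C := B)
      (fun s _ => (hasDerivAt_comp_update φ x j s).hasDerivWithinAt) (fun s _ => hB _)
      (mem_univ (|R| + 1)) (mem_univ (x j))
    rw [h0, sub_zero, Function.update_eq_self] at h1
    refine h1.trans ?_
    rw [mul_comm, Real.norm_eq_abs]
    refine mul_le_mul_of_nonneg_right ?_ hB0
    rw [abs_le] at hx1 ⊢
    constructor <;> linarith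
  · rw [image_eq_zero_of_notMem_tsupport hx, norm_zero]
    positivity

theorem norm_le_of_pderivWord_le {R : ℝ} {φ : 𝓓(Ω, 𝕜)}
    (hφ : tsupport φ ⊆ Metric.closedBall 0 R) (w : List (Fin d)) {B : ℝ}
    (hB : ∀ x, ‖pderivWord w φ x‖ ≤ B) (x : Fin d → ℝ) :
    ‖φ x‖ ≤ (2 * |R| + 1) ^ w.length * B := by
  induction w generalizing B with
  | nil => simpa using hB x
  | cons j w ih =>
    rw [List.length_cons, pow_succ, mul_assoc]
    exact ih fun x => norm_le_of_pderiv_le ((tsupport_pderivWord_subset w φ).trans hφ) j hB x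

theorem enorm_le_lintegral_pderiv (φ : 𝓓(Ω, 𝕜)) (j : Fin d) (x : Fin d → ℝ) :
    ‖φ x‖ₑ ≤ ∫⁻ s, ‖pderiv j φ (Function.update x j s)‖ₑ := by
  have h := HasCompactSupport.enorm_le_lintegral_Ici_deriv
    (f := fun s => φ (Function.update x j s)) ?_ ?_ (x j)
  · rw [Function.update_eq_self] at h
    refine h.trans ((setLIntegral_le_lintegral _ _).trans_eq ?_)
    exact lintegral_congr fun s => by rw [(hasDerivAt_comp_update φ x j s).deriv]
  · exact ((smooth φ).of_le (by simp)).comp (contDiff_update 1 x j)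
  · exact φ.hasCompactSupport.comp_isClosedEmbedding (isClosedEmbedding_update x j)

/-- The one-variable estimate of a function by the integral of its derivative is iterated over
distinct coordinates. -/
theorem enorm_le_lmarginal (φ : 𝓓(Ω, 𝕜)) {w : List (Fin d)} (hw : w.Nodup) (x : Fin d → ℝ) :
    ‖φ x‖ₑ ≤ lmarginal (fun _ => volume) w.toFinset (fun x => ‖pderivWord w φ x‖ₑ) x := by
  induction w generalizing x with
  | nil => simp
  | cons j w ih =>
    obtain ⟨hj, hw⟩ := List.nodup_cons.1 hw
    refine (ih hw x).trans ?_
    have hm : Measurable fun x => ‖pderivWord (j :: w) φ x‖ₑ :=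
      (pderivWord (j :: w) φ).contDiff.continuous.measurable.enorm
    rw [List.toFinset_cons, lmarginal_insert' _ hm (by simpa using hj)]
    exact lmarginal_mono (fun z => enorm_le_lintegral_pderiv _ j z) x

theorem norm_le_integral_pderivWord (φ : 𝓓(Ω, 𝕜)) (x : Fin d → ℝ) :
    ‖φ x‖ ≤ ∫ x, ‖pderivWord (List.finRange d) φ x‖ := by
  have h := enorm_le_lmarginal φ (List.nodup_finRange d) x
  have hu : (List.finRange d).toFinset = Finset.univ := by
    ext
    simp
  rw [hu, lmarginal_univ, ← volume_pi] at h
  have hint : Integrable (pderivWord (List.finRange d) φ) :=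
    (TestFunction.continuous _).integrable_of_hasCompactSupport (TestFunction.hasCompactSupport _)
  rw [← ofReal_integral_norm_eq_lintegral_enorm hint, ← ofReal_norm] at h
  exact (ENNReal.ofReal_le_ofReal_iff (integral_nonneg fun _ => norm_nonneg _)).1 h

/-- All derivatives up to a given order are bounded by the `L_1`-norm of a single derivative of
higher order, uniformly for functions supported in a fixed ball. -/
theorem exists_norm_iteratedFDeriv_le_integral (𝕜 : Type*) [RCLike 𝕜] (Ω : Opens (Fin d → ℝ))
    (N : ℕ) (R : ℝ) :
    ∃ (w : List (Fin d)) (C : ℝ), 0 ≤ C ∧ ∀ φ : 𝓓(Ω, 𝕜), tsupport φ ⊆ Metric.closedBall 0 R →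
      ∀ i ≤ N, ∀ x, ‖iteratedFDeriv ℝ i φ x‖ ≤ C * ∫ x, ‖pderivWord w φ x‖ := by
  -- `V` contains each index `N` times, so every word of length at most `N` is part of it up to
  -- order. The missing derivatives are added at the cost of powers of the diameter, and one more
  -- derivative per coordinate passes from the sup norm to `L¹`.
  set V : List (Fin d) := (List.replicate N (List.finRange d)).flatten
  have hV : ∀ j, V.count j = N := fun j => by
    rw [List.count_flatten, List.map_replicate, List.sum_replicate,
      List.count_eq_one_of_mem (List.nodup_finRange d) (List.mem_finRange j)]
    simp
  choose C hC hCb using exists_norm_iteratedFDeriv_le 𝕜 d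
  refine ⟨List.finRange d ++ V, ∑ i ∈ Finset.range (N + 1), C i * (2 * |R| + 1) ^ V.length,
    Finset.sum_nonneg fun i _ => mul_nonneg (hC i) (by positivity), fun φ hφ i hi x => ?_⟩
  set I := ∫ x, ‖pderivWord (List.finRange d ++ V) φ x‖
  have hI : 0 ≤ I := integral_nonneg fun _ => norm_nonneg _
  have hR : 1 ≤ 2 * |R| + 1 := by
    have := abs_nonneg R
    linarith
  have key : ∀ w : List (Fin d), w.length = i → ∀ x,
      ‖pderivWord w φ x‖ ≤ (2 * |R| + 1) ^ V.length * I := by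
    intro w hw x
    have hsub : w.Subperm V := List.subperm_ext_iff.2 fun j _ => by
      rw [hV]
      exact (List.count_le_length).trans (hw.trans_le hi)
    obtain ⟨v, hv, hvV⟩ := hsub
    obtain ⟨l, hl⟩ := hvV.exists_perm_append
    have hperm : V.Perm (l ++ w) :=
      hl.trans ((hv.append_right l).trans List.perm_append_comm)
    have h1 : ∀ x, ‖pderivWord l (pderivWord w φ) x‖ ≤ I := fun x => by
      rw [← pderivWord_append, ← pderivWord_perm hperm]
      have := norm_le_integral_pderivWord (pderivWord V φ) x
      rwa [← pderivWord_append] at this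
    refine (norm_le_of_pderivWord_le ((tsupport_pderivWord_subset w φ).trans hφ) l h1 x).trans ?_
    refine mul_le_mul_of_nonneg_right (pow_le_pow_right₀ hR ?_) hI
    rw [hperm.length_eq, List.length_append]
    lia
  refine (hCb i φ _ key x).trans ?_
  rw [← mul_assoc]
  refine mul_le_mul_of_nonneg_right ?_ hI
  exact Finset.single_le_sum (f := fun i => C i * (2 * |R| + 1) ^ V.length)
    (fun i _ => mul_nonneg (hC i) (by positivity)) (Finset.mem_range.2 (by lia))

variable {L : Dist 𝕜 Ω → Dist 𝕜 Ω} {M : 𝓓(Ω, 𝕜) → 𝓓(Ω, 𝕜)}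

/-- Each evaluation `φ ↦ A (M φ) y` is continuous, and for fixed `φ` the values are bounded in `y`.
Banach-Steinhaus on the barrelled space `𝓓_K` makes the supremum a continuous seminorm, and the
Sobolev inequality replaces it by one `L¹` norm. -/
theorem IsTranspose.exists_bound (h : IsTranspose L M) {R : ℝ}
    (hR : Metric.closedBall 0 R ⊆ (Ω : Set (Fin d → ℝ))) (A : 𝓓(Ω, 𝕜) →L[𝕜] 𝓓(Ω, 𝕜)) :
    ∃ (w : List (Fin d)) (C : ℝ), 0 ≤ C ∧ ∀ φ : 𝓓(Ω, 𝕜), tsupport φ ⊆ Metric.closedBall 0 R →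
      ∀ y, ‖A (M φ) y‖ ≤ C * ∫ x, ‖pderivWord w φ x‖ := by
  let K : Compacts (Fin d → ℝ) := ⟨Metric.closedBall 0 R, isCompact_closedBall 0 R⟩
  choose Λ hΛ using fun y => h.exists_clm A y
  let ι : 𝓓_{K}(Fin d → ℝ, 𝕜) →L[𝕜] 𝓓(Ω, 𝕜) := TestFunction.ofSupportedInCLM 𝕜 (K := K) hR
  let p : (Fin d → ℝ) → Seminorm 𝕜 𝓓_{K}(Fin d → ℝ, 𝕜) := fun y =>
    (normSeminorm 𝕜 𝕜).comp ((Λ y).comp ι : 𝓓_{K}(Fin d → ℝ, 𝕜) →ₗ[𝕜] 𝕜)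
  have hp : ∀ y f, p y f = ‖A (M (ι f)) y‖ := fun y f => by
    rw [← hΛ]
    rfl
  have hbdd : BddAbove (range p) := by
    rw [Seminorm.bddAbove_range_iff]
    intro f
    obtain ⟨C, -, hC⟩ := bddAbove_iteratedFDeriv (A (M (ι f))) 0
    refine ⟨C, ?_⟩
    rintro _ ⟨y, rfl⟩
    have := hC y
    rw [norm_iteratedFDeriv_zero] at this
    beta_reduce
    rwa [hp]
  have hcont : Continuous ⇑(⨆ y, p y) := by
    rw [Seminorm.coe_iSup_eq hbdd]
    exact Seminorm.continuous_iSup p (fun y => continuous_norm.comp ((Λ y).comp ι).continuous) hbdd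
  obtain ⟨s, C, -, hC⟩ := Seminorm.bound_of_continuous
    (ContDiffMapSupportedIn.withSeminorms 𝕜 (Fin d → ℝ) 𝕜 ⊤ K) _ hcont
  obtain ⟨w, C', hC', hw⟩ := exists_norm_iteratedFDeriv_le_integral 𝕜 Ω (s.sup id) R
  refine ⟨w, C * C', mul_nonneg C.2 hC', fun φ hφ y => ?_⟩
  set f := restrictSupport K φ (subset_closure.trans hφ)
  have h1 : ‖A (M φ) y‖ ≤ (⨆ y, p y) f := by
    rw [Seminorm.iSup_apply hbdd]
    refine le_ciSup_of_le (Seminorm.bddAbove_range_iff.1 hbdd f) y ?_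
    rw [hp]
    exact le_rfl
  refine h1.trans ((hC f).trans ?_)
  rw [mul_assoc]
  refine mul_le_mul_of_nonneg_left ?_ C.2
  have hI : 0 ≤ C' * ∫ x, ‖pderivWord w φ x‖ :=
    mul_nonneg hC' (integral_nonneg fun _ => norm_nonneg _)
  refine Seminorm.finset_sup_apply_le hI fun i hi => ?_
  refine (ContDiffMapSupportedIn.seminorm_top_le_iff 𝕜 hI i f).2 fun x _ => ?_
  exact hw φ hφ i (Finset.le_sup (f := id) hi) x

end Sobolev

end HadamardOp
end

noncomputable section

namespace HadamardOp

open Filter Topology Set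

/-! ### Flatness along the coordinate hyperplanes -/

section Flatness

variable {𝕜 : Type*} [RCLike 𝕜] {d : ℕ} {Ω : Opens (Fin d → ℝ)}

theorem pderivWord_replicate_succ (l : ℕ) (j : Fin d) (g : 𝓓(Ω, 𝕜)) :
    pderivWord (List.replicate (l + 1) j) g = pderiv j (pderivWord (List.replicate l j) g) := by
  rw [List.replicate_succ, pderivWord_cons]

theorem pderivWord_replicate_pderiv (l : ℕ) (j : Fin d) (g : 𝓓(Ω, 𝕜)) :
    pderivWord (List.replicate l j) (pderiv j g) = pderivWord (List.replicate (l + 1) j) g := by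
  rw [List.replicate_succ', pderivWord_append]
  rfl

/-- Taylor's estimate along the `j`-th axis, by iterating the mean value inequality; the factorial
is not needed. -/
theorem norm_le_abs_pow_mul (j : Fin d) (k : ℕ) (g : 𝓓(Ω, 𝕜)) {B : ℝ}
    (hflat : ∀ l < k, ∀ y : Fin d → ℝ, y j = 0 → pderivWord (List.replicate l j) g y = 0)
    (hB : ∀ y, ‖pderivWord (List.replicate k j) g y‖ ≤ B) (y : Fin d → ℝ) :
    ‖g y‖ ≤ |y j| ^ k * B := by
  induction k generalizing g y with
  | zero => simpa using hB y
  | succ k ih =>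
    have hB0 : 0 ≤ B := (norm_nonneg _).trans (hB 0)
    have h1 : ∀ y, ‖pderiv j g y‖ ≤ |y j| ^ k * B := fun y => by
      refine ih (pderiv j g) (fun l hl y hy => ?_) (fun y => ?_) y
      · rw [pderivWord_replicate_pderiv]
        exact hflat _ (by lia) y hy
      · rw [pderivWord_replicate_pderiv]
        exact hB y
    have h2 := Convex.norm_image_sub_le_of_norm_hasDerivWithin_le (s := uIcc 0 (y j))
      (f := fun s => g (Function.update y j s)) (C := |y j| ^ k * B)
      (fun s _ => (hasDerivAt_comp_update g y j s).hasDerivWithinAt) (fun s hs => by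
        refine (h1 _).trans (mul_le_mul_of_nonneg_right ?_ hB0)
        rw [Function.update_self]
        refine pow_le_pow_left₀ (abs_nonneg _) ?_ k
        simpa using abs_sub_left_of_mem_uIcc hs)
      (convex_uIcc 0 (y j)) left_mem_uIcc right_mem_uIcc
    have h3 : g (Function.update y j 0) = 0 := hflat 0 (by lia) _ (by simp)
    rw [Function.update_eq_self, h3, sub_zero, sub_zero, Real.norm_eq_abs] at h2
    calc ‖g y‖ ≤ _ := h2
      _ = _ := by ring

theorem pderivWord_replicate_eulerTranspose (l : ℕ) (j : Fin d) (g : 𝓓(Ω, 𝕜)) :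
    pderivWord (List.replicate l j) (eulerTranspose j g) =
      eulerTranspose j (pderivWord (List.replicate l j) g) -
        (l : 𝕜) • pderivWord (List.replicate l j) g := by
  induction l with
  | zero => simp
  | succ l ih =>
    rw [pderivWord_replicate_succ, ih, pderivWord_replicate_succ, map_sub, map_smul]
    ext y
    simp only [sub_apply, smul_apply, pderiv_eulerTranspose, if_true]
    push_cast
    rw [add_smul, one_smul]
    ring

/-- On `y_j = 0` the transposed Euler derivative acts on the `l`-th normal derivative as the scalar
`-(l + 1)`. Hence adding `l + 1` to it annihilates that derivative. -/
theorem pderivWord_replicate_eulerTranspose_apply (l : ℕ) (j : Fin d) (g : 𝓓(Ω, 𝕜))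
    {y : Fin d → ℝ} (hy : y j = 0) :
    pderivWord (List.replicate l j) (eulerTranspose j g) y =
      -(((l : 𝕜) + 1) * pderivWord (List.replicate l j) g y) := by
  rw [pderivWord_replicate_eulerTranspose, sub_apply, smul_apply, eulerTranspose_apply, hy,
    zero_smul, smul_eq_mul]
  ring

/-- The reflection in the `j`-th coordinate. -/
def reflection (j : Fin d) : Fin d → ℝ := Function.update 1 j (-1)

theorem reflection_ne_zero (j i : Fin d) : reflection j i ≠ 0 := by
  rw [reflection, Function.update_apply]
  split_ifs <;> simp

theorem reflection_self (j : Fin d) : reflection j j = -1 := by simp [reflection]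

theorem mul_reflection (x : Fin d → ℝ) (j : Fin d) :
    x * reflection j = Function.update x j (-x j) := by
  ext i
  by_cases h : i = j
  · subst h; simp [reflection]
  · simp [reflection, h]

theorem abs_mul_reflection (x : Fin d → ℝ) (j i : Fin d) : |(x * reflection j) i| = |x i| := by
  rw [mul_reflection, Function.update_apply]
  split_ifs with h
  · rw [h, abs_neg]
  · rfl

theorem norm_mul_reflection (x : Fin d → ℝ) (j : Fin d) : ‖x * reflection j‖ = ‖x‖ := by
  simp only [Pi.norm_def, nnnorm]
  congr 2
  ext i
  exact abs_mul_reflection x j i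

theorem pderivWord_replicate_scale {Ω' : Opens (Fin d → ℝ)} {φ : 𝓓(Ω, 𝕜)} {ψ : 𝓓(Ω', 𝕜)}
    {y : Fin d → ℝ} (h : ∀ x, ψ x = φ (x * y)) (l : ℕ) (j : Fin d) (x : Fin d → ℝ) :
    pderivWord (List.replicate l j) ψ x =
      y j ^ l • pderivWord (List.replicate l j) φ (x * y) := by
  induction l generalizing x with
  | zero => simpa using h x
  | succ l ih =>
    have h1 : ∀ x, pderivWord (List.replicate l j) ψ x =
        (((y j ^ l : ℝ) : 𝕜) • pderivWord (List.replicate l j) φ) (x * y) := fun x => by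
      rw [ih, smul_apply, smul_eq_mul, RCLike.real_smul_eq_coe_mul]
    rw [pderivWord_replicate_succ, pderivWord_replicate_succ, pderiv_scale h1, map_smul, smul_apply,
      smul_eq_mul, RCLike.real_smul_eq_coe_mul, RCLike.real_smul_eq_coe_mul]
    push_cast
    ring

/-- The antiderivative in the `j`-th coordinate. -/
def antideriv (j : Fin d) (h : (Fin d → ℝ) → 𝕜) (x : Fin d → ℝ) : 𝕜 :=
  ∫ σ in Iic (x j), h (Function.update x j σ)

/-- The measure whose convolution is `antideriv j`. -/
def rayMeasure (j : Fin d) : Measure (Fin d → ℝ) :=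
  Measure.map (fun τ : ℝ => Pi.single j τ) (volume.restrict (Ici 0))

theorem continuous_single (j : Fin d) : Continuous fun τ : ℝ => (Pi.single j τ : Fin d → ℝ) :=
  _root_.continuous_single (A := fun _ : Fin d => ℝ) j

instance (j : Fin d) : IsLocallyFiniteMeasure (rayMeasure j) where
  finiteAtNhds x := by
    refine ⟨Metric.ball x 1, Metric.ball_mem_nhds x one_pos, ?_⟩
    rw [rayMeasure, Measure.map_apply (continuous_single j).measurable measurableSet_ball]
    refine ((Measure.restrict_apply_le _ _).trans (measure_mono (t := Metric.ball (x j) 1) ?_)).trans_lt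
      measure_ball_lt_top
    intro τ hτ
    have := (dist_le_pi_dist _ x j).trans_lt hτ
    simpa using this

/-- Smoothness of the antiderivative in all variables then follows from that of convolutions with a
locally finite measure. -/
theorem antideriv_eq_convolution (j : Fin d) {h : (Fin d → ℝ) → 𝕜} (hc : Continuous h)
    (x : Fin d → ℝ) :
    antideriv j h x = ∫ t, (1 : ℝ) • h (x - t) ∂(rayMeasure j) := by
  have h1 : ∀ τ : ℝ, x - Pi.single j τ = Function.update x j (x j - τ) := fun τ => by
    ext i
    by_cases hi : i = j
    · subst hi; simp
    · simp [hi]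
  rw [rayMeasure, integral_map (continuous_single j).aemeasurable (by
    apply Continuous.aestronglyMeasurable; fun_prop)]
  simp only [one_smul, h1]
  rw [antideriv, ← integral_indicator measurableSet_Iic, ← integral_indicator measurableSet_Ici,
    ← integral_sub_left_eq_self _ volume (x j)]
  congr 1
  ext τ
  simp [indicator]

theorem contDiff_antideriv (j : Fin d) {h : (Fin d → ℝ) → 𝕜} (hh : ContDiff ℝ (⊤ : ℕ∞) h)
    (hs : HasCompactSupport h) : ContDiff ℝ (⊤ : ℕ∞) (antideriv j h) := by
  have h1 : antideriv j h = convolution (fun _ => (1 : ℝ)) h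
      (ContinuousLinearMap.lsmul ℝ ℝ) (rayMeasure j) := by
    ext x
    rw [antideriv_eq_convolution j hh.continuous]
    rfl
  rw [h1]
  exact hs.contDiff_convolution_right _ (locallyIntegrable_const 1) hh

theorem hasCompactSupport_comp_update {h : (Fin d → ℝ) → 𝕜} (hs : HasCompactSupport h)
    (x : Fin d → ℝ) (j : Fin d) : HasCompactSupport fun s => h (Function.update x j s) := by
  obtain ⟨R, hR⟩ := hs.isCompact.isBounded.exists_norm_le
  refine HasCompactSupport.of_support_subset_isCompact (isCompact_closedBall 0 R) fun s hs' => ?_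
  have := (norm_le_pi_norm _ j).trans (hR _ (subset_tsupport _ hs'))
  simpa using this

theorem hasDerivAt_antideriv (j : Fin d) {h : (Fin d → ℝ) → 𝕜} (hc : Continuous h)
    (hs : HasCompactSupport h) (x : Fin d → ℝ) :
    HasDerivAt (fun s => antideriv j h (Function.update x j s)) (h x) (x j) := by
  set g : ℝ → 𝕜 := fun s => h (Function.update x j s)
  have hg : Continuous g := by fun_prop
  have hgs : HasCompactSupport g := hasCompactSupport_comp_update hs x j
  have hi : Integrable g := hg.integrable_of_hasCompactSupport hgs
  have h1 : (fun s => antideriv j h (Function.update x j s)) =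
      fun s => (∫ σ in Iic (x j), g σ) + ∫ σ in (x j)..s, g σ := by
    ext s
    rw [← intervalIntegral.integral_Iic_sub_Iic hi.integrableOn hi.integrableOn, add_sub_cancel]
    simp [antideriv, g]
  rw [h1]
  have h2 := intervalIntegral.integral_hasDerivAt_right (a := x j) (b := x j)
    (hg.intervalIntegrable _ _) (hg.stronglyMeasurableAtFilter _ _) hg.continuousAt
  have h3 : g (x j) = h x := by simp [g]
  rw [h3] at h2
  exact h2.const_add _

/-- If another coordinate exceeds `R`, the whole line misses the support of `h`. Otherwise `|x_j| >
R`: on the negative side nothing has been integrated yet, and on the positive side the full integral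
of an odd function appears. -/
theorem antideriv_eq_zero (j : Fin d) {h : (Fin d → ℝ) → 𝕜} {R : ℝ}
    (hR : ∀ x, R < ‖x‖ → h x = 0) (hodd : ∀ x, h (x * reflection j) = -h x)
    {x : Fin d → ℝ} (hx : R < ‖x‖) : antideriv j h x = 0 := by
  by_cases hi : ∃ i, i ≠ j ∧ R < |x i|
  · obtain ⟨i, hij, hi⟩ := hi
    rw [antideriv]
    refine integral_eq_zero_of_ae (ae_of_all _ fun σ => hR _ (hi.trans_le ?_))
    have := norm_le_pi_norm (Function.update x j σ) i
    rwa [Function.update_of_ne hij] at this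
  · push Not at hi
    have hj : R < |x j| := by
      by_contra! hj
      refine hx.not_ge ((pi_norm_le_iff_of_nonneg ((abs_nonneg _).trans hj)).2 fun i => ?_)
      by_cases h : i = j
      · rwa [h]
      · exact hi i h
    have hz : ∀ σ, R < |σ| → h (Function.update x j σ) = 0 := fun σ hσ => by
      refine hR _ (hσ.trans_le ?_)
      have := norm_le_pi_norm (Function.update x j σ) j
      rwa [Function.update_self] at this
    rw [antideriv]
    rcases lt_or_ge (x j) 0 with h0 | h0
    · rw [setIntegral_eq_zero_of_forall_eq_zero]
      intro σ hσ
      refine hz σ (hj.trans_le ?_)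
      rw [mem_Iic] at hσ
      rw [abs_of_neg h0, abs_of_nonpos (hσ.trans h0.le)]
      linarith
    · rw [abs_of_nonneg h0] at hj
      rw [setIntegral_eq_integral_of_forall_compl_eq_zero]
      · have h1 := integral_neg_eq_self (fun σ => h (Function.update x j σ)) volume
        have h2 : ∀ σ, h (Function.update x j (-σ)) = -h (Function.update x j σ) := fun σ => by
          rw [← hodd, mul_reflection]
          simp
        simp only [h2, integral_neg] at h1
        exact self_eq_neg.1 h1.symm
      · intro σ hσ
        rw [mem_Iic, not_le] at hσ
        exact hz σ ((hj.trans hσ).trans_le (le_abs_self _))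

theorem contDiff_inv_pow_smul {h : (Fin d → ℝ) → 𝕜} (hh : ContDiff ℝ (⊤ : ℕ∞) h) (j : Fin d)
    {c : ℝ} (hc : 0 < c) (h0 : ∀ x, h x ≠ 0 → c ≤ |x j|) (n : ℕ) :
    ContDiff ℝ (⊤ : ℕ∞) fun x => ((x j)⁻¹ ^ n) • h x := by
  rw [contDiff_iff_contDiffAt]
  intro x
  by_cases hx : x j = 0
  · have : (fun x => ((x j)⁻¹ ^ n) • h x) =ᶠ[𝓝 x] fun _ => 0 := by
      have ho : IsOpen {x : Fin d → ℝ | |x j| < c} :=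
        isOpen_lt ((continuous_apply j).abs) continuous_const
      filter_upwards [ho.mem_nhds (x := x) (by simpa [hx] using hc)] with z hz
      have : h z = 0 := by
        by_contra hne
        exact (h0 z hne).not_gt hz
      rw [this, smul_zero]
    exact contDiffAt_const.congr_of_eventuallyEq this
  · exact (((contDiff_coord j).contDiffAt.inv hx).pow n).smul hh.contDiffAt

/-- A function with suitable parity which vanishes near `x_j = 0` is in the range of
`φ ↦ P_j φ + (l + 1) φ`, where `P_j` is the transposed Euler derivative. -/
theorem exists_eulerTranspose_add_eq (j : Fin d) (l : ℕ) {R c : ℝ} (hc : 0 < c)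
    (hR : Metric.closedBall 0 R ⊆ (Ω : Set (Fin d → ℝ))) (φ : 𝓓(Ω, 𝕜))
    (hφR : ∀ x, φ x ≠ 0 → ‖x‖ ≤ R) (hφc : ∀ x, φ x ≠ 0 → c ≤ |x j|)
    (hpar : ∀ x, φ (x * reflection j) = (-1 : 𝕜) ^ l * φ x) :
    ∃ ψ : 𝓓(Ω, 𝕜), φ = -(eulerTranspose j ψ + ((l : 𝕜) + 1) • ψ) := by
  -- The equation reads `φ = x_j ∂_j ψ - l ψ = x_j^(l+1) ∂_j (x_j^(-l) ψ)`, so `ψ = x_j^l u` with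
  -- `∂_j u = h`.
  set h : (Fin d → ℝ) → 𝕜 := fun x => ((x j)⁻¹ ^ (l + 1)) • φ x
  have hh : ContDiff ℝ (⊤ : ℕ∞) h := contDiff_inv_pow_smul (smooth φ) j hc hφc (l + 1)
  have hhs : HasCompactSupport h :=
    HasCompactSupport.smul_left (f := fun x : Fin d → ℝ => (x j)⁻¹ ^ (l + 1)) φ.hasCompactSupport
  have hhR : ∀ x, R < ‖x‖ → h x = 0 := fun x hx => by
    by_contra hne
    exact hx.not_ge (hφR x (right_ne_zero_of_smul hne))
  -- The parity hypothesis serves exactly this: an odd `h` has integral zero on each line, so its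
  -- antiderivative has compact support.
  have hodd : ∀ x, h (x * reflection j) = -h x := fun x => by
    simp only [h, hpar, Pi.mul_apply, reflection_self, RCLike.real_smul_eq_coe_mul]
    push_cast
    rw [mul_neg, mul_one, inv_neg, neg_pow, pow_succ (-1 : 𝕜) l]
    have : ((-1 : 𝕜) ^ l) * (-1) ^ l = 1 := by rw [← mul_pow]; simp
    linear_combination (-((x j : 𝕜)⁻¹ ^ (l + 1)) * φ x) * this
  have hu0 : Function.support (antideriv j h) ⊆ Metric.closedBall 0 R := fun x hx => by
    rw [mem_closedBall_zero_iff]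
    by_contra! hne
    exact hx (antideriv_eq_zero j hhR hodd hne)
  let u : 𝓓(Ω, 𝕜) :=
    { toFun := antideriv j h
      contDiff' := contDiff_antideriv j hh hhs
      hasCompactSupport' := HasCompactSupport.of_support_subset_isCompact
        (isCompact_closedBall 0 R) hu0
      tsupport_subset' := (closure_minimal hu0 Metric.isClosed_closedBall).trans hR }
  have hu : ∀ x, pderiv j u x = h x := fun x => by
    have h1 := hasDerivAt_comp_update u x j (x j)
    rw [Function.update_eq_self] at h1
    exact h1.unique (hasDerivAt_antideriv j hh.continuous hhs x)
  have hpow : ContDiff ℝ (⊤ : ℕ∞) fun x : Fin d → ℝ => x j ^ l := (contDiff_coord j).pow l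
  refine ⟨smulLeft (fun x => x j ^ l) hpow u, ?_⟩
  ext x
  have hfd : fderiv ℝ (fun x : Fin d → ℝ => x j ^ l) x (Pi.single j 1) = l * x j ^ (l - 1) := by
    have h1 : HasFDerivAt (fun x : Fin d → ℝ => x j)
        (ContinuousLinearMap.proj (R := ℝ) (φ := fun _ : Fin d => ℝ) j) x :=
      (ContinuousLinearMap.proj (R := ℝ) (φ := fun _ : Fin d => ℝ) j).hasFDerivAt
    rw [(h1.pow l).fderiv]
    simp
  have hx : (x j ^ (l + 1)) • h x = φ x := by
    by_cases h0 : φ x = 0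
    · simp [h, h0]
    · have : x j ≠ 0 := fun hx => by
        have := hφc x h0
        rw [hx, abs_zero] at this
        linarith
      simp only [h]
      rw [smul_smul, ← mul_pow, mul_inv_cancel₀ this, one_pow, one_smul]
  have hl : x j * (l * x j ^ (l - 1)) = l * x j ^ l := by
    cases l with
    | zero => simp
    | succ l => 
      rw [Nat.add_sub_cancel, pow_succ]
      ring
  rw [neg_apply, add_apply, smul_apply, eulerTranspose_apply, pderiv_smulLeft_apply, hu, hfd,
    smulLeft_apply]
  generalize h x = v at hx
  have hl' : ((x j * (l * x j ^ (l - 1)) : ℝ) : 𝕜) = ((l * x j ^ l : ℝ) : 𝕜) := by rw [hl]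
  simp only [RCLike.real_smul_eq_coe_mul, smul_eq_mul] at hx ⊢
  push_cast at hx hl' ⊢
  linear_combination -hx - u x * hl'

variable {L : Dist 𝕜 Ω → Dist 𝕜 Ω} {M : 𝓓(Ω, 𝕜) → 𝓓(Ω, 𝕜)}

/-- Symmetrization reduces to functions of parity `(-1)^l`, which lie in the range of the Euler
operator shifted by `l + 1`. Since `M` commutes with that operator, its image has vanishing `l`-th
normal derivative. -/
theorem IsTranspose.pderivWord_replicate_eq_zero (h : IsTranspose L M) (j : Fin d) (l : ℕ) {R c : ℝ}
    (hc : 0 < c) (hR : Metric.closedBall 0 R ⊆ (Ω : Set (Fin d → ℝ))) (φ : 𝓓(Ω, 𝕜))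
    (hφR : ∀ x, φ x ≠ 0 → ‖x‖ ≤ R) (hφc : ∀ x, φ x ≠ 0 → c ≤ |x j|) {y : Fin d → ℝ}
    (hy : y j = 0) : pderivWord (List.replicate l j) (M φ) y = 0 := by
  have hts : tsupport φ ⊆ Metric.closedBall 0 R :=
    closure_minimal (fun x hx => mem_closedBall_zero_iff.2 (hφR x hx)) Metric.isClosed_closedBall
  set ρ := scaleTo Ω (reflection j) (reflection_ne_zero j) φ fun x hx => hR (by
    have := hts hx
    rwa [mem_closedBall_zero_iff, norm_mul_reflection] at *)
  have hρ : ∀ x, ρ x = φ (x * reflection j) := fun x => rfl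
  have hrr : ∀ x : Fin d → ℝ, x * reflection j * reflection j = x := fun x => by
    simp [mul_reflection]
  have hyr : y * reflection j = y := by
    rw [mul_reflection, hy, neg_zero, ← hy, Function.update_eq_self]
  have h1 : pderivWord (List.replicate l j) (M ρ) y =
      (-1 : 𝕜) ^ l * pderivWord (List.replicate l j) (M φ) y := by
    rw [pderivWord_replicate_scale (h.apply_scale (reflection_ne_zero j) hρ), hyr, reflection_self,
      RCLike.real_smul_eq_coe_mul]
    push_cast
    rfl
  have hs : ((-1 : 𝕜) ^ l) * (-1) ^ l = 1 := by rw [← mul_pow]; simp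
  -- `M` commutes with the reflection, so on the hyperplane both summands contribute the same `l`-th
  -- derivative, and symmetrizing just doubles it.
  set φ₁ : 𝓓(Ω, 𝕜) := φ + (-1 : 𝕜) ^ l • ρ
  have hφ₁ : ∀ x, φ₁ x ≠ 0 → φ x ≠ 0 ∨ φ (x * reflection j) ≠ 0 := fun x hx => by
    by_contra! h
    refine hx ?_
    simp [φ₁, hρ, h.1, h.2]
  obtain ⟨ψ, hψ⟩ := exists_eulerTranspose_add_eq j l hc hR φ₁
    (fun x hx => (hφ₁ x hx).elim (hφR x) fun h => by
      rw [← norm_mul_reflection x j]; exact hφR _ h)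
    (fun x hx => (hφ₁ x hx).elim (hφc x) fun h => by
      rw [← abs_mul_reflection x j]; exact hφc _ h)
    (fun x => by
      simp only [φ₁, add_apply, smul_apply, hρ, hrr, smul_eq_mul]
      linear_combination (-φ (x * reflection j)) * hs)
  have h2 : pderivWord (List.replicate l j) (M φ₁) y = 0 := by
    rw [hψ, ← neg_one_smul 𝕜, h.map_smul, h.map_add, h.map_smul, h.eulerTranspose,
      ← pderivWordCLM_apply, _root_.map_smul, _root_.map_add, _root_.map_smul]
    simp only [pderivWordCLM_apply, smul_apply, add_apply]
    rw [pderivWord_replicate_eulerTranspose_apply l j _ hy, smul_eq_mul, smul_eq_mul]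
    ring
  have h3 : pderivWord (List.replicate l j) (M φ₁) y =
      2 * pderivWord (List.replicate l j) (M φ) y := by
    rw [h.map_add, h.map_smul, ← pderivWordCLM_apply, _root_.map_add, _root_.map_smul]
    simp only [pderivWordCLM_apply, smul_apply, add_apply]
    rw [h1, smul_eq_mul]
    linear_combination (pderivWord (List.replicate l j) (M φ) y) * hs
  rw [h3] at h2
  simpa using h2

/-- Flatness turns a bound on `∂_j^k M φ` into a factor `|y_j|^k`. The index `none` stands for the
plain bound, also needed when there are no coordinates. -/
theorem IsTranspose.exists_bound_pow (h : IsTranspose L M) {R c : ℝ} (hc : 0 < c)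
    (hR : Metric.closedBall 0 R ⊆ (Ω : Set (Fin d → ℝ))) (k : ℕ) :
    ∃ (w : Option (Fin d) → List (Fin d)) (C : ℝ), 0 ≤ C ∧ ∀ φ : 𝓓(Ω, 𝕜),
      (∀ x, φ x ≠ 0 → ‖x‖ ≤ R ∧ ∀ j, c ≤ |x j|) → ∀ y,
        ‖M φ y‖ ≤ C * ∑ o, ∫ x, ‖pderivWord (w o) φ x‖ ∧
        ∀ j, ‖M φ y‖ ≤ C * |y j| ^ k * ∑ o, ∫ x, ‖pderivWord (w o) φ x‖ := by
  have key : ∀ o : Option (Fin d), ∃ (w : List (Fin d)) (C : ℝ), 0 ≤ C ∧ ∀ φ : 𝓓(Ω, 𝕜),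
      tsupport φ ⊆ Metric.closedBall 0 R → ∀ y,
        ‖pderivWord (o.elim [] fun j => List.replicate k j) (M φ) y‖ ≤
          C * ∫ x, ‖pderivWord w φ x‖ := fun o => by
    simpa using h.exists_bound hR (pderivWordCLM (o.elim [] fun j => List.replicate k j))
  choose w C hC hw using key
  refine ⟨w, ∑ o, C o, Finset.sum_nonneg fun o _ => hC o, fun φ hφ y => ?_⟩
  have hts : tsupport φ ⊆ Metric.closedBall 0 R :=
    closure_minimal (fun x hx => mem_closedBall_zero_iff.2 (hφ x hx).1) Metric.isClosed_closedBall
  have hI : ∀ o, 0 ≤ ∫ x, ‖pderivWord (w o) φ x‖ := fun o => integral_nonneg fun _ => norm_nonneg _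
  have hle : ∀ o, C o * ∫ x, ‖pderivWord (w o) φ x‖ ≤
      (∑ o, C o) * ∑ o, ∫ x, ‖pderivWord (w o) φ x‖ := fun o =>
    mul_le_mul (Finset.single_le_sum (fun o _ => hC o) (Finset.mem_univ o))
      (Finset.single_le_sum (fun o _ => hI o) (Finset.mem_univ o)) (hI o)
      (Finset.sum_nonneg fun o _ => hC o)
  refine ⟨(hw none φ hts y).trans (hle none), fun j => ?_⟩
  have h1 := norm_le_abs_pow_mul j k (M φ)
    (fun l _ y hy => h.pderivWord_replicate_eq_zero j l hc hR φ (fun x hx => (hφ x hx).1)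
      (fun x hx => (hφ x hx).2 j) hy)
    (fun y => (hw (some j) φ hts y).trans (hle (some j))) y
  calc ‖M φ y‖ ≤ _ := h1
    _ = _ := by ring

end Flatness

end HadamardOp
end

noncomputable section

namespace HadamardOp

open Filter Topology Set

/-! ### A weighted bound for the distribution of a Hadamard operator -/

section Weighted

variable {𝕜 : Type*} [RCLike 𝕜] {d : ℕ} {Ω : Opens (Fin d → ℝ)}

/-- Smooth functions of one variable with support in `c ≤ |s| ≤ R`. -/
def bandClass (c R : ℝ) : Set (ℝ → ℝ) :=
  {η | ContDiff ℝ (⊤ : ℕ∞) η ∧ (∀ s, |s| < c → η s = 0) ∧ ∀ s, R < |s| → η s = 0}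

theorem contDiff_inv_mul {η : ℝ → ℝ} (h : ContDiff ℝ (⊤ : ℕ∞) η) {c : ℝ} (hc : 0 < c)
    (h0 : ∀ s, |s| < c → η s = 0) : ContDiff ℝ (⊤ : ℕ∞) fun s => s⁻¹ * η s := by
  rw [contDiff_iff_contDiffAt]
  intro s
  by_cases hs : s = 0
  · have : (fun s => s⁻¹ * η s) =ᶠ[𝓝 s] fun _ => 0 := by
      filter_upwards [(isOpen_lt continuous_abs continuous_const).mem_nhds
        (show |s| < c by simpa [hs] using hc)] with t ht
      rw [h0 t ht, mul_zero]
    exact contDiffAt_const.congr_of_eventuallyEq this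
  · exact (contDiffAt_inv ℝ hs).mul h.contDiffAt

theorem bandClass_inv_mul {c R : ℝ} (hc : 0 < c) {η : ℝ → ℝ} (h : η ∈ bandClass c R) :
    (fun s => s⁻¹ * η s) ∈ bandClass c R :=
  ⟨contDiff_inv_mul h.1 hc h.2.1, fun s hs => by simp [h.2.1 s hs],
    fun s hs => by simp [h.2.2 s hs]⟩

theorem bandClass_deriv {c R : ℝ} {η : ℝ → ℝ} (h : η ∈ bandClass c R) :
    deriv η ∈ bandClass c R := by
  refine ⟨contDiff_deriv h.1, fun s hs => deriv_eq_zero_of_forall_abs_lt h.2.1 hs, fun s hs => ?_⟩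
  have : η =ᶠ[𝓝 s] fun _ => 0 := by
    filter_upwards [(isOpen_lt continuous_const continuous_abs).mem_nhds hs] with t ht
      using h.2.2 t ht
  rw [this.deriv_eq, deriv_const]

theorem bandClass_bounded {c R : ℝ} {η : ℝ → ℝ} (h : η ∈ bandClass c R) :
    ∃ b, ∀ s, |η s| ≤ b := by
  have hs : HasCompactSupport η := HasCompactSupport.of_support_subset_isCompact
    (isCompact_closedBall 0 R) fun s hs => by
      rw [mem_closedBall_zero_iff, Real.norm_eq_abs]
      by_contra! hlt
      exact hs (h.2.2 s hlt)
  exact h.1.continuous.bounded_above_of_compact_support hs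

/-- The band stays away from the hyperplanes, so all partial derivatives of the localized function
become Euler derivatives with bounded coefficients. -/
theorem exists_pderivWord_smulLeft_eq {c R : ℝ} (hc : 0 < c) (w : List (Fin d)) {κ : ℝ → ℝ}
    (hκ : κ ∈ bandClass c R) (hχ : ContDiff ℝ (⊤ : ℕ∞) (tensor fun _ : Fin d => κ)) :
    ∃ (n : ℕ) (χ : Fin n → (Fin d → ℝ) → ℝ) (v : Fin n → List (Fin d)),
      (∀ i, χ i ∈ tensorClass d (bandClass c R)) ∧ ∀ (g : 𝓓(Ω, 𝕜)) x,
        pderivWord w (smulLeft (tensor fun _ => κ) hχ g) x =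
          ∑ i, χ i x • eulerWord (v i) g x := by
  refine (hasEulerExpansion_pderivWord_smulLeft (𝒢 := bandClass c R) (Ω := Ω) (𝕜 := 𝕜)
    (fun η h => h.1) (fun η h => h.2.1 0 (by simpa using hc)) (fun η h => ?_) (fun η h => ?_) w
    (χ := tensor fun _ => κ) ⟨_, fun _ => hκ, rfl⟩).exists_sum
  · have h1 := bandClass_deriv h
    have h2 := bandClass_inv_mul hc h
    exact ⟨h1.1.sub h2.1, fun s hs => by beta_reduce; rw [h1.2.1 s hs, h.2.1 s hs]; simp,
      fun s hs => by beta_reduce; rw [h1.2.2 s hs, h.2.2 s hs]; simp⟩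
  · have h2 := bandClass_inv_mul hc h
    exact ⟨h2.1.neg, fun s hs => by simp [h.2.1 s hs], fun s hs => by simp [h.2.2 s hs]⟩

theorem pderivWord_congr {Ω' : Opens (Fin d → ℝ)} {φ : 𝓓(Ω, 𝕜)} {ψ : 𝓓(Ω', 𝕜)}
    (h : ∀ x, ψ x = φ x) (w : List (Fin d)) (x : Fin d → ℝ) :
    pderivWord w ψ x = pderivWord w φ x := by
  induction w generalizing x with
  | nil => exact h x
  | cons j w ih =>
    rw [pderivWord_cons, pderivWord_cons, pderiv_apply, pderiv_apply, funext ih]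

variable {L : Dist 𝕜 Ω → Dist 𝕜 Ω} {M : 𝓓(Ω, 𝕜) → 𝓓(Ω, 𝕜)}

/-- An abstract form of the choice of the coordinate in which the transform is flat. -/
theorem exists_weight {A y₀ R S : ℝ} {y : Fin d → ℝ} (k : ℕ) (hy : ∀ j, 0 < y j)
    (hy0 : ∀ j, y j ≤ y₀) (hy₀ : 0 < y₀) (hR : 0 < R) (h1 : A ≤ S)
    (h2 : ∀ j, A ≤ |y j| ^ k * S) :
    ∃ m, 0 ≤ m ∧ A ≤ m * S ∧ ∀ z : Fin d → ℝ, (∀ j, |z j * y j| ≤ R) →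
      m * (1 + ‖z‖) ^ k ≤ (1 + y₀ + R) ^ k := by
  -- In dimension zero there is no coordinate to use and the plain bound suffices.
  rcases isEmpty_or_nonempty (Fin d) with he | hne
  · refine ⟨1, zero_le_one, by simpa using h1, fun z _ => ?_⟩
    rw [one_mul, Subsingleton.elim z 0, norm_zero, add_zero]
    exact pow_le_pow_left₀ zero_le_one (by linarith) k
  -- The smallest coordinate controls all of `z`: it gives `‖z‖ ≤ R / y_j`, so `y_j (1 + ‖z‖)` is
  -- bounded.
  · obtain ⟨j, hj⟩ := Finite.exists_min y
    refine ⟨|y j| ^ k, by positivity, h2 j, fun z hz => ?_⟩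
    rw [← mul_pow, abs_of_pos (hy j)]
    refine pow_le_pow_left₀ (mul_nonneg (hy j).le (by positivity)) ?_ k
    have : ‖z‖ ≤ R / y j := by
      refine (pi_norm_le_iff_of_nonneg (div_nonneg hR.le (hy j).le)).2 fun i => ?_
      rw [le_div_iff₀ (hy j), Real.norm_eq_abs]
      refine (mul_le_mul_of_nonneg_left (hj i) (abs_nonneg _)).trans ?_
      rw [← abs_of_pos (hy i), ← abs_mul]
      exact hz i
    rw [le_div_iff₀ (hy j)] at this
    linarith [hy0 j]

theorem contDiff_tensor_mul {κ : ℝ → ℝ} (hκ : ContDiff ℝ (⊤ : ℕ∞) κ) (y : Fin d → ℝ) :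
    ContDiff ℝ (⊤ : ℕ∞) fun x => tensor (fun _ => κ) (x * y) :=
  (contDiff_tensor fun _ => hκ).comp (contDiff_id.mul contDiff_const)

theorem continuous_weight_mul (k : ℕ) (φ : 𝓓(Ω, 𝕜)) :
    Continuous fun x => ((1 + ‖x‖) ^ k)⁻¹ * ‖φ x‖ := by
  refine Continuous.mul (Continuous.inv₀ (by fun_prop) fun x => by positivity) φ.continuous.norm

theorem integrable_weight_mul (k : ℕ) (φ : 𝓓(Ω, 𝕜)) :
    Integrable fun x => ((1 + ‖x‖) ^ k)⁻¹ * ‖φ x‖ :=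
  (continuous_weight_mul k φ).integrable_of_hasCompactSupport φ.hasCompactSupport.norm.mul_left

/-- The weighted bound for one piece of a dyadic partition. -/
theorem IsTranspose.exists_bound_piece (h : IsTranspose L M)
    {T : Dist 𝕜 (⊤ : Opens (Fin d → ℝ))} (hT : ∀ φ, IsMulTransform T φ (M φ)) {c R : ℝ}
    (hc : 0 < c) (hcR : 0 < R) (hR : Metric.closedBall 0 R ⊆ (Ω : Set (Fin d → ℝ))) {κ : ℝ → ℝ}
    (hκ : κ ∈ bandClass c R) {y₀ : ℝ} (hy₀ : 0 < y₀) (k : ℕ) :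
    ∃ (ι : Type) (_ : Fintype ι) (w : ι → List (Fin d)) (C : ℝ), 0 ≤ C ∧
      ∀ y : Fin d → ℝ, (∀ j, 0 < y j) → (∀ j, y j ≤ y₀) → ∀ φ : 𝓓((⊤ : Opens (Fin d → ℝ)), 𝕜),
        ‖T (smulLeft _ (contDiff_tensor_mul hκ.1 y) φ)‖ ≤
          C * (∏ j, y j) * ∑ i, ∫ x, ((1 + ‖x‖) ^ k)⁻¹ * ‖eulerWord (w i) φ x‖ := by
  obtain ⟨w, C, hC, hw⟩ := h.exists_bound_pow hc hR k
  have hχ : ContDiff ℝ (⊤ : ℕ∞) (tensor fun _ : Fin d => κ) := contDiff_tensor fun _ => hκ.1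
  choose n χ v hχm hexp using fun o =>
    exists_pderivWord_smulLeft_eq (Ω := (⊤ : Opens (Fin d → ℝ))) (𝕜 := 𝕜) hc (w o) hκ hχ
  have hb : ∀ p : Σ o, Fin (n o), ∃ b, ∀ x, |χ p.1 p.2 x| ≤ b := fun p => by
    obtain ⟨η, hη, he⟩ := hχm p.1 p.2
    rw [he]
    exact exists_bound_tensor fun j => bandClass_bounded (hη j)
  choose b hb using hb
  have hb0 : ∀ p, 0 ≤ b p := fun p => (abs_nonneg _).trans (hb p 0)
  have hzero : ∀ (p : Σ o, Fin (n o)) x, χ p.1 p.2 x ≠ 0 → ∀ j, |x j| ≤ R := fun p x hx j => by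
    obtain ⟨η, hη, he⟩ := hχm p.1 p.2
    by_contra! hlt
    rw [he] at hx
    exact hx (Finset.prod_eq_zero (Finset.mem_univ j) ((hη j).2.2 _ hlt))
  have hts : ∀ x : Fin d → ℝ, tensor (fun _ => κ) x ≠ 0 → ∀ j, c ≤ |x j| ∧ |x j| ≤ R := by
    intro x hx j
    have := Finset.prod_ne_zero_iff.1 hx j (Finset.mem_univ j)
    constructor
    · by_contra! hlt
      exact this (hκ.2.1 _ hlt)
    · by_contra! hlt
      exact this (hκ.2.2 _ hlt)
  set B := ∑ p : (Σ o, Fin (n o)), b p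
  have hB0 : 0 ≤ B := Finset.sum_nonneg fun p _ => hb0 p
  have hB : ∀ (p : Σ o, Fin (n o)) x, |χ p.1 p.2 x| ≤ B := fun p x =>
    (hb p x).trans (Finset.single_le_sum (fun p _ => hb0 p) (Finset.mem_univ p))
  set B' := (1 + y₀ + R) ^ k
  have hB' : 0 ≤ B' := by positivity
  refine ⟨Σ o, Fin (n o), inferInstance, fun p : (Σ o, Fin (n o)) => v p.1 p.2, C * (B * B'),
    by positivity, fun y hy hyy φ => ?_⟩
  have hy0 : ∀ j, y j ≠ 0 := fun j => (hy j).ne'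
  have hy0' : ∀ j, y⁻¹ j ≠ 0 := fun j => inv_ne_zero (hy0 j)
  have hyinv : ∀ x : Fin d → ℝ, x * y⁻¹ * y = x := fun x => by
    ext j
    simp [hy0 j]
  set ωφ := smulLeft _ (contDiff_tensor_mul hκ.1 y) φ
  have hωs : ∀ x, x * y⁻¹ ∈ tsupport ωφ → x ∈ Metric.closedBall 0 R := by
    have hcl : IsClosed {z : Fin d → ℝ | z * y ∈ Metric.closedBall 0 R} :=
      Metric.isClosed_closedBall.preimage (continuous_id.mul continuous_const)
    intro x hx
    have := closure_minimal (fun z hz => ?_) hcl hx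
    · rwa [mem_ofPred_eq, hyinv] at this
    · rw [mem_ofPred_eq, mem_closedBall_zero_iff, pi_norm_le_iff_of_nonneg hcR.le]
      exact fun j => (hts _ (left_ne_zero_of_smul hz) j).2
  -- Dilating the piece gives `ψ(x) = κ(x) φ(x/y)`, with `κ` standing for its tensor power. The
  -- cutoff no longer depends on `y`, so constants are uniform.
  set ψ := scaleTo Ω y⁻¹ hy0' ωφ fun x hx => hR (hωs x hx)
  have hψ : ∀ x, ψ x = smulLeft _ hχ (dilate y⁻¹ hy0' φ) x := fun x => by
    rw [scaleTo_apply, smulLeft_apply, smulLeft_apply, dilate_apply, hyinv]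
  have hψ0 : ∀ x, ψ x ≠ 0 → ∀ j, c ≤ |x j| ∧ |x j| ≤ R := fun x hx => by
    rw [hψ, smulLeft_apply] at hx
    exact hts x (left_ne_zero_of_smul hx)
  have hTM : T ωφ = M ψ y := by
    rw [hT ψ y hy0, dilate_scaleTo_inv]
  rw [hTM]
  set S := ∑ o, ∫ x, ‖pderivWord (w o) ψ x‖
  have h1 := hw ψ (fun x hx => ⟨(pi_norm_le_iff_of_nonneg hcR.le).2 fun j => (hψ0 x hx j).2,
    fun j => (hψ0 x hx j).1⟩) y
  obtain ⟨m, hm0, hm1, hm2⟩ := exists_weight k hy hyy hy₀ hcR h1.1 fun j => by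
    calc ‖M ψ y‖ ≤ _ := h1.2 j
      _ = _ := by ring
  have hpy : 0 < ∏ j, y j := Finset.prod_pos fun j _ => hy j
  have key : ∀ o, m * ∫ x, ‖pderivWord (w o) ψ x‖ ≤ B * B' * (∏ j, y j) *
      ∑ i, ∫ x, ((1 + ‖x‖) ^ k)⁻¹ * ‖eulerWord (v o i) φ x‖ := by
    intro o
    set H : (Fin d → ℝ) → ℝ := fun z => ∑ i, ((1 + ‖z‖) ^ k)⁻¹ * ‖eulerWord (v o i) φ z‖
    have hH : Integrable H := integrable_finsetSum _ fun i _ => integrable_weight_mul k _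
    -- Euler derivatives of `φ(x/y)` produce no powers of `1/y`; the flatness factor `m` absorbs the
    -- weight on the support of the coefficients.
    have hpt : ∀ x, m * ‖pderivWord (w o) ψ x‖ ≤ B * B' * H (y⁻¹ * x) := fun x => by
      rw [pderivWord_congr hψ, hexp]
      refine (mul_le_mul_of_nonneg_left (norm_sum_le _ _) hm0).trans ?_
      rw [Finset.mul_sum, Finset.mul_sum]
      refine Finset.sum_le_sum fun i _ => ?_
      rw [norm_smul, eulerWord_scale (φ := φ) (y := y⁻¹) (fun x => rfl), mul_comm x, ← mul_assoc,
        ← mul_assoc]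
      refine mul_le_mul_of_nonneg_right ?_ (norm_nonneg _)
      by_cases hx : χ o i x = 0
      · rw [hx, norm_zero, mul_zero]
        positivity
      · rw [← div_eq_mul_inv, le_div_iff₀ (by positivity)]
        have h2 := hm2 (y⁻¹ * x) fun j => by
          have : (y⁻¹ * x) j * y j = x j := by
            have := congrFun (hyinv x) j
            rw [mul_comm x] at this
            exact this
          rw [this]
          exact hzero ⟨o, i⟩ x hx j
        calc m * ‖χ o i x‖ * (1 + ‖y⁻¹ * x‖) ^ k
            = ‖χ o i x‖ * (m * (1 + ‖y⁻¹ * x‖) ^ k) := by ring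
          _ ≤ B * B' := mul_le_mul (hB ⟨o, i⟩ x) h2 (by positivity) hB0
    calc m * ∫ x, ‖pderivWord (w o) ψ x‖ = ∫ x, m * ‖pderivWord (w o) ψ x‖ :=
          (integral_const_mul _ _).symm
      _ ≤ ∫ x, B * B' * H (y⁻¹ * x) :=
          integral_mono_of_nonneg (ae_of_all _ fun x => by positivity)
            ((integrable_comp_mul hH _ hy0').const_mul _) (ae_of_all _ hpt)
      _ = B * B' * ((∏ j, y j) * ∫ x, H x) := by
          rw [integral_const_mul, integral_comp_mul H _ hy0', smul_eq_mul]
          congr 3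
          simp only [Pi.inv_apply, Finset.prod_inv_distrib]
          rw [abs_of_pos (inv_pos.2 hpy), inv_inv]
      _ = _ := by
          rw [integral_finsetSum _ fun i _ => integrable_weight_mul k _]
          ring
  calc ‖M ψ y‖ ≤ m * (C * S) := hm1
    _ = C * ∑ o, m * ∫ x, ‖pderivWord (w o) ψ x‖ := by rw [← Finset.mul_sum]; ring
    _ ≤ C * ∑ o, B * B' * (∏ j, y j) *
        ∑ i, ∫ x, ((1 + ‖x‖) ^ k)⁻¹ * ‖eulerWord (v o i) φ x‖ :=
        mul_le_mul_of_nonneg_left (Finset.sum_le_sum fun o _ => key o) hC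
    _ = _ := by
        rw [← Finset.mul_sum, Fintype.sum_sigma]
        ring

/-- The weighted bound for the distribution of a Hadamard operator. -/
theorem IsTranspose.exists_bound_dist (h : IsTranspose L M) (h0 : (0 : Fin d → ℝ) ∈ Ω)
    {T : Dist 𝕜 (⊤ : Opens (Fin d → ℝ))} (hT : ∀ φ, IsMulTransform T φ (M φ)) (k : ℕ) :
    ∃ (ι : Type) (_ : Fintype ι) (w : ι → List (Fin d)) (C : ℝ), 0 ≤ C ∧
      ∀ φ : 𝓓((⊤ : Opens (Fin d → ℝ)), 𝕜),
        ‖T φ‖ ≤ C * ∑ i, ∫ x, ((1 + ‖x‖) ^ k)⁻¹ * ‖eulerWord (w i) φ x‖ := by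
  obtain ⟨r', hr', hrΩ'⟩ := Metric.isOpen_iff.1 Ω.isOpen 0 h0
  set r := r' / 2
  have hr : 0 < r := by positivity
  have hrΩ : Metric.closedBall 0 r ⊆ (Ω : Set (Fin d → ℝ)) :=
    (Metric.closedBall_subset_ball (by simp only [r]; linarith)).trans hrΩ'
  obtain ⟨ε, hε, hsupp⟩ := h.exists_support_bound h0 hT
  set a := ε / 4
  have ha : 0 < a := by positivity
  obtain ⟨η, ⟨hη, hη0, -, -⟩, hη1⟩ := exists_mem_awayClass ha
  set y₀ := r / (4 * a)
  have hy₀ : 0 < y₀ := by positivity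
  -- As `η` vanishes below `a` and is 1 beyond `2a`, this difference lives in `a y₀ ≤ |s| ≤ 4 a y₀`,
  -- and `y₀ = r/(4a)` makes the outer radius equal to `r`.
  set κ : ℝ → ℝ := fun s => η (s / y₀) - η (s / y₀ / 2)
  have hκ : κ ∈ bandClass (r / 4) r := by
    refine ⟨?_, fun s hs => ?_, fun s hs => ?_⟩
    · exact (hη.comp (contDiff_id.div_const _)).sub
        (hη.comp ((contDiff_id.div_const _).div_const _))
    · have h1 : |s / y₀| < a := by
        rw [abs_div, abs_of_pos hy₀, div_lt_iff₀ hy₀]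
        calc |s| < r / 4 := hs
          _ = a * y₀ := by simp only [y₀]; field_simp
      have h2 : |s / y₀ / 2| < a := by
        rw [abs_div, abs_two]
        linarith [abs_nonneg (s / y₀)]
      simp only [κ]
      rw [hη0 _ h1, hη0 _ h2, sub_zero]
    · have h1 : 4 * a < |s / y₀| := by
        rw [abs_div, abs_of_pos hy₀, lt_div_iff₀ hy₀]
        calc 4 * a * y₀ = r := by simp only [y₀]; field_simp
          _ < |s| := hs
      have h2 : 2 * a < |s / y₀ / 2| := by
        rw [abs_div, abs_two]
        linarith
      simp only [κ]
      rw [hη1 _ (by linarith), hη1 _ h2, sub_self]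
  obtain ⟨ι, hι, w, C, hC, hw⟩ := h.exists_bound_piece hT (by positivity) hr hrΩ hκ hy₀ k
  refine ⟨ι, hι, w, C * (2 * y₀) ^ d, by positivity, fun φ => ?_⟩
  set y : (Fin d → ℕ) → Fin d → ℝ := fun n j => y₀ * (1 / 2) ^ n j
  have hy : ∀ n j, 0 < y n j := fun n j => by positivity
  have hyy : ∀ n j, y n j ≤ y₀ := fun n j =>
    mul_le_of_le_one_right hy₀.le (pow_le_one₀ (by norm_num) (by norm_num))
  have hηt : ContDiff ℝ (⊤ : ℕ∞) (tensor fun _ : Fin d => η) := contDiff_tensor fun _ => hη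
  obtain ⟨ρ, hρ⟩ := φ.hasCompactSupport.isCompact.isBounded.exists_norm_le
  obtain ⟨m, hm⟩ : ∃ m : ℕ, (1 / 2 : ℝ) ^ m * (|ρ| + 1) < a := by
    obtain ⟨m, hm⟩ := exists_pow_lt_of_lt_one (y := (1 / 2 : ℝ)) (div_pos ha (by positivity :
      0 < |ρ| + 1)) (by norm_num)
    exact ⟨m, (lt_div_iff₀ (by positivity)).1 hm⟩
  have hpart : smulLeft _ hηt φ = ∑ n ∈ Fintype.piFinset fun _ : Fin d => Finset.range m,
      smulLeft _ (contDiff_tensor_mul hκ.1 (y n)) φ := by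
    ext x
    rw [sum_apply]
    simp only [smulLeft_apply]
    rw [← Finset.sum_smul]
    by_cases hx : φ x = 0
    · simp [hx]
    congr 1
    -- The dyadic dilates of `κ` telescope, and on the bounded support of `φ` the remaining term
    -- vanishes by the choice of `m`.
    have htel : ∀ s, |s| ≤ ρ → η s = ∑ n ∈ Finset.range m, κ (s * (y₀ * (1 / 2) ^ n)) := by
      intro s hs
      have h1 : ∀ n : ℕ, κ (s * (y₀ * (1 / 2) ^ n)) =
          η (s * (1 / 2) ^ n) - η (s * (1 / 2) ^ (n + 1)) := fun n => by
        simp only [κ]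
        congr 2
        · field_simp
        · rw [pow_succ]
          field_simp
      simp only [h1]
      rw [Finset.sum_range_sub' (fun n => η (s * (1 / 2) ^ n)), pow_zero, mul_one,
        hη0 (s * (1 / 2) ^ m), sub_zero]
      refine lt_of_le_of_lt ?_ hm
      rw [abs_mul, abs_of_pos (by positivity : (0 : ℝ) < (1 / 2) ^ m), mul_comm]
      gcongr
      linarith [le_abs_self ρ]
    have hxρ : ∀ j, |x j| ≤ ρ := fun j =>
      (norm_le_pi_norm x j).trans (hρ x (subset_tsupport _ hx))
    simp only [tensor, y, Pi.mul_apply]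
    rw [Finset.prod_congr rfl fun j _ => htel (x j) (hxρ j), Finset.prod_univ_sum]
  have hTη : T φ = T (smulLeft _ hηt φ) := by
    rw [← sub_eq_zero, ← map_sub]
    refine apply_eq_zero_of_disjoint_dsupport T _ fun x hx hxT => ?_
    have ho : IsOpen {z : Fin d → ℝ | ∀ j, 2 * a < |z j|} := by
      simp only [ofPred_forall]
      exact isOpen_iInter_of_finite fun j =>
        isOpen_lt continuous_const ((continuous_apply j).abs)
    have hxo : x ∈ {z : Fin d → ℝ | ∀ j, 2 * a < |z j|} := fun j => by
      have := hsupp x hxT j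
      simp only [a]
      linarith
    refine notMem_tsupport_iff_eventuallyEq.2 ?_ hx
    filter_upwards [ho.mem_nhds hxo] with z hz
    have : tensor (fun _ : Fin d => η) z = 1 := Finset.prod_eq_one fun j _ => hη1 _ (hz j)
    rw [sub_apply, smulLeft_apply, this, one_smul, sub_self]
    rfl
  rw [hTη, hpart, map_sum]
  set I := ∑ i, ∫ x, ((1 + ‖x‖) ^ k)⁻¹ * ‖eulerWord (w i) φ x‖
  have hI : 0 ≤ I := Finset.sum_nonneg fun i _ => integral_nonneg fun x => by positivity
  -- The Jacobians sum to the `d`-th power of this series, bounded independently of `m` and hence of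
  -- the support of `φ`.
  have hgeo : ∑ n ∈ Finset.range m, y₀ * (1 / 2 : ℝ) ^ n ≤ 2 * y₀ := by
    rw [← Finset.mul_sum, mul_comm]
    refine mul_le_mul_of_nonneg_right ?_ hy₀.le
    exact (Summable.sum_le_tsum _ (fun n _ => by positivity) summable_geometric_two).trans_eq
      tsum_geometric_two
  calc ‖∑ n ∈ Fintype.piFinset fun _ : Fin d => Finset.range m,
        T (smulLeft _ (contDiff_tensor_mul hκ.1 (y n)) φ)‖
      ≤ ∑ n ∈ Fintype.piFinset fun _ : Fin d => Finset.range m, C * (∏ j, y n j) * I :=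
        norm_sum_le_of_le _ fun n _ => hw (y n) (hy n) (hyy n) φ
    _ = C * (∏ j : Fin d, ∑ n ∈ Finset.range m, y₀ * (1 / 2 : ℝ) ^ n) * I := by
        rw [Finset.prod_univ_sum, ← Finset.sum_mul, ← Finset.mul_sum]
    _ ≤ C * (2 * y₀) ^ d * I := by
        refine mul_le_mul_of_nonneg_right (mul_le_mul_of_nonneg_left ?_ hC) hI
        rw [Finset.prod_const, Finset.card_univ, Fintype.card_fin]
        exact pow_le_pow_left₀ (Finset.sum_nonneg fun n _ => by positivity) hgeo d

end Weighted

end HadamardOp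
end

noncomputable section

namespace HadamardOp

open Filter Topology Set

/-! ### The dual of `L¹` of a finite measure -/

section DualLone

variable {𝕜 : Type*} [RCLike 𝕜] {α : Type*} {m : MeasurableSpace α} {ν : Measure α}
  [IsFiniteMeasure ν]

theorem memLp_one_of_two {f : α → 𝕜} (hf : MemLp f 2 ν) : MemLp f 1 ν :=
  hf.mono_exponent one_le_two

/-- The inclusion of `L²` into `L¹` for a finite measure. -/
def lpTwoToOne (ν : Measure α) [IsFiniteMeasure ν] : Lp 𝕜 2 ν →L[𝕜] Lp 𝕜 1 ν :=
  LinearMap.mkContinuous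
    { toFun := fun f => (memLp_one_of_two (Lp.memLp f)).toLp f
      map_add' := fun f g => by
        rw [← MemLp.toLp_add]
        exact MemLp.toLp_congr _ _ (Lp.coeFn_add f g)
      map_smul' := fun c f => by
        rw [RingHom.id_apply, ← MemLp.toLp_const_smul]
        exact MemLp.toLp_congr _ _ (Lp.coeFn_smul c f) }
    (ν univ ^ (1 / (1 : ENNReal).toReal - 1 / (2 : ENNReal).toReal)).toReal fun f => by
    have h := eLpNorm_le_eLpNorm_mul_rpow_measure_univ (μ := ν) (p := 1) (q := 2) one_le_two
      (Lp.aestronglyMeasurable f)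
    simp only [LinearMap.coe_mk, AddHom.coe_mk]
    rw [Lp.norm_toLp, Lp.norm_def, mul_comm, ← ENNReal.toReal_mul]
    refine ENNReal.toReal_mono (ENNReal.mul_ne_top (Lp.eLpNorm_ne_top f) ?_) h
    exact ENNReal.rpow_ne_top_of_nonneg (by norm_num) (measure_ne_top ν _)

theorem lpTwoToOne_toLp {g : α → 𝕜} (hg : MemLp g 2 ν) :
    lpTwoToOne ν (hg.toLp g) = (memLp_one_of_two hg).toLp g :=
  MemLp.toLp_congr (memLp_one_of_two (Lp.memLp _)) _ hg.coeFn_toLp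

/-- A continuous linear form on `L¹` of a finite measure is given, on `L²`, by a bounded
function. -/
theorem exists_bounded_of_dual_lp_one (F : Lp 𝕜 1 ν →L[𝕜] 𝕜) :
    ∃ u : α → 𝕜, StronglyMeasurable u ∧ (∀ x, ‖u x‖ ≤ ‖F‖) ∧
      ∀ (g : α → 𝕜) (hg : MemLp g 2 ν),
        F ((memLp_one_of_two hg).toLp g) = ∫ x, u x * g x ∂ν := by
  set v : Lp 𝕜 2 ν := (InnerProductSpace.toDual 𝕜 (Lp 𝕜 2 ν)).symm (F.comp (lpTwoToOne ν))
  have hv : ∀ (g : α → 𝕜) (hg : MemLp g 2 ν),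
      F ((memLp_one_of_two hg).toLp g) = ∫ x, (starRingEnd 𝕜) (v x) * g x ∂ν := by
    intro g hg
    have h1 : inner 𝕜 v (hg.toLp g) = F ((memLp_one_of_two hg).toLp g) := by
      rw [InnerProductSpace.toDual_symm_apply, ContinuousLinearMap.comp_apply, lpTwoToOne_toLp]
    rw [← h1, L2.inner_def]
    refine integral_congr_ae ?_
    filter_upwards [hg.coeFn_toLp] with x hx
    rw [hx, RCLike.inner_apply, mul_comm]
  have hvm : StronglyMeasurable v := Lp.stronglyMeasurable v
  set s : Set α := {x | ‖F‖ < ‖v x‖}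
  have hs : MeasurableSet s := measurableSet_lt measurable_const hvm.norm.measurable
  have hs0 : ν s = 0 := by
    -- Testing with the phase of the Riesz representative on the set where it exceeds `‖F‖` would
    -- violate the operator norm unless that set is null.
    set g : α → 𝕜 := s.indicator fun x => ((‖v x‖⁻¹ : ℝ) : 𝕜) * v x
    have hgm : StronglyMeasurable g :=
      ((RCLike.continuous_ofReal.comp_stronglyMeasurable
        hvm.norm.measurable.inv.stronglyMeasurable).mul hvm).indicator hs
    have hgn : ∀ x, ‖g x‖ ≤ s.indicator 1 x := fun x => by
      by_cases hx : x ∈ s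
      · simp only [g, indicator_of_mem hx, norm_mul, RCLike.norm_ofReal, abs_inv, abs_norm,
          Pi.one_apply]
        exact inv_mul_le_one
      · simp [g, indicator_of_notMem hx]
    have hg2 : MemLp g 2 ν := MemLp.of_bound hgm.aestronglyMeasurable 1 (ae_of_all _ fun x =>
      (hgn x).trans (indicator_le_self' (fun _ _ => zero_le_one) x))
    have h1 : F ((memLp_one_of_two hg2).toLp g) = ((∫ x in s, ‖v x‖ ∂ν : ℝ) : 𝕜) := by
      rw [hv g hg2, ← integral_indicator hs, ← integral_ofReal]
      refine integral_congr_ae (ae_of_all _ fun x => ?_)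
      by_cases hx : x ∈ s
      · have hx0 : ((‖v x‖ : ℝ) : 𝕜) ≠ 0 := by
          exact_mod_cast ((norm_nonneg F).trans_lt hx).ne'
        simp only [g, indicator_of_mem hx]
        rw [mul_left_comm, RCLike.conj_mul]
        push_cast
        field_simp
      · simp [g, indicator_of_notMem hx]
    have h2 : ‖(memLp_one_of_two hg2).toLp g‖ ≤ ν.real s := by
      have := L1.norm_of_fun_eq_integral_norm (memLp_one_iff_integrable.1 (memLp_one_of_two hg2))
      refine this.trans_le ?_
      rw [← integral_indicator_one hs]
      refine integral_mono (memLp_one_iff_integrable.1 (memLp_one_of_two hg2)).norm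
        ((integrable_const (1 : ℝ)).indicator hs) fun x => ?_
      exact hgn x
    have hvi : IntegrableOn (fun x => ‖v x‖) s ν :=
      (memLp_one_iff_integrable.1 (memLp_one_of_two (Lp.memLp v))).norm.integrableOn
    have h3 : ∫ x in s, ‖v x‖ ∂ν ≤ ‖F‖ * ν.real s := by
      have h4 : ‖F ((memLp_one_of_two hg2).toLp g)‖ ≤ ‖F‖ * ν.real s :=
        (F.le_opNorm _).trans (mul_le_mul_of_nonneg_left h2 (norm_nonneg _))
      rw [h1, RCLike.norm_ofReal] at h4
      exact (le_abs_self _).trans h4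
    by_contra hne
    have hpos : 0 < ∫ x in s, (‖v x‖ - ‖F‖) ∂ν := by
      rw [setIntegral_pos_iff_support_of_nonneg_ae]
      · refine lt_of_lt_of_le (pos_iff_ne_zero.2 hne) (measure_mono fun x hx => ⟨?_, hx⟩)
        exact (sub_pos.2 hx).ne'
      · filter_upwards [ae_restrict_mem hs] with x hx using (sub_pos.2 hx).le
      · exact hvi.sub (integrable_const _).integrableOn
    rw [integral_sub hvi (integrable_const _).integrableOn, setIntegral_const, smul_eq_mul] at hpos
    linarith
  refine ⟨sᶜ.indicator fun x => (starRingEnd 𝕜) (v x), ?_, fun x => ?_, fun g hg => ?_⟩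
  · exact (RCLike.continuous_conj.comp_stronglyMeasurable hvm).indicator hs.compl
  · by_cases hx : x ∈ s
    · simp [hx]
    · rw [indicator_of_mem (mem_compl hx), RCLike.norm_conj]
      exact not_lt.1 hx
  · rw [hv g hg]
    refine integral_congr_ae ?_
    filter_upwards [measure_eq_zero_iff_ae_notMem.1 hs0] with x hx
    rw [indicator_of_mem (mem_compl hx)]

end DualLone

/-! ### The distribution of a Hadamard operator -/

section HahnBanach

/-- A linear form which is bounded by finitely many linear maps into a normed space factors
through them. -/
theorem exists_sum_dual {𝕜 V E : Type*} [RCLike 𝕜] [AddCommGroup V] [Module 𝕜 V]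
    [NormedAddCommGroup E] [NormedSpace 𝕜 E] {ι : Type*} [Fintype ι] (T : V →ₗ[𝕜] 𝕜)
    (J : ι → V →ₗ[𝕜] E) {C : ℝ} (hC : 0 ≤ C) (h : ∀ φ, ‖T φ‖ ≤ C * ∑ i, ‖J i φ‖) :
    ∃ F : ι → E →L[𝕜] 𝕜, ∀ φ, T φ = ∑ i, F i (J i φ) := by
  classical
  set J' : V →ₗ[𝕜] ι → E := LinearMap.pi J
  -- The bound forces `T` to vanish on the common kernel, so it descends to a bounded functional on
  -- the range, to which Hahn-Banach applies.
  have hT : T ∈ LinearMap.range J'.dualMap := by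
    rw [LinearMap.range_dualMap_eq_dualAnnihilator_ker, Submodule.mem_dualAnnihilator]
    intro φ hφ
    have h1 : ∀ i, J i φ = 0 := fun i => congrFun (LinearMap.mem_ker.1 hφ) i
    have := h φ
    simp only [h1, norm_zero, Finset.sum_const_zero, mul_zero] at this
    exact norm_le_zero_iff.1 this
  obtain ⟨f, hf⟩ := hT
  have hfJ : ∀ φ, f (J' φ) = T φ := fun φ => by
    rw [← hf]
    rfl
  obtain ⟨g, hg, -⟩ := exists_extension_norm_eq (𝕜 := 𝕜) (LinearMap.range J')
    (LinearMap.mkContinuous (f.domRestrict (LinearMap.range J')) (C * Fintype.card ι) (by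
      rintro ⟨_, φ, rfl⟩
      rw [LinearMap.domRestrict_apply, hfJ, mul_assoc]
      refine (h φ).trans (mul_le_mul_of_nonneg_left ?_ hC)
      rw [← nsmul_eq_mul, ← Finset.card_univ]
      exact Finset.sum_le_card_nsmul _ _ _ fun i _ => norm_le_pi_norm (J' φ) i))
  refine ⟨fun i => g.comp (ContinuousLinearMap.single 𝕜 (fun _ : ι => E) i), fun φ => ?_⟩
  have h1 := hg ⟨J' φ, φ, rfl⟩
  simp only [LinearMap.mkContinuous_apply, LinearMap.domRestrict_apply, hfJ] at h1
  rw [← h1, ← Finset.univ_sum_single (J' φ), map_sum]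
  rfl

end HahnBanach

section Representation

variable {𝕜 : Type*} [RCLike 𝕜] {d : ℕ} {Ω : Opens (Fin d → ℝ)}

/-- The density `(1 + ‖x‖)^{-k}`. -/
def weight (d k : ℕ) (x : Fin d → ℝ) : NNReal := Real.toNNReal ((1 + ‖x‖) ^ k)⁻¹

theorem coe_weight (k : ℕ) (x : Fin d → ℝ) : (weight d k x : ℝ) = ((1 + ‖x‖) ^ k)⁻¹ :=
  Real.coe_toNNReal _ (by positivity)

theorem continuous_weight (k : ℕ) : Continuous (weight d k) :=
  continuous_real_toNNReal.comp (Continuous.inv₀ (by fun_prop) fun x => by positivity)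

/-- The measure with density `(1 + ‖x‖)^{-k}`. -/
def weightMeasure (d k : ℕ) : Measure (Fin d → ℝ) :=
  volume.withDensity fun x => (weight d k x : ENNReal)

theorem isFiniteMeasure_weightMeasure {k : ℕ} (hk : d < k) :
    IsFiniteMeasure (weightMeasure d k) := by
  refine isFiniteMeasure_withDensity ?_
  have h := integrable_one_add_norm (E := Fin d → ℝ) (μ := volume) (r := k) (by simpa using hk)
  have h1 : ∀ x : Fin d → ℝ, (1 + ‖x‖) ^ (-(k : ℝ)) = ((1 + ‖x‖) ^ k)⁻¹ := fun x => by
    rw [Real.rpow_neg (by positivity), Real.rpow_natCast]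
  simp only [h1] at h
  exact h.lintegral_lt_top.ne

theorem integral_weightMeasure {F : Type*} [NormedAddCommGroup F] [NormedSpace ℝ F] (k : ℕ)
    (g : (Fin d → ℝ) → F) :
    ∫ x, g x ∂(weightMeasure d k) = ∫ x, ((1 + ‖x‖) ^ k)⁻¹ • g x := by
  rw [weightMeasure, integral_withDensity_eq_integral_smul (continuous_weight k).measurable]
  refine integral_congr_ae (ae_of_all _ fun x => ?_)
  beta_reduce
  rw [NNReal.smul_def, coe_weight]

/-- A distribution which satisfies the weighted bounds belongs to `O_H`. -/
theorem isOH_of_bound {T : Dist 𝕜 (⊤ : Opens (Fin d → ℝ))}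
    (h : ∀ k : ℕ, ∃ (ι : Type) (_ : Fintype ι) (w : ι → List (Fin d)) (C : ℝ), 0 ≤ C ∧
      ∀ φ : 𝓓((⊤ : Opens (Fin d → ℝ)), 𝕜),
        ‖T φ‖ ≤ C * ∑ i, ∫ x, ((1 + ‖x‖) ^ k)⁻¹ * ‖eulerWord (w i) φ x‖) : IsOH T := by
  classical
  intro k
  -- The surplus `d + 1` makes the weighted measure finite, as the inclusion of `L²` in `L¹`
  -- requires.
  set k₁ := k + d + 1
  obtain ⟨ι, hι, w, C, hC, hw⟩ := h k₁
  set ν := weightMeasure d k₁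
  have hν : IsFiniteMeasure ν := isFiniteMeasure_weightMeasure (by lia)
  have hmem : ∀ (φ : 𝓓((⊤ : Opens (Fin d → ℝ)), 𝕜)) (p : ENNReal), MemLp φ p ν := fun φ p =>
    φ.continuous.memLp_of_hasCompactSupport φ.hasCompactSupport
  let J : ι → 𝓓((⊤ : Opens (Fin d → ℝ)), 𝕜) →ₗ[𝕜] Lp 𝕜 1 ν := fun i =>
    { toFun := fun φ => (memLp_one_of_two (hmem (eulerWord (w i) φ) 2)).toLp _
      map_add' := fun φ ψ => by
        rw [← MemLp.toLp_add]
        refine MemLp.toLp_congr _ _ (ae_of_all _ fun x => ?_)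
        rw [← eulerWordCLM_apply, map_add]
        simp only [eulerWordCLM_apply]
        rfl
      map_smul' := fun c φ => by
        rw [RingHom.id_apply, ← MemLp.toLp_const_smul]
        refine MemLp.toLp_congr _ _ (ae_of_all _ fun x => ?_)
        rw [← eulerWordCLM_apply, map_smul]
        simp only [eulerWordCLM_apply]
        rfl }
  have hJ : ∀ i φ, ‖J i φ‖ = ∫ x, ((1 + ‖x‖) ^ k₁)⁻¹ * ‖eulerWord (w i) φ x‖ := fun i φ =>
    (L1.norm_of_fun_eq_integral_norm (memLp_one_iff_integrable.1
      (memLp_one_of_two (hmem (eulerWord (w i) φ) 2)))).trans (integral_weightMeasure k₁ _)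
  obtain ⟨F, hF⟩ := exists_sum_dual
    ((T : 𝓓((⊤ : Opens (Fin d → ℝ)), 𝕜) →L[𝕜] 𝕜) : 𝓓((⊤ : Opens (Fin d → ℝ)), 𝕜) →ₗ[𝕜] 𝕜) J hC
    fun φ => by
      simp only [hJ]
      exact hw φ
  choose u hum hub hu using fun i => exists_bounded_of_dual_lp_one (F i)
  set β : ι → Fin d → ℕ := fun i j => (w i).count j
  have hwβ : ∀ i (φ : 𝓓((⊤ : Opens (Fin d → ℝ)), 𝕜)), eulerWord (w i) φ =
      eulerTransposePow (β i) φ := fun i φ => eulerWord_eq_eulerTransposePow (w i) φ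
  set t : ι → (Fin d → ℝ) → 𝕜 := fun i x => ((1 + ‖x‖) ^ k₁)⁻¹ • u i x
  have hwc : Continuous fun x : Fin d → ℝ => ((1 + ‖x‖) ^ k₁)⁻¹ :=
    Continuous.inv₀ (by fun_prop) fun x => by positivity
  have htm : ∀ i, StronglyMeasurable (t i) := fun i => hwc.stronglyMeasurable.smul (hum i)
  have htb : ∀ i x, ‖t i x‖ ≤ ((1 + ‖x‖) ^ k₁)⁻¹ * ‖F i‖ := fun i x => by
    rw [norm_smul, Real.norm_of_nonneg (by positivity)]
    exact mul_le_mul_of_nonneg_left (hub i x) (by positivity)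
  have hti : ∀ i (φ : 𝓓((⊤ : Opens (Fin d → ℝ)), 𝕜)), Integrable fun x => t i x * φ x := by
    intro i φ
    refine (φ.continuous.integrable_of_hasCompactSupport φ.hasCompactSupport).bdd_mul (c := ‖F i‖)
      (htm i).aestronglyMeasurable (ae_of_all _ fun x => (htb i x).trans ?_)
    refine mul_le_of_le_one_left (norm_nonneg _) (inv_le_one_of_one_le₀ (one_le_pow₀ ?_))
    linarith [norm_nonneg x]
  refine ⟨Finset.univ.image β, fun b x => ∑ i with β i = b, t i x, fun b _ => ?_, fun φ => ?_⟩
  -- Different words may have the same multiplicities, hence the densities are summed over each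
  -- fibre of `β`.
  · have hsq : Continuous fun x : Fin d → ℝ => (1 + ∑ j, x j ^ 2 : ℝ) ^ ((k : ℝ) / 2) :=
      Continuous.rpow_const (by fun_prop) fun x => Or.inr (by positivity)
    refine memLp_top_of_bound (hsq.aestronglyMeasurable.smul
      (Finset.stronglyMeasurable_fun_sum _ fun i _ => htm i).aestronglyMeasurable)
      ((1 + d) ^ ((k : ℝ) / 2) * ∑ i, ‖F i‖) (ae_of_all _ fun x => ?_)
    have h1 : (1 + ∑ j, x j ^ 2 : ℝ) ≤ (1 + d) * (1 + ‖x‖) ^ 2 := by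
      have h2 : ∑ j, x j ^ 2 ≤ d * ‖x‖ ^ 2 := by
        refine (Finset.sum_le_card_nsmul Finset.univ _ (‖x‖ ^ 2) fun j _ => ?_).trans_eq (by simp)
        rw [← sq_abs]
        exact pow_le_pow_left₀ (abs_nonneg _) (norm_le_pi_norm x j) 2
      have h3 : (0 : ℝ) ≤ d := d.cast_nonneg
      nlinarith [norm_nonneg x, mul_nonneg h3 (norm_nonneg x)]
    have h2 : (1 + ∑ j, x j ^ 2 : ℝ) ^ ((k : ℝ) / 2) ≤ (1 + d) ^ ((k : ℝ) / 2) * (1 + ‖x‖) ^ k := by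
      refine (Real.rpow_le_rpow (by positivity) h1 (by positivity)).trans_eq ?_
      rw [Real.mul_rpow (by positivity) (by positivity), ← Real.rpow_natCast (1 + ‖x‖) 2,
        ← Real.rpow_mul (by positivity), ← Real.rpow_natCast (1 + ‖x‖) k]
      congr 2
      push_cast
      ring
    have h3 : ‖∑ i with β i = b, t i x‖ ≤ ((1 + ‖x‖) ^ k₁)⁻¹ * ∑ i, ‖F i‖ := by
      rw [Finset.mul_sum]
      refine (norm_sum_le_of_le _ fun i _ => htb i x).trans ?_
      exact Finset.sum_le_univ_sum_of_nonneg fun i => by positivity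
    have h4 : (1 + ‖x‖) ^ k * ((1 + ‖x‖) ^ k₁)⁻¹ ≤ 1 := by
      rw [← div_eq_mul_inv, div_le_one (by positivity)]
      exact pow_le_pow_right₀ (by linarith [norm_nonneg x]) (by lia)
    have hS : 0 ≤ ∑ i, ‖F i‖ := Finset.sum_nonneg fun i _ => norm_nonneg _
    rw [norm_smul, Real.norm_of_nonneg (by positivity)]
    calc (1 + ∑ j, x j ^ 2 : ℝ) ^ ((k : ℝ) / 2) * ‖∑ i with β i = b, t i x‖
        ≤ ((1 + d) ^ ((k : ℝ) / 2) * (1 + ‖x‖) ^ k) * (((1 + ‖x‖) ^ k₁)⁻¹ * ∑ i, ‖F i‖) :=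
          mul_le_mul h2 h3 (norm_nonneg _) (by positivity)
      _ = (1 + d) ^ ((k : ℝ) / 2) * ((1 + ‖x‖) ^ k * ((1 + ‖x‖) ^ k₁)⁻¹) * ∑ i, ‖F i‖ := by ring
      _ ≤ (1 + d) ^ ((k : ℝ) / 2) * 1 * ∑ i, ‖F i‖ := by gcongr
      _ = _ := by ring
  · have h1 : T φ = ∑ i, ∫ x, t i x * eulerTransposePow (β i) φ x := by
      refine (hF φ).trans (Finset.sum_congr rfl fun i _ => ?_)
      refine (hu i _ (hmem (eulerWord (w i) φ) 2)).trans ?_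
      rw [integral_weightMeasure, ← hwβ]
      simp only [t, smul_mul_assoc]
    rw [h1, ← Finset.sum_fiberwise_of_maps_to (g := β) (t := Finset.univ.image β)
      fun i _ => Finset.mem_image_of_mem β (Finset.mem_univ i)]
    refine Finset.sum_congr rfl fun b _ => ?_
    simp only [Finset.sum_mul]
    rw [integral_finsetSum _ fun i _ => hti i _]
    refine Finset.sum_congr rfl fun i hi => ?_
    rw [(Finset.mem_filter.1 hi).2]

theorem exists_isDH_of_isHadamardOperator (h0 : (0 : Fin d → ℝ) ∈ Ω)
    {L : Dist 𝕜 Ω → Dist 𝕜 Ω} (hL : IsHadamardOperator L) :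
    ∃ T : Dist 𝕜 (⊤ : Opens (Fin d → ℝ)),
      IsDH T ∧ SupportCondition Ω T ∧ ∀ S : Dist 𝕜 Ω, IsMulConv S T (L S) := by
  obtain ⟨M, hM⟩ := exists_transpose hL.isLinearMap hL.continuous
  have h : IsTranspose L M := ⟨hL, hM⟩
  obtain ⟨T, hT⟩ := h.exists_dist h0
  exact ⟨T, ⟨isOH_of_bound (h.exists_bound_dist h0 hT), h.exists_support_bound h0 hT⟩,
    h.supportCondition h0 hT, fun S φ => ⟨M φ, hT φ, h.apply S φ⟩⟩

end Representation

end HadamardOp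
end

theorem theorem4p1 {𝕜 : Type*} [RCLike 𝕜] (d : ℕ) (Ω : TopologicalSpace.Opens (Fin d → ℝ))
    (h0 : (0 : Fin d → ℝ) ∈ Ω) :
    (∀ L : HadamardOp.Dist 𝕜 Ω → HadamardOp.Dist 𝕜 Ω,
      HadamardOp.IsHadamardOperator L ↔
        ∃ T : HadamardOp.Dist 𝕜 (⊤ : TopologicalSpace.Opens (Fin d → ℝ)),
          HadamardOp.IsDH T ∧ HadamardOp.SupportCondition Ω T ∧
            ∀ S : HadamardOp.Dist 𝕜 Ω, HadamardOp.IsMulConv S T (L S)) ∧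
    (∀ T : HadamardOp.Dist 𝕜 (⊤ : TopologicalSpace.Opens (Fin d → ℝ)),
      HadamardOp.IsDH T → HadamardOp.SupportCondition Ω T →
        ∀ S : HadamardOp.Dist 𝕜 Ω, ∃ U : HadamardOp.Dist 𝕜 Ω, HadamardOp.IsMulConv S T U) :=
  ⟨fun _ => ⟨HadamardOp.exists_isDH_of_isHadamardOperator h0,
    fun ⟨_, hT, hs, h⟩ => HadamardOp.isHadamardOperator_of_isMulConv hT hs h⟩,
    fun _ hT hs S => HadamardOp.exists_isMulConv hT hs S⟩
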